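/- Let $n\ge 1$ and let $A$ be an $n\times n$ matrix of complex-valued, measurable coefficients on $\mathbb{R}^n$ that is bounded and elliptic: there are $0<\lambda\le\Lambda<\infty$ such that, for a.e. $x\in\mathbb{R}^n$ and all $\xi,\zeta\in\mathbb{C}^n$, $\lambda|\xi|^2\le \operatorname{Re} A(x)\xi\cdot\bar\xi$ and $|A(x)\xi\cdot\bar\zeta|\le\Lambda|\xi||\zeta|$. Let $L=-\operatorname{div}(A\nabla\,\cdot\,)$ be the associated maximal-accretive operator on $L^2(\mathbb{R}^n)$: $u\in\mathcal D(L)$ and $Lu=h$ if and only if $u\in W^{1,2}(\mathbb{R}^n)$, $h\in L^2(\mathbb{R}^n)$ and $\int A\nabla u\cdot\overline{\nabla v}\,dx=\int h\,\bar v\,dx$ for all $v\in W^{1,2}(\mathbb{R}^n)$. Then $-L$ generates a $C^0$-semigroup of contractions $\{e^{-tL}\}_{t\ge0}$ on $L^2(\mathbb{R}^n)$. For $f\in L^2(\mathbb{R}^n)$, $t>0$ and $m\in\mathbb{N}_0=\{0,1,2,\dots\}$, write $u_{m,t}:=(t^2L)^me^{-t^2L}f$. Then $e^{-t^2L}f\in\mathcal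 D(L^{m+1})$, $u_{m,t}\in W^{1,2}(\mathbb{R}^n)$, and $t\mapsto u_{m,t}$ is differentiable on $(0,\infty)$ as an $L^2(\mathbb{R}^n)$-valued function, so that the following conical square functions are well defined with values in $[0,\infty]$: with $\Gamma(x)=\{(y,t)\in\mathbb{R}^n\times(0,\infty):|x-y|<t\}$, $$ \mathcal S_{m,H}f(x)=\Big(\iint_{\Gamma(x)}|u_{m,t}(y)|^2\frac{dy\,dt}{t^{n+1}}\Big)^{1/2}, $$ $$ \mathrm G_{m,H}f(x)=\Big(\iint_{\Gamma(x)}|t\nabla_y u_{m,t}(y)|^2\frac{dy\,dt}{t^{n+1}}\Big)^{1/2}, \qquad \mathcal G_{m,H}f(x)=\Big(\iint_{\Gamma(x)}|t\nabla_{y,t} u_{m,t}(y)|^2\frac{dy\,dt}{t^{n+1}}\Big)^{1/2}, $$ where $|\nabla_{y,t}u_{m,t}|^2=|\nabla_yu_{m,t}|^2+|\partial_tu_{m,t}|^2$. Put $\mathcal S_Hf=\mathcal S_{1,H}f$. For a weight $w$ (a locally integrable function that is positive a.e.) write $\|F\|_{L^p(w)}=\big(\int_{\mathbb{R}^n}|F|^p\,w\,dx\big)^{1/p}$,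 and let $A_\infty=\bigcup_{1\le p<\infty}A_p$ be the union of the Muckenhoupt classes. Moreover, the following hold. (a) For every $f\in L^2(\mathbb{R}^n)$, every $m\in\mathbb{N}_0$ and every $x\in\mathbb{R}^n$, $\mathrm G_{m,H}f(x)\le\mathcal G_{m,H}f(x)$. (b) For every integer $m\ge1$, every $w\in A_\infty$ and every $0<p<\infty$ there is a constant $C<\infty$ such that $\|\mathcal S_{m,H}f\|_{L^p(w)}\le C\,\|\mathcal S_Hf\|_{L^p(w)}$ for all $f\in L^2(\mathbb{R}^n)$. (c) For every integer $m\ge1$, every $w\in A_\infty$ and every $0<p<\infty$ there is a constant $C<\infty$ such that $\|\mathcal G_{m,H}f\|_{L^p(w)}\le C\,\|\mathcal S_Hf\|_{L^p(w)}$ for all $f\in L^2(\mathbb{R}^n)$. -/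

import Mathlib

open MeasureTheory Set Filter Topology
open scoped ENNReal NNReal Matrix ContDiff

noncomputable section

/-- Euclidean space `ℝⁿ`. -/
abbrev RSpace (n : ℕ) : Type := EuclideanSpace ℝ (Fin n)

/-- The complex Hilbert space `L²(ℝⁿ)`. -/
abbrev L2Space (n : ℕ) : Type := Lp ℂ 2 (volume : Measure (RSpace n))

/-! ### The elliptic operator `L = -div(A ∇ ·)` -/

/-- The pairing `M ξ · conj ζ = ∑ j k, M j k * ξ k * conj (ζ j)`. -/
def sesqPairing {n : ℕ} (M : Matrix (Fin n) (Fin n) ℂ) (ξ ζ : Fin n → ℂ) : ℂ :=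
  (M *ᵥ ξ) ⬝ᵥ star ζ

/-- A matrix of (measurable) complex `L^∞` coefficients which is elliptic. The upper bound `Λ`
contains the boundedness of the coefficients. -/
structure IsElliptic {n : ℕ} (A : RSpace n → Matrix (Fin n) (Fin n) ℂ) : Prop where
  aestronglyMeasurable : ∀ j k, AEStronglyMeasurable (fun x => A x j k) volume
  bounds : ∃ l u : ℝ, 0 < l ∧ l ≤ u ∧
    ∀ᵐ x, ∀ ξ ζ : EuclideanSpace ℂ (Fin n),
      l * ‖ξ‖ ^ 2 ≤ (sesqPairing (A x) (fun k => ξ k) (fun k => ξ k)).re ∧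
      ‖sesqPairing (A x) (fun k => ξ k) (fun k => ζ k)‖ ≤ u * ‖ξ‖ * ‖ζ‖

/-- `g = ∇u` in the sense of distributions, where `u` and all `g j` are in `L²(ℝⁿ)`. -/
def HasWeakGradient {n : ℕ} (u : L2Space n) (g : Fin n → L2Space n) : Prop :=
  ∀ (j : Fin n) (φ : RSpace n → ℝ), ContDiff ℝ ∞ φ → HasCompactSupport φ →
    ∫ x, (fderiv ℝ φ x (EuclideanSpace.single j 1)) • u x = - ∫ x, φ x • g j x

open Classical in
/-- The weak gradient of `u ∈ W^{1,2}(ℝⁿ)`. -/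
def weakGradient {n : ℕ} (u : L2Space n) : Fin n → L2Space n :=
  if h : ∃ g, HasWeakGradient u g then h.choose else 0

/-- `u` belongs to the domain of `L = -div(A ∇ ·)` and `L u = h`: `u ∈ W^{1,2}(ℝⁿ)` and
`∫ A ∇u · conj ∇v = ∫ h conj v` for every `v ∈ W^{1,2}(ℝⁿ)`. -/
def IsEllipticImage {n : ℕ} (A : RSpace n → Matrix (Fin n) (Fin n) ℂ) (u h : L2Space n) : Prop :=
  ∃ g, HasWeakGradient u g ∧ ∀ v k, HasWeakGradient v k →
    ∫ x, sesqPairing (A x) (fun i => g i x) (fun i => k i x) =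
      ∫ x, h x * starRingEnd ℂ (v x)

/-- The domain of `L` in `L²(ℝⁿ)`. -/
def ellipticDomain {n : ℕ} (A : RSpace n → Matrix (Fin n) (Fin n) ℂ) : Set (L2Space n) :=
  {u | ∃ h, IsEllipticImage A u h}

open Classical in
/-- The operator `L` (with value `0` off its domain). -/
def ellipticOp {n : ℕ} (A : RSpace n → Matrix (Fin n) (Fin n) ℂ) (u : L2Space n) : L2Space n :=
  if h : ∃ w, IsEllipticImage A u w then h.choose else 0

/-! ### The heat semigroup -/

/-- `T` (restricted to `t ≥ 0`) is the `C⁰`-semigroup of contractions on `L²(ℝⁿ)` generated by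
`-L`: the domain of its generator is the domain of `L`, and the generator equals `-L` there. -/
structure IsHeatSemigroup {n : ℕ} (A : RSpace n → Matrix (Fin n) (Fin n) ℂ)
    (T : ℝ → L2Space n →L[ℂ] L2Space n) : Prop where
  map_zero : T 0 = ContinuousLinearMap.id ℂ (L2Space n)
  map_add : ∀ s t, 0 ≤ s → 0 ≤ t → T (s + t) = (T s).comp (T t)
  contraction : ∀ t, 0 ≤ t → ‖T t‖ ≤ 1
  continuous : ∀ f, Tendsto (fun t => T t f) (𝓝[>] 0) (𝓝 f)
  generator : ∀ u h, IsEllipticImage A u h ↔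
    Tendsto (fun t : ℝ => t⁻¹ • (T t u - u)) (𝓝[>] 0) (𝓝 (-h))

open Classical in
/-- The heat semigroup `e^{-tL}`, `t ≥ 0`. -/
def heatSemigroup {n : ℕ} (A : RSpace n → Matrix (Fin n) (Fin n) ℂ) :
    ℝ → L2Space n →L[ℂ] L2Space n :=
  if h : ∃ T, IsHeatSemigroup A T then h.choose else 0

/-- `(t² L)^m e^{-t² L} f`. -/
def heatFamily {n : ℕ} (A : RSpace n → Matrix (Fin n) (Fin n) ℂ) (m : ℕ) (f : L2Space n)
    (t : ℝ) : L2Space n :=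
  ((t ^ 2) ^ m : ℝ) • (ellipticOp A)^[m] (heatSemigroup A (t ^ 2) f)

/-! ### Conical square functions -/

/-- `(∬_{Γ(x)} |F(y,t)|² dy dt / t^{n+1})^{1/2}`, where `Γ(x) = {(y,t) : t > 0, |x - y| < t}`. The
double integral is iterated, so that it only depends on the a.e. classes `F(·,t)`, `t > 0`. -/
def conicalSquare {n : ℕ} (F : ℝ → RSpace n → ℝ) (x : RSpace n) : ℝ≥0∞ :=
  (∫⁻ t in Ioi (0 : ℝ), ∫⁻ y in Metric.ball x t,
    ‖F t y‖ₑ ^ 2 / ENNReal.ofReal (t ^ (n + 1))) ^ (1 / 2 : ℝ)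

/-- `𝒮_{m,H} f(x)`, with integrand `|(t²L)^m e^{-t²L} f(y)|²`. -/
def squareS {n : ℕ} (A : RSpace n → Matrix (Fin n) (Fin n) ℂ) (m : ℕ) (f : L2Space n) :
    RSpace n → ℝ≥0∞ :=
  conicalSquare fun t y => ‖heatFamily A m f t y‖

/-- `G_{m,H} f(x)`, with integrand `|t ∇_y (t²L)^m e^{-t²L} f(y)|²`. -/
def squareG {n : ℕ} (A : RSpace n → Matrix (Fin n) (Fin n) ℂ) (m : ℕ) (f : L2Space n) :
    RSpace n → ℝ≥0∞ :=
  conicalSquare fun t y => t * √(∑ j, ‖weakGradient (heatFamily A m f t) j y‖ ^ 2)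

/-- `𝒢_{m,H} f(x)`, with integrand `|t ∇_{y,t} (t²L)^m e^{-t²L} f(y)|²`; the `t`-derivative is that
of the `L²(ℝⁿ)`-valued function `t ↦ (t²L)^m e^{-t²L} f`. -/
def squareGFull {n : ℕ} (A : RSpace n → Matrix (Fin n) (Fin n) ℂ) (m : ℕ) (f : L2Space n) :
    RSpace n → ℝ≥0∞ :=
  conicalSquare fun t y => t * √((∑ j, ‖weakGradient (heatFamily A m f t) j y‖ ^ 2) +
    ‖deriv (heatFamily A m f) t y‖ ^ 2)

/-! ### Muckenhoupt weights -/

/-- Weights: locally integrable positive functions. -/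
structure IsWeight {n : ℕ} (w : RSpace n → ℝ) : Prop where
  locallyIntegrable : LocallyIntegrable w volume
  pos : ∀ᵐ x, 0 < w x

/-- The condition `A₁`. -/
def MuckenhouptA1 {n : ℕ} (w : RSpace n → ℝ) : Prop :=
  ∃ C : ℝ≥0, ∀ (c : RSpace n) (r : ℝ), 0 < r → ∀ᵐ y ∂(volume.restrict (Metric.ball c r)),
    ⨍⁻ x in Metric.ball c r, ENNReal.ofReal (w x) ∂volume ≤ C * ENNReal.ofReal (w y)

/-- The condition `A_p`, `1 < p < ∞`. -/
def MuckenhouptAp {n : ℕ} (p : ℝ) (w : RSpace n → ℝ) : Prop :=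
  ∃ C : ℝ≥0, ∀ (c : RSpace n) (r : ℝ), 0 < r →
    (⨍⁻ x in Metric.ball c r, ENNReal.ofReal (w x) ∂volume) *
      (⨍⁻ x in Metric.ball c r, ENNReal.ofReal (w x) ^ (1 - p.conjExponent) ∂volume) ^ (p - 1)
        ≤ C

/-- `w ∈ A_∞ = ⋃_{1 ≤ p < ∞} A_p`. -/
def MuckenhouptAInfty {n : ℕ} (w : RSpace n → ℝ) : Prop :=
  IsWeight w ∧ (MuckenhouptA1 w ∨ ∃ p : ℝ, 1 < p ∧ MuckenhouptAp p w)

/-- The (quasi-)norm of `L^p(w)`, `0 < p < ∞`. -/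
def weightedNorm {n : ℕ} (p : ℝ) (w : RSpace n → ℝ) (F : RSpace n → ℝ≥0∞) : ℝ≥0∞ :=
  eLpNorm F (ENNReal.ofReal p) (volume.withDensity fun x => ENNReal.ofReal (w x))


/-! ### The choices in `weakGradient` and `ellipticOp` are unambiguous -/

theorem HasWeakGradient.unique {n : ℕ} {u : L2Space n} {g g' : Fin n → L2Space n}
    (h : HasWeakGradient u g) (h' : HasWeakGradient u g') : g = g' := by
  funext j
  have hli : ∀ v : L2Space n, LocallyIntegrable v volume := fun v =>
    (Lp.memLp v).locallyIntegrable (by norm_num)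
  apply Lp.ext
  refine ae_eq_of_integral_contDiff_smul_eq (hli _) (hli _) ?_
  intro φ hφ hc
  exact neg_injective ((h j φ hφ hc).symm.trans (h' j φ hφ hc))

theorem hasWeakGradient_toLp {n : ℕ} {φ : RSpace n → ℝ} (hφ : ContDiff ℝ ∞ φ)
    (hc : HasCompactSupport φ) : ∃ (v : L2Space n) (k : Fin n → L2Space n),
      HasWeakGradient v k ∧ v =ᵐ[volume] fun x => (φ x : ℂ) := by
  have hd : ∀ j : Fin n, Continuous fun x => fderiv ℝ φ x (EuclideanSpace.single j 1) := fun j =>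
    (hφ.continuous_fderiv (by simp)).clm_apply continuous_const
  have hdc : ∀ j : Fin n, HasCompactSupport fun x => fderiv ℝ φ x (EuclideanSpace.single j 1) :=
    fun j => hc.fderiv_apply ℝ _
  have hm : ∀ ψ : RSpace n → ℝ, Continuous ψ → HasCompactSupport ψ →
      MemLp (fun x => (ψ x : ℂ)) 2 (volume : Measure (RSpace n)) := fun ψ h1 h2 =>
    (h1.memLp_of_hasCompactSupport h2).ofReal
  refine ⟨(hm φ hφ.continuous hc).toLp _, fun j => (hm _ (hd j) (hdc j)).toLp _, ?_,
    MemLp.coeFn_toLp _⟩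
  intro j ψ hψ hψc
  have e1 : ∫ x, (fderiv ℝ ψ x (EuclideanSpace.single j 1)) •
      ((hm φ hφ.continuous hc).toLp _ : L2Space n) x =
      ∫ x, ((fderiv ℝ ψ x (EuclideanSpace.single j 1) * φ x : ℝ) : ℂ) := by
    refine integral_congr_ae ?_
    filter_upwards [MemLp.coeFn_toLp (hm φ hφ.continuous hc)] with x hx
    rw [hx]; simp
  have e2 : ∫ x, ψ x • ((hm _ (hd j) (hdc j)).toLp _ : L2Space n) x =
      ∫ x, ((ψ x * fderiv ℝ φ x (EuclideanSpace.single j 1) : ℝ) : ℂ) := by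
    refine integral_congr_ae ?_
    filter_upwards [MemLp.coeFn_toLp (hm _ (hd j) (hdc j))] with x hx
    rw [hx]; simp
  rw [e1, e2, integral_complex_ofReal, integral_complex_ofReal, ← Complex.ofReal_neg]
  congr 1
  have hdψ : Continuous fun x => fderiv ℝ ψ x (EuclideanSpace.single j 1) :=
    (hψ.continuous_fderiv (by simp)).clm_apply continuous_const
  rw [integral_mul_fderiv_eq_neg_fderiv_mul_of_integrable, neg_neg]
  · exact (hdψ.mul hφ.continuous).integrable_of_hasCompactSupport hc.mul_left
  · exact (hψ.continuous.mul (hd j)).integrable_of_hasCompactSupport (hdc j).mul_left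
  · exact (hψ.continuous.mul hφ.continuous).integrable_of_hasCompactSupport hc.mul_left
  · exact fun x _ => hψ.differentiable (by simp) x
  · exact fun x _ => hφ.differentiable (by simp) x

theorem IsEllipticImage.unique {n : ℕ} {A : RSpace n → Matrix (Fin n) (Fin n) ℂ}
    {u h h' : L2Space n} (H : IsEllipticImage A u h) (H' : IsEllipticImage A u h') : h = h' := by
  obtain ⟨g, hg, H⟩ := H
  obtain ⟨g', hg', H'⟩ := H'
  obtain rfl := hg.unique hg'
  have hli : ∀ v : L2Space n, LocallyIntegrable v volume := fun v =>
    (Lp.memLp v).locallyIntegrable (by norm_num)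
  apply Lp.ext
  refine ae_eq_of_integral_contDiff_smul_eq (hli _) (hli _) ?_
  intro φ hφ hc
  obtain ⟨v, k, hvk, hv⟩ := hasWeakGradient_toLp hφ hc
  have e : ∀ w : L2Space n, ∫ x, w x * starRingEnd ℂ (v x) = ∫ x, φ x • w x := by
    intro w
    refine integral_congr_ae ?_
    filter_upwards [hv] with x hx
    rw [hx]; simp [mul_comm]
  rw [← e, ← e, ← H v k hvk, ← H' v k hvk]

end

/-!
# Conical square functions of the heat semigroup of an elliptic operator

The heat semigroup is constructed from the sesquilinear form by the theorems of Lax–Milgram and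
Hille–Yosida (`isMaxAccretive_isEllipticImage`, `IsMaxAccretive.exists_semigroup`). The comparison
of square functions then rests on a localized domination at each scale `t`, followed by a change of
aperture.

**Localized domination.** Since
`t² L e^{-t² L} = 4 e^{-(3/4) t² L} ((t/2)² L e^{-(t/2)² L})`, the functions `u_{m,t}`, `m ≥ 1`,
together with `t ∂_t u_{m,t} = 2 m u_{m,t} - 2 u_{m+1,t}`, are combinations of the images of
`u_{1,t/2}` under the operators `(t² L)^k e^{-(3/4) t² L}`. These are bounded on `L²(e^{2ψ} dx)`,
uniformly in `t` and `ψ`, as long as `|∇ψ| ≤ 1/t`; and `t ∇_y u_{m,t}` is added by Caccioppoli's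
inequality (`exists_norm_heatFamily_le`, `exists_norm_gradient_heatFamily_le`). Energy estimates
replace the analyticity of the semigroup here. The weighted bound for `s L e^{-sL}` comes from
duality: for the adjoint semigroup `T'`, the number `⟨v, L T_s u⟩` equals
`⟨T'_{s-r} v, L T_r u⟩` for every `r ∈ [0, s]`, hence is at most a constant times the product of the
weighted dissipations of `T_r u` and `T'_{s-r} v`, with dual weights, and the squares of the
dissipations are integrable in `r` (`IsContractionSemigroup.norm_inner_le`). With `ψ` close to
`-|y - x| / t`, this bounds the squared `L²`-norms on `B(x, t)` of the integrands of `𝒮_m` and `𝒢_m`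
by a sum over `j` of the squared `L²`-norms of `u_{1,t/2}` on `B(x, 2^j t)`, with coefficients
`e^{-2^j}` (`setLIntegral_ball_le_tsum`).
Integrating in `t`, the square functions squared are controlled pointwise by a series of squares of
`𝒮_1` over cones of aperture `2^{j+1}` (`conicalSquare_le_tsum_coneMeasure`).

**Change of aperture.** For the doubling measure `μ = w dx`, `w ∈ A_∞`, and any exponent, passing
from aperture `1` to aperture `2` costs a constant factor in `L^p(w)`, so that aperture `2^j` costs
`C^j`, for which the decay of the coefficients `e^{-2^j}` makes up. As the square of `𝒮_1`
is the measure of a cone, Tonelli's theorem gives the case `p = 2`; the case `p < 2` follows from a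
distributional inequality, and the case `p > 2` by duality. Both use only the maximal
function of `μ` (`IsDoublingOnBalls.exists_lintegral_coneMeasure_two_le`).
-/

/-! ### Contraction semigroups generated by maximal accretive operators -/

section Semigroup

variable {H : Type*} [NormedAddCommGroup H] [InnerProductSpace ℂ H]

/-- A single-valued linear relation `R u h`, read `L u = h`, is maximal accretive if
`Re ⟨u, L u⟩ ≥ 0` and `1 + ε L` is onto for every `ε > 0`. -/
structure IsMaxAccretive (R : H → H → Prop) : Prop where
  add : ∀ {u h v k}, R u h → R v k → R (u + v) (h + k)
  smul : ∀ (c : ℂ) {u h}, R u h → R (c • u) (c • h)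
  unique : ∀ {u h k}, R u h → R u k → h = k
  accretive : ∀ {u h}, R u h → 0 ≤ (inner ℂ u h).re
  surj : ∀ ε : ℝ, 0 < ε → ∀ f, ∃ u h, R u h ∧ u + (ε : ℂ) • h = f

namespace IsMaxAccretive

variable {R : H → H → Prop}

theorem sub (hR : IsMaxAccretive R) {u h v k : H} (h1 : R u h) (h2 : R v k) :
    R (u - v) (h - k) := by
  have := hR.add h1 (hR.smul (-1) h2)
  simpa [sub_eq_add_neg] using this

theorem norm_le_norm_add (hR : IsMaxAccretive R) {u h : H} (h1 : R u h) {ε : ℝ} (hε : 0 ≤ ε) :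
    ‖u‖ ≤ ‖u + (ε : ℂ) • h‖ := by
  have h2 : ‖u‖ ^ 2 ≤ (inner ℂ u (u + (ε : ℂ) • h)).re := by
    rw [inner_add_right, inner_smul_right, inner_self_eq_norm_sq_to_K]
    have := mul_nonneg hε (hR.accretive h1)
    simp only [Complex.add_re, Complex.re_ofReal_mul, Complex.coe_algebraMap, ← Complex.ofReal_pow,
      Complex.ofReal_re]
    linarith
  have h3 : (inner ℂ u (u + (ε : ℂ) • h)).re ≤ ‖u‖ * ‖u + (ε : ℂ) • h‖ :=
    (Complex.re_le_norm _).trans (norm_inner_le_norm _ _)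
  by_contra! hlt
  have h4 : 0 < ‖u‖ := (norm_nonneg _).trans_lt hlt
  nlinarith

/-- The resolvent `(1 + ε L)⁻¹` is a contraction. -/
theorem exists_resolvent (hR : IsMaxAccretive R) {ε : ℝ} (hε : 0 < ε) : ∃ J : H →L[ℂ] H,
    (∀ u h, R u h → J (u + (ε : ℂ) • h) = u) ∧
    (∀ f, R (J f) ((ε : ℂ)⁻¹ • (f - J f))) ∧ ∀ f, ‖J f‖ ≤ ‖f‖ := by
  choose U K hUK hf using hR.surj ε hε
  have hε' : (ε : ℂ) ≠ 0 := by exact_mod_cast hε.ne'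
  have key : ∀ u h, R u h → U (u + (ε : ℂ) • h) = u := by
    intro u h h1
    have h2 := hR.norm_le_norm_add (hR.sub (hUK (u + (ε : ℂ) • h)) h1) hε.le
    have h3 := hf (u + (ε : ℂ) • h)
    have h4 : U (u + (ε : ℂ) • h) - u + (ε : ℂ) • (K (u + (ε : ℂ) • h) - h) = 0 := by
      rw [smul_sub, sub_add_sub_comm, h3, sub_self]
    rw [h4, norm_zero] at h2
    exact sub_eq_zero.1 (norm_le_zero_iff.1 h2)
  let J : H →ₗ[ℂ] H :=
    { toFun := U
      map_add' := fun f g => by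
        have := key _ _ (hR.add (hUK f) (hUK g))
        rw [← this]
        congr 1
        conv_lhs => rw [← hf f, ← hf g]
        rw [smul_add]; abel
      map_smul' := fun c f => by
        have := key _ _ (hR.smul c (hUK f))
        rw [RingHom.id_apply, ← this]
        congr 1
        conv_lhs => rw [← hf f]
        rw [smul_add, smul_comm] }
  have hb : ∀ f, ‖J f‖ ≤ 1 * ‖f‖ := fun f => by
    have := hR.norm_le_norm_add (hUK f) hε.le
    rw [hf f] at this
    simpa [J] using this
  refine ⟨J.mkContinuous 1 hb, key, fun f => ?_, fun f => by simpa using hb f⟩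
  have : (ε : ℂ)⁻¹ • (f - U f) = K f := by
    rw [← eq_sub_iff_add_eq'.2 (hf f), smul_smul, inv_mul_cancel₀ hε', one_smul]
  change R (U f) ((ε : ℂ)⁻¹ • (f - U f))
  rw [this]; exact hUK f

/-- A vector orthogonal to the domain vanishes: it equals `u + L u`, and testing with `u` gives
`‖u‖² + Re ⟨u, L u⟩ = 0`. -/
theorem dense_domain [CompleteSpace H] (hR : IsMaxAccretive R) : Dense {u | ∃ h, R u h} := by
  let D : Submodule ℂ H :=
    { carrier := {u | ∃ h, R u h}
      add_mem' := fun ⟨_, h1⟩ ⟨_, h2⟩ => ⟨_, hR.add h1 h2⟩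
      zero_mem' := by
        obtain ⟨u, h, h1, -⟩ := hR.surj 1 one_pos 0
        exact ⟨_, by simpa using hR.smul 0 h1⟩
      smul_mem' := fun c _ ⟨_, h1⟩ => ⟨_, hR.smul c h1⟩ }
  have : D.topologicalClosure = ⊤ := by
    rw [Submodule.topologicalClosure_eq_top_iff, Submodule.eq_bot_iff]
    intro f hf
    obtain ⟨u, h, h1, h2⟩ := hR.surj 1 one_pos f
    have h3 : inner ℂ u f = 0 := hf u ⟨h, h1⟩
    have h4 := hR.accretive h1
    have h5 : (inner ℂ u f).re = ‖u‖ ^ 2 + (inner ℂ u h).re := by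
      rw [← h2, inner_add_right, inner_self_eq_norm_sq_to_K]
      simp only [Complex.add_re, Complex.coe_algebraMap, ← Complex.ofReal_pow,
        Complex.ofReal_re, Complex.ofReal_one, one_smul]
    rw [h3, Complex.zero_re] at h5
    have h6 : u = 0 := by
      have : ‖u‖ ^ 2 = 0 := le_antisymm (by linarith) (by positivity)
      simpa using this
    subst h6
    have h7 : h = 0 := hR.unique h1 (by simpa using hR.smul 0 h1)
    simp [← h2, h7]
  have h2 : Dense (D : Set H) := by
    rw [← Submodule.dense_iff_topologicalClosure_eq_top] at this
    exact this
  exact h2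

/-- An accretive limit of the graph belongs to the graph. -/
theorem mem_of_accretive (hR : IsMaxAccretive R) {u h : H}
    (H1 : ∀ v k, R v k → 0 ≤ (inner ℂ (u - v) (h - k)).re) : R u h := by
  obtain ⟨v, k, h1, h2⟩ := hR.surj 1 one_pos (u + h)
  have h3 := H1 v k h1
  have h4 : h - k = -(u - v) := by
    rw [Complex.ofReal_one, one_smul] at h2
    rw [neg_sub, sub_eq_sub_iff_add_eq_add, add_comm, ← h2]
  rw [h4, inner_neg_right, inner_self_eq_norm_sq_to_K] at h3
  simp only [Complex.neg_re, Complex.coe_algebraMap, ← Complex.ofReal_pow, Complex.ofReal_re] at h3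
  have h5 : u - v = 0 := by
    have : ‖u - v‖ ^ 2 = 0 := le_antisymm (by linarith) (by positivity)
    simpa using this
  have h6 : h = k := by rw [h5, neg_zero] at h4; exact sub_eq_zero.1 h4
  rw [sub_eq_zero.1 h5, h6]; exact h1

theorem mem_of_tendsto (hR : IsMaxAccretive R) {ι : Type*} {l : Filter ι} [l.NeBot]
    {u h : ι → H} {u₀ h₀ : H}
    (H1 : ∀ i, R (u i) (h i)) (hu : Tendsto u l (𝓝 u₀)) (hh : Tendsto h l (𝓝 h₀)) : R u₀ h₀ := by
  refine hR.mem_of_accretive fun v k hv => ?_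
  have : Tendsto (fun i => (inner ℂ (u i - v) (h i - k)).re) l
      (𝓝 (inner ℂ (u₀ - v) (h₀ - k)).re) :=
    (Complex.continuous_re.tendsto _).comp ((hu.sub_const v).inner (hh.sub_const k))
  exact ge_of_tendsto' this fun i => hR.accretive (hR.sub (H1 i) hv)

end IsMaxAccretive

/-- Uniformly bounded operators which converge on a dense set converge everywhere. -/
theorem tendsto_of_dense_of_norm_le {ι : Type*} {l : Filter ι} {P : ι → H →L[ℂ] H}
    {Q : H →L[ℂ] H} (hP : ∀ᶠ i in l, ∀ f, ‖P i f‖ ≤ ‖f‖) (hQ : ∀ f, ‖Q f‖ ≤ ‖f‖) {D : Set H}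
    (hD : Dense D) (H1 : ∀ f ∈ D, Tendsto (fun i => P i f) l (𝓝 (Q f))) (f : H) :
    Tendsto (fun i => P i f) l (𝓝 (Q f)) := by
  rw [Metric.tendsto_nhds]
  intro ε hε
  obtain ⟨g, hg, hfg⟩ := Metric.dense_iff.1 hD f (ε / 3) (by positivity)
  rw [Metric.mem_ball, dist_eq_norm] at hg
  filter_upwards [hP, Metric.tendsto_nhds.1 (H1 g hfg) (ε / 3) (by positivity)] with i hi1 hi2
  rw [dist_eq_norm] at hi2 ⊢
  have e : P i f - Q f = -P i (g - f) + (P i g - Q g) + Q (g - f) := by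
    simp only [map_sub]; abel
  rw [e]
  have h1 := hi1 (g - f)
  have h2 := hQ (g - f)
  have h3 := norm_add_le (-P i (g - f) + (P i g - Q g)) (Q (g - f))
  have h4 := norm_add_le (-P i (g - f)) (P i g - Q g)
  rw [norm_neg] at h4
  linarith

/-- The Yosida approximations `B k = L (1 + ε L)⁻¹`, `ε = 1 / (k + 1)`. -/
theorem IsMaxAccretive.exists_yosida [CompleteSpace H] {R : H → H → Prop} (hR : IsMaxAccretive R) :
    ∃ B : ℕ → H →L[ℂ] H,
    (∀ k f, 0 ≤ (inner ℂ f (B k f)).re) ∧ (∀ k l, Commute (B k) (B l)) ∧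
    (∀ k u h, R u h → ‖B k u‖ ≤ ‖h‖) ∧
    ∀ u h, R u h → Tendsto (fun k => B k u) atTop (𝓝 h) := by
  choose! J hJ1 hJ2 hJ3 using fun (ε : ℝ) (hε : 0 < ε) => hR.exists_resolvent hε
  set e : ℕ → ℝ := fun k => 1 / ((k : ℝ) + 1)
  have he0 : ∀ k, 0 < e k := fun k => by positivity
  have he0' : ∀ k, (e k : ℂ) ≠ 0 := fun k => by exact_mod_cast (he0 k).ne'
  set B : ℕ → H →L[ℂ] H := fun k => (e k : ℂ)⁻¹ • (ContinuousLinearMap.id ℂ H - J (e k)) with hB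
  have hBa : ∀ k f, B k f = (e k : ℂ)⁻¹ • (f - J (e k) f) := fun k f => rfl
  have hBR : ∀ k f, R (J (e k) f) (B k f) := fun k f => hJ2 _ (he0 k) f
  have hfB : ∀ k f, f = J (e k) f + (e k : ℂ) • B k f := fun k f => by
    rw [hBa, smul_smul, mul_inv_cancel₀ (he0' k), one_smul, add_sub_cancel]
  have hBJ : ∀ k u h, R u h → B k u = J (e k) h := fun k u h h1 => by
    have h2 := hJ1 _ (he0 k) u h h1
    rw [map_add, map_smul] at h2
    rw [hBa, sub_eq_iff_eq_add'.2 h2.symm, smul_smul, inv_mul_cancel₀ (he0' k), one_smul]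
  have hJJ : ∀ k l, Commute (J (e k)) (J (e l)) := fun k l => by
    ext f
    have h1 : R (J (e k) (J (e l) f)) (J (e k) (B l f)) := by
      rw [← hBJ k _ _ (hBR l f)]; exact hBR k _
    have h2 := hJ1 _ (he0 l) _ _ h1
    rw [← map_smul, ← map_add, ← hfB] at h2
    exact h2.symm
  refine ⟨B, fun k f => ?_, fun k l => ?_, fun k u h h1 => ?_, fun u h h1 => ?_⟩
  · have h1 : inner ℂ f (B k f) = inner ℂ (J (e k) f + (e k : ℂ) • B k f) (B k f) :=
      congrArg (fun g => inner ℂ g (B k f)) (hfB k f)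
    rw [h1, inner_add_left, inner_smul_left, inner_self_eq_norm_sq_to_K]
    have := hR.accretive (hBR k f)
    simp only [Complex.add_re, Complex.conj_ofReal, Complex.re_ofReal_mul, Complex.coe_algebraMap,
      ← Complex.ofReal_pow, Complex.ofReal_re]
    have := mul_nonneg (he0 k).le (sq_nonneg ‖B k f‖)
    linarith
  · have h1 : Commute (ContinuousLinearMap.id ℂ H - J (e k))
        (ContinuousLinearMap.id ℂ H - J (e l)) :=
      ((Commute.one_left _).sub_right (Commute.one_left _)).sub_left
        ((Commute.one_right _).sub_right (hJJ k l))
    exact (h1.smul_left _).smul_right _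
  · rw [hBJ k u h h1]; exact hJ3 _ (he0 k) h
  · simp_rw [fun k => hBJ k u h h1]
    refine tendsto_of_dense_of_norm_le (P := fun k => J (e k)) (Q := ContinuousLinearMap.id ℂ H)
      (Eventually.of_forall fun k => hJ3 _ (he0 k)) (fun f => le_rfl) hR.dense_domain ?_ h
    rintro v ⟨k, hv⟩
    rw [ContinuousLinearMap.id_apply, tendsto_iff_norm_sub_tendsto_zero]
    refine squeeze_zero (g := fun i => e i * ‖k‖) (fun _ => norm_nonneg _) (fun i => ?_) ?_
    · have h2 : J (e i) v - v = -((e i : ℂ) • B i v) := by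
        rw [eq_sub_iff_add_eq'.2 (hfB i v).symm, neg_sub]
      rw [h2, norm_neg, norm_smul, Complex.norm_real, Real.norm_of_nonneg (he0 i).le,
        hBJ i v k hv]
      exact mul_le_mul_of_nonneg_left (hJ3 _ (he0 i) k) (he0 i).le
    · have := (tendsto_one_div_add_atTop_nhds_zero_nat (𝕜 := ℝ)).mul_const ‖k‖
      rwa [zero_mul] at this

variable [NormedSpace ℝ H] [IsScalarTower ℝ ℂ H]

theorem ofReal_smul_eq (t : ℝ) (f : H) : (t : ℂ) • f = t • f := by
  rw [← Complex.coe_algebraMap, algebraMap_smul]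

variable [CompleteSpace H]

theorem hasDerivAt_exp_smul_apply (B : H →L[ℂ] H) (f : H) (t : ℝ) :
    HasDerivAt (fun s : ℝ => NormedSpace.exp ((s : ℂ) • B) f)
      (NormedSpace.exp ((t : ℂ) • B) (B f)) t := by
  have h1 := hasDerivAt_exp_smul_const (𝕂 := ℂ) B (t : ℂ)
  have h2 := (ContinuousLinearMap.apply ℂ H f).hasFDerivAt.comp_hasDerivAt (t : ℂ) h1
  have h3 := HasDerivAt.scomp t h2 (Complex.ofRealCLM.hasDerivAt (x := t))
  rw [Complex.ofRealCLM_apply, Complex.ofReal_one, one_smul] at h3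
  exact h3

/-- The semigroup generated by `-B`, with `B` bounded and accretive, is contractive. -/
theorem norm_exp_neg_smul_apply_le {B : H →L[ℂ] H} (hB : ∀ f, 0 ≤ (inner ℂ f (B f)).re) {t : ℝ}
    (ht : 0 ≤ t) (f : H) : ‖NormedSpace.exp ((t : ℂ) • (-B)) f‖ ≤ ‖f‖ := by
  have hd : ∀ s : ℝ, HasDerivAt (fun s : ℝ => (inner ℂ (NormedSpace.exp ((s : ℂ) • (-B)) f)
      (NormedSpace.exp ((s : ℂ) • (-B)) f)).re)
      (-2 * (inner ℂ (NormedSpace.exp ((s : ℂ) • (-B)) f)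
        (B (NormedSpace.exp ((s : ℂ) • (-B)) f))).re) s := by
    intro s
    have hc : NormedSpace.exp ((s : ℂ) • (-B)) (-B f) =
        -B (NormedSpace.exp ((s : ℂ) • (-B)) f) := by
      have : Commute (NormedSpace.exp ((s : ℂ) • (-B))) (-B) :=
        ((Commute.refl (-B)).smul_left (s : ℂ)).exp_left
      exact DFunLike.congr_fun this.eq f
    have h1 := hasDerivAt_exp_smul_apply (-B) f s
    rw [neg_apply, hc] at h1
    have h2 := Complex.reCLM.hasFDerivAt.comp_hasDerivAt s (h1.inner ℂ h1)
    refine h2.congr_deriv ?_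
    simp only [inner_neg_right, inner_neg_left, Complex.reCLM_apply, Complex.add_re, Complex.neg_re]
    rw [← inner_conj_symm (B _) _, Complex.conj_re]
    ring
  have h1 := antitone_of_hasDerivAt_nonpos hd (fun s => by
    have := hB (NormedSpace.exp ((s : ℂ) • (-B)) f)
    change -2 * _ ≤ (0 : ℝ)
    linarith) ht
  simp only [inner_self_eq_norm_sq_to_K, Complex.coe_algebraMap, ← Complex.ofReal_pow,
      Complex.ofReal_re, Complex.ofReal_zero, zero_smul, NormedSpace.exp_zero,
      one_apply_eq_self] at h1
  exact (sq_le_sq₀ (norm_nonneg _) (norm_nonneg _)).1 h1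

/-- Duhamel's formula for two commuting bounded generators. -/
theorem norm_exp_sub_exp_le {B C : H →L[ℂ] H} (hB : ∀ f, 0 ≤ (inner ℂ f (B f)).re)
    (hC : ∀ f, 0 ≤ (inner ℂ f (C f)).re) (hBC : Commute B C) {t : ℝ} (ht : 0 ≤ t) (f : H) :
    ‖NormedSpace.exp ((t : ℂ) • (-B)) f - NormedSpace.exp ((t : ℂ) • (-C)) f‖ ≤
      t * ‖B f - C f‖ := by
  let _ : NormedAlgebra ℚ (H →L[ℂ] H) := NormedAlgebra.restrictScalars ℚ ℂ _
  set y := NormedSpace.exp ((t : ℂ) • (-C)) f with hy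
  have e1 : ∀ (s : ℝ) (g : H), NormedSpace.exp ((s : ℂ) • (C - B))
      (NormedSpace.exp ((t : ℂ) • (-C)) g) = NormedSpace.exp ((s : ℂ) • (-B))
      (NormedSpace.exp (((t - s : ℝ) : ℂ) • (-C)) g) := by
    intro s g
    have hCB : Commute (C - B) (-C) := by
      exact ((Commute.refl C).sub_left hBC).neg_right
    have h1 := NormedSpace.exp_add_of_commute
      ((hCB.smul_left (s : ℂ)).smul_right (t : ℂ))
    have h2 := NormedSpace.exp_add_of_commute
      (((hBC.neg_left.neg_right).smul_left (s : ℂ)).smul_right ((t - s : ℝ) : ℂ))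
    have h3 : (s : ℂ) • (C - B) + (t : ℂ) • (-C) = (s : ℂ) • (-B) + ((t - s : ℝ) : ℂ) • (-C) := by
      push_cast; module
    rw [h3, h2] at h1
    exact (DFunLike.congr_fun h1 g).symm
  have e2 : ∀ g, C (NormedSpace.exp ((t : ℂ) • (-C)) g) = NormedSpace.exp ((t : ℂ) • (-C)) (C g) ∧
      B (NormedSpace.exp ((t : ℂ) • (-C)) g) = NormedSpace.exp ((t : ℂ) • (-C)) (B g) := by
    intro g
    have h1 : Commute C (NormedSpace.exp ((t : ℂ) • (-C))) :=
      ((Commute.refl C).neg_right.smul_right (t : ℂ)).exp_right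
    have h2 : Commute B (NormedSpace.exp ((t : ℂ) • (-C))) :=
      (hBC.neg_right.smul_right (t : ℂ)).exp_right
    exact ⟨DFunLike.congr_fun h1.eq g, DFunLike.congr_fun h2.eq g⟩
  have h1 := norm_image_sub_le_of_norm_deriv_le_segment' (a := 0) (b := t) (C := ‖B f - C f‖)
    (f := fun s : ℝ => NormedSpace.exp ((s : ℂ) • (C - B)) y)
    (f' := fun s : ℝ => NormedSpace.exp ((s : ℂ) • (C - B)) ((C - B) y))
    (fun s _ => (hasDerivAt_exp_smul_apply (C - B) y s).hasDerivWithinAt)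
    (fun s hs => by
      rw [sub_apply, (e2 f).1, (e2 f).2, ← map_sub, e1]
      refine (norm_exp_neg_smul_apply_le hB hs.1 _).trans ?_
      refine (norm_exp_neg_smul_apply_le hC (by linarith [hs.2]) _).trans ?_
      rw [norm_sub_rev])
    t (right_mem_Icc.2 ht)
  simp only [sub_zero, Complex.ofReal_zero, zero_smul, NormedSpace.exp_zero,
      one_apply_eq_self] at h1
  rw [hy, e1, sub_self, Complex.ofReal_zero, zero_smul, NormedSpace.exp_zero,
    one_apply_eq_self, mul_comm] at h1
  exact h1

/-- `T`, restricted to `t ≥ 0`, is a strongly continuous semigroup of contractions whose generator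
is `-L`, where `L u = h` is the relation `R u h`. -/
structure IsContractionSemigroup (R : H → H → Prop) (T : ℝ → H →L[ℂ] H) : Prop where
  map_zero : T 0 = ContinuousLinearMap.id ℂ H
  map_add : ∀ s t, 0 ≤ s → 0 ≤ t → T (s + t) = (T s).comp (T t)
  contraction : ∀ t, 0 ≤ t → ‖T t‖ ≤ 1
  continuous : ∀ f, Tendsto (fun t => T t f) (𝓝[>] 0) (𝓝 f)
  generator : ∀ u h, R u h ↔ Tendsto (fun t : ℝ => t⁻¹ • (T t u - u)) (𝓝[>] 0) (𝓝 (-h))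

namespace IsMaxAccretive

variable {R : H → H → Prop}

/-- The Hille–Yosida theorem for maximal accretive operators: the semigroup is the limit of those
generated by the Yosida approximations. -/
theorem exists_semigroup (hR : IsMaxAccretive R) : ∃ T, IsContractionSemigroup R T := by
  let _ : NormedAlgebra ℚ (H →L[ℂ] H) := NormedAlgebra.restrictScalars ℚ ℂ _
  obtain ⟨B, hacc, hcomm, hBle, hBlim⟩ := hR.exists_yosida
  set S : ℕ → ℝ → H →L[ℂ] H := fun k t => NormedSpace.exp ((t : ℂ) • (-B k)) with hS
  have hSle : ∀ k t, 0 ≤ t → ∀ f, ‖S k t f‖ ≤ ‖f‖ := fun k t ht f =>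
    norm_exp_neg_smul_apply_le (hacc k) ht f
  have hSd : ∀ k t f, HasDerivAt (fun s => S k s f) (-(S k t (B k f))) t := fun k t f => by
    have := hasDerivAt_exp_smul_apply (-B k) f t
    rw [neg_apply, map_neg] at this
    exact this
  have hS0 : ∀ k f, S k 0 f = f := fun k f => by
    simp only [hS, Complex.ofReal_zero, zero_smul, NormedSpace.exp_zero, one_apply_eq_self]
  have hSadd : ∀ k s t f, S k (s + t) f = S k s (S k t f) := fun k s t f => by
    have := NormedSpace.exp_add_of_commute
      (((Commute.refl (-B k)).smul_left (s : ℂ)).smul_right (t : ℂ))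
    rw [← add_smul, ← Complex.ofReal_add] at this
    exact DFunLike.congr_fun this f
  -- the approximating semigroups converge on the domain by Duhamel's formula, hence everywhere
  have hcau : ∀ t, 0 ≤ t → ∀ f, ∃ g, Tendsto (fun k => S k t f) atTop (𝓝 g) := by
    intro t ht f
    apply cauchySeq_tendsto_of_complete
    rw [Metric.cauchySeq_iff']
    intro ε hε
    obtain ⟨g, hg, ⟨h, hgh⟩⟩ := Metric.dense_iff.1 hR.dense_domain f (ε / 4) (by positivity)
    rw [Metric.mem_ball, dist_eq_norm] at hg
    have h1 : CauchySeq fun k => B k g := (hBlim g h hgh).cauchySeq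
    obtain ⟨N, hN⟩ := Metric.cauchySeq_iff'.1 h1 (ε / (4 * (t + 1))) (by positivity)
    refine ⟨N, fun k hk => ?_⟩
    have h2 := hN k hk
    rw [dist_eq_norm] at h2 ⊢
    have h3 := norm_exp_sub_exp_le (hacc k) (hacc N) (hcomm k N) ht g
    have h4 : t * ‖B k g - B N g‖ ≤ ε / 4 := by
      rw [lt_div_iff₀ (by positivity)] at h2
      nlinarith [norm_nonneg (B k g - B N g)]
    have e : S k t f - S N t f = -S k t (g - f) + (S k t g - S N t g) + S N t (g - f) := by
      simp only [map_sub]; abel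
    rw [e]
    have h5 := norm_add_le (-S k t (g - f) + (S k t g - S N t g)) (S N t (g - f))
    have h6 := norm_add_le (-S k t (g - f)) (S k t g - S N t g)
    rw [norm_neg] at h6
    have h7 := hSle k t ht (g - f)
    have h8 := hSle N t ht (g - f)
    have h9 : ‖S k t g - S N t g‖ ≤ t * ‖B k g - B N g‖ := h3
    linarith
  choose! T₀ hT₀ using hcau
  have hclm : ∀ t, ∃ P : H →L[ℂ] H, 0 ≤ t → ∀ f, P f = T₀ t f := by
    intro t
    by_cases ht : 0 ≤ t
    · exact ⟨continuousLinearMapOfTendsto (S · t) (tendsto_pi_nhds.2 (hT₀ t ht)), fun _ f => rfl⟩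
    · exact ⟨0, fun h => absurd h ht⟩
  choose T hT using hclm
  have hlim : ∀ t, 0 ≤ t → ∀ f, Tendsto (fun k => S k t f) atTop (𝓝 (T t f)) := fun t ht f => by
    rw [hT t ht]; exact hT₀ t ht f
  have hTle : ∀ t, 0 ≤ t → ∀ f, ‖T t f‖ ≤ ‖f‖ := fun t ht f =>
    le_of_tendsto' (hlim t ht f).norm fun k => hSle k t ht f
  have hSsub : ∀ k t, 0 ≤ t → ∀ u h, R u h → ‖S k t u - u‖ ≤ t * ‖h‖ := by
    intro k t ht u h huh
    have := norm_image_sub_le_of_norm_deriv_le_segment' (a := 0) (b := t) (C := ‖h‖)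
      (fun s _ => (hSd k s u).hasDerivWithinAt)
      (fun s hs => by
        rw [norm_neg]; exact (hSle k s hs.1 _).trans (hBle k u h huh)) t (right_mem_Icc.2 ht)
    rw [hS0] at this
    simpa [mul_comm] using this
  have hTsub : ∀ t, 0 ≤ t → ∀ u h, R u h → ‖T t u - u‖ ≤ t * ‖h‖ := fun t ht u h huh =>
    le_of_tendsto' ((hlim t ht u).sub_const u).norm fun k => hSsub k t ht u h huh
  have hpos : ∀ᶠ t : ℝ in 𝓝[>] 0, 0 < t := self_mem_nhdsWithin
  -- first order expansion at `0` of `T t u`; `g` is an element of the domain close to `h = L u`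
  have hexp : ∀ u h g l, R u h → R g l → ∀ t, 0 ≤ t →
      ‖T t u - u + (t : ℂ) • h‖ ≤ (2 * ‖h - g‖ + t * ‖l‖) * t := by
    intro u h g l huh hgl t ht
    have h1 : ∀ k, ‖S k t u - u + (t : ℂ) • B k u‖ ≤ (2 * ‖B k u - g‖ + t * ‖l‖) * t := by
      intro k
      have hd : ∀ s : ℝ, HasDerivAt (fun s : ℝ => S k s u - u + (s : ℂ) • B k u)
          (-(S k s (B k u)) + B k u) s := by
        intro s
        have h2 : HasDerivAt (fun s : ℝ => (s : ℂ) • B k u) (B k u) s := by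
          simpa using (Complex.ofRealCLM.hasDerivAt (x := s)).smul_const (B k u)
        exact ((hSd k s u).sub_const u).add h2
      have := norm_image_sub_le_of_norm_deriv_le_segment' (a := 0) (b := t)
        (C := 2 * ‖B k u - g‖ + t * ‖l‖)
        (fun s _ => (hd s).hasDerivWithinAt)
        (fun s hs => by
          have h3 := hSle k s hs.1 (B k u - g)
          have h4 := hSsub k s hs.1 g l hgl
          have e : -(S k s (B k u)) + B k u =
              -S k s (B k u - g) + (B k u - g) - (S k s g - g) := by
            rw [map_sub]; abel
          rw [e]
          have h5 := norm_sub_le (-S k s (B k u - g) + (B k u - g)) (S k s g - g)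
          have h6 := norm_add_le (-S k s (B k u - g)) (B k u - g)
          rw [norm_neg] at h6
          have h7 : s * ‖l‖ ≤ t * ‖l‖ := mul_le_mul_of_nonneg_right hs.2.le (norm_nonneg _)
          linarith) t (right_mem_Icc.2 ht)
      rw [hS0, sub_self, Complex.ofReal_zero, zero_smul, add_zero, sub_zero, sub_zero] at this
      exact this
    have hb := hBlim u h huh
    refine le_of_tendsto_of_tendsto' (((hlim t ht u).sub_const u).add (hb.const_smul (t : ℂ))).norm
      (((((hb.sub_const g).norm).const_mul 2).add_const (t * ‖l‖)).mul_const t) h1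
  have hgen : ∀ u h, R u h → Tendsto (fun t : ℝ => t⁻¹ • (T t u - u)) (𝓝[>] 0) (𝓝 (-h)) := by
    intro u h huh
    rw [Metric.tendsto_nhds]
    intro ε hε
    obtain ⟨g, hg, ⟨l, hgl⟩⟩ := Metric.dense_iff.1 hR.dense_domain h (ε / 4) (by positivity)
    rw [Metric.mem_ball, dist_eq_norm, norm_sub_rev] at hg
    have h1 : ∀ᶠ t : ℝ in 𝓝[>] 0, t * ‖l‖ < ε / 4 := by
      have : Tendsto (fun t : ℝ => t * ‖l‖) (𝓝[>] 0) (𝓝 (0 * ‖l‖)) :=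
        (tendsto_nhdsWithin_of_tendsto_nhds tendsto_id).mul_const _
      rw [zero_mul] at this
      exact this.eventually (gt_mem_nhds (by positivity))
    filter_upwards [h1, hpos] with t ht1 ht0
    have h2 := hexp u h g l huh hgl t ht0.le
    have e : t⁻¹ • (T t u - u) - -h = t⁻¹ • (T t u - u + (t : ℂ) • h) := by
      rw [smul_add, ofReal_smul_eq t h, smul_smul, inv_mul_cancel₀ ht0.ne', one_smul,
        sub_neg_eq_add]
    rw [dist_eq_norm, e, norm_smul, norm_inv, Real.norm_of_nonneg ht0.le,
      inv_mul_lt_iff₀ ht0]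
    refine h2.trans_lt ?_
    rw [mul_comm]
    exact mul_lt_mul_of_pos_left (by linarith) ht0
  refine ⟨T, ?_, fun s t hs ht => ?_, fun t ht => ?_, fun f => ?_, fun u h => ⟨hgen u h, ?_⟩⟩
  · ext f
    refine tendsto_nhds_unique (hlim 0 le_rfl f) ?_
    simp [hS0]
  · ext f
    refine tendsto_nhds_unique (hlim (s + t) (add_nonneg hs ht) f) ?_
    have h1 := hlim s hs (T t f)
    have h2 : Tendsto (fun k => S k s (S k t f - T t f)) atTop (𝓝 0) := by
      have h3 := tendsto_iff_norm_sub_tendsto_zero.1 (hlim t ht f)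
      exact squeeze_zero_norm (fun k => hSle k s hs _) h3
    have h4 := h2.add h1
    rw [zero_add] at h4
    refine h4.congr fun k => ?_
    rw [hSadd, map_sub, sub_add_cancel]
  · exact ContinuousLinearMap.opNorm_le_bound _ zero_le_one fun f => by simpa using hTle t ht f
  · refine tendsto_of_dense_of_norm_le (Q := ContinuousLinearMap.id ℂ H)
      (hpos.mono fun t ht => hTle t ht.le) (fun f => le_rfl) hR.dense_domain ?_ f
    rintro v ⟨k, hv⟩
    rw [ContinuousLinearMap.id_apply, tendsto_iff_norm_sub_tendsto_zero]
    refine tendsto_of_tendsto_of_tendsto_of_le_of_le' tendsto_const_nhds (h := fun t => t * ‖k‖) ?_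
      (Eventually.of_forall fun _ => norm_nonneg _) (hpos.mono fun t ht => hTsub t ht.le v k hv)
    have : Tendsto (fun t : ℝ => t * ‖k‖) (𝓝[>] 0) (𝓝 (0 * ‖k‖)) :=
      (tendsto_nhdsWithin_of_tendsto_nhds tendsto_id).mul_const _
    simpa using this
  · -- the generator is accretive, so it cannot be larger than the maximal accretive operator
    intro hlim'
    refine hR.mem_of_accretive fun v k hv => ?_
    have h1 : Tendsto (fun t : ℝ => t⁻¹ • (T t (u - v) - (u - v))) (𝓝[>] 0) (𝓝 (-(h - k))) := by
      have := hlim'.sub (hgen v k hv)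
      rw [show -h - -k = -(h - k) by abel] at this
      refine this.congr fun t => ?_
      rw [← smul_sub, map_sub]; congr 1; abel
    have h2 : Tendsto (fun t : ℝ => (inner ℂ (u - v) (t⁻¹ • (T t (u - v) - (u - v)))).re)
        (𝓝[>] 0) (𝓝 (inner ℂ (u - v) (-(h - k))).re) :=
      (Complex.continuous_re.tendsto _).comp (tendsto_const_nhds.inner h1)
    have h3 : (inner ℂ (u - v) (-(h - k))).re ≤ 0 := by
      refine le_of_tendsto h2 ?_
      filter_upwards [hpos] with t ht
      rw [← ofReal_smul_eq, inner_smul_right, Complex.re_ofReal_mul, inner_sub_right,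
        Complex.sub_re, inner_self_eq_norm_sq_to_K]
      have h4 : (inner ℂ (u - v) (T t (u - v))).re ≤ ‖u - v‖ * ‖u - v‖ :=
        ((Complex.re_le_norm _).trans (norm_inner_le_norm _ _)).trans
          (mul_le_mul_of_nonneg_left (hTle t ht.le _) (norm_nonneg _))
      simp only [Complex.coe_algebraMap, ← Complex.ofReal_pow, Complex.ofReal_re]
      refine mul_nonpos_of_nonneg_of_nonpos (inv_nonneg.2 ht.le) ?_
      rw [pow_two]; linarith
    rw [inner_neg_right, Complex.neg_re] at h3
    linarith

end IsMaxAccretive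

end Semigroup

/-! ### Properties of contraction semigroups -/

section SemigroupProperties

variable {H : Type*} [NormedAddCommGroup H] [InnerProductSpace ℂ H] [NormedSpace ℝ H]

namespace IsContractionSemigroup

variable {R R' : H → H → Prop} {T T' : ℝ → H →L[ℂ] H}

theorem norm_apply_le (hT : IsContractionSemigroup R T) {t : ℝ} (ht : 0 ≤ t) (f : H) :
    ‖T t f‖ ≤ ‖f‖ := by
  simpa using (T t).le_of_opNorm_le (hT.contraction t ht) f

theorem map_add_apply (hT : IsContractionSemigroup R T) {s t : ℝ} (hs : 0 ≤ s) (ht : 0 ≤ t)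
    (f : H) : T (s + t) f = T s (T t f) := by
  rw [hT.map_add s t hs ht]; rfl

theorem map_zero_apply (hT : IsContractionSemigroup R T) (f : H) : T 0 f = f := by
  rw [hT.map_zero]; rfl

theorem continuousOn (hT : IsContractionSemigroup R T) (f : H) :
    ContinuousOn (fun t => T t f) (Ici 0) := by
  have h1 : Tendsto (fun t => T t f) (𝓝[≥] 0) (𝓝 f) := by
    rw [← Ioi_insert, nhdsWithin_insert, tendsto_sup]
    exact ⟨by rw [tendsto_pure_left]; intro s hs; simpa [hT.map_zero] using mem_of_mem_nhds hs,
      hT.continuous f⟩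
  have hle : ∀ s t : ℝ, 0 ≤ s → s ≤ t → ‖T t f - T s f‖ ≤ ‖T (t - s) f - f‖ := by
    intro s t hs hst
    have : T t f = T s (T (t - s) f) := by
      rw [← hT.map_add_apply hs (sub_nonneg.2 hst), add_sub_cancel]
    rw [this, ← map_sub]
    exact hT.norm_apply_le hs _
  intro t ht
  rw [ContinuousWithinAt, tendsto_iff_norm_sub_tendsto_zero]
  have h2 : Tendsto (fun s => |s - t|) (𝓝[≥] t ⊔ 𝓝[Ici 0] t) (𝓝[≥] 0) := by
    refine tendsto_nhdsWithin_of_tendsto_nhds_of_eventually_within _ ?_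
      (Eventually.of_forall fun s => mem_Ici.2 (abs_nonneg _))
    have : Tendsto (fun s => |s - t|) (𝓝 t) (𝓝 |t - t|) :=
      ((continuous_id.sub continuous_const).abs).tendsto t
    rw [sub_self, abs_zero] at this
    exact this.mono_left (sup_le nhdsWithin_le_nhds nhdsWithin_le_nhds)
  have h3 := tendsto_iff_norm_sub_tendsto_zero.1 (h1.comp (h2.mono_left le_sup_right))
  refine squeeze_zero' (Eventually.of_forall fun _ => norm_nonneg _) ?_ h3
  filter_upwards [self_mem_nhdsWithin] with s hs
  rcases le_total s t with hst | hst
  · rw [norm_sub_rev]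
    simpa [abs_sub_comm s t, abs_of_nonneg (sub_nonneg.2 hst)] using hle s t hs hst
  · simpa [abs_of_nonneg (sub_nonneg.2 hst)] using hle t s ht hst

theorem apply_mem [IsScalarTower ℝ ℂ H] (hT : IsContractionSemigroup R T) {u h : H}
    (huh : R u h) {t : ℝ} (ht : 0 ≤ t) : R (T t u) (T t h) := by
  rw [hT.generator] at huh ⊢
  have h1 := ((T t).continuous.tendsto _).comp huh
  rw [map_neg] at h1
  refine h1.congr' ?_
  filter_upwards [self_mem_nhdsWithin] with s hs
  have hs' : 0 ≤ s := le_of_lt hs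
  rw [Function.comp_apply, ← ofReal_smul_eq, map_smul, map_sub, ofReal_smul_eq,
    ← hT.map_add_apply ht hs', ← hT.map_add_apply hs' ht, add_comm]

theorem hasDerivAt [IsScalarTower ℝ ℂ H] (hT : IsContractionSemigroup R T) {u h : H}
    (huh : R u h) {t : ℝ} (ht : 0 < t) : HasDerivAt (fun s => T s u) (-T t h) t := by
  have hg := (hT.generator u h).1 huh
  rw [hasDerivAt_iff_tendsto_slope, ← nhdsLT_sup_nhdsGT, tendsto_sup]
  constructor
  · have h0 : Tendsto (fun s => t - s) (𝓝[<] t) (𝓝[>] 0) := by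
      refine tendsto_nhdsWithin_of_tendsto_nhds_of_eventually_within _ ?_ ?_
      · have : Tendsto (fun s => t - s) (𝓝 t) (𝓝 (t - t)) :=
          (continuous_const.sub continuous_id).tendsto t
        rw [sub_self] at this
        exact this.mono_left nhdsWithin_le_nhds
      · filter_upwards [self_mem_nhdsWithin] with s hs
        exact mem_Ioi.2 (sub_pos.2 (by simpa using hs))
    have h1 := hg.comp h0
    have hpos : ∀ᶠ s in 𝓝[<] t, 0 < s :=
      mem_nhdsWithin_of_mem_nhds (lt_mem_nhds ht)
    have h2 : Tendsto (fun s => T s h) (𝓝[<] t) (𝓝 (T t h)) :=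
      (((hT.continuousOn h).continuousAt (Ici_mem_nhds ht)).tendsto).mono_left nhdsWithin_le_nhds
    have h3 : Tendsto (fun s => T s ((t - s)⁻¹ • (T (t - s) u - u) + h)) (𝓝[<] t) (𝓝 0) := by
      have h4 : Tendsto (fun s => (t - s)⁻¹ • (T (t - s) u - u) + h) (𝓝[<] t) (𝓝 0) := by
        have := h1.add_const h
        rwa [neg_add_cancel] at this
      refine squeeze_zero_norm' ?_ (tendsto_norm_zero.comp h4)
      filter_upwards [hpos] with s hs using hT.norm_apply_le hs.le _
    have h5 := h3.sub h2
    rw [zero_sub] at h5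
    refine h5.congr' ?_
    filter_upwards [hpos, self_mem_nhdsWithin] with s hs hst
    have hst' : 0 ≤ t - s := sub_nonneg.2 (le_of_lt hst)
    rw [_root_.map_add, add_sub_cancel_right, ← ofReal_smul_eq, map_smul, map_sub,
      ← hT.map_add_apply hs.le hst', add_sub_cancel, ofReal_smul_eq, slope_def_module,
      ← neg_sub t s, inv_neg, neg_smul, ← smul_neg, neg_sub]
  · have h0 : Tendsto (fun s => s - t) (𝓝[>] t) (𝓝[>] 0) := by
      refine tendsto_nhdsWithin_of_tendsto_nhds_of_eventually_within _ ?_ ?_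
      · have : Tendsto (fun s => s - t) (𝓝 t) (𝓝 (t - t)) :=
          (continuous_id.sub continuous_const).tendsto t
        rw [sub_self] at this
        exact this.mono_left nhdsWithin_le_nhds
      · filter_upwards [self_mem_nhdsWithin] with s hs
        exact mem_Ioi.2 (sub_pos.2 (by simpa using hs))
    have h1 := ((T t).continuous.tendsto _).comp (hg.comp h0)
    rw [map_neg] at h1
    refine h1.congr' ?_
    filter_upwards [self_mem_nhdsWithin] with s hs
    have hst' : 0 ≤ s - t := sub_nonneg.2 (le_of_lt hs)
    simp only [Function.comp_apply]
    rw [← ofReal_smul_eq, map_smul, map_sub, ofReal_smul_eq, ← hT.map_add_apply ht.le hst',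
      add_sub_cancel, slope_def_module]

theorem continuousOn_quadratic (hT : IsContractionSemigroup R T) (P : H →L[ℂ] H) (u : H) :
    ContinuousOn (fun s => (inner ℂ (P (T s u)) (T s u)).re) (Ici 0) :=
  Complex.continuous_re.comp_continuousOn
    ((P.continuous.comp_continuousOn (hT.continuousOn u)).inner (hT.continuousOn u))

variable [IsScalarTower ℝ ℂ H]

/-- Semigroups generated by operators in duality are in duality: the function
`r ↦ ⟨T' (s - r) v, T r u⟩` is constant. -/
theorem inner_apply_eq (hT : IsContractionSemigroup R T) (hT' : IsContractionSemigroup R' T')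
    (hD : Dense {u | ∃ h, R u h}) (hD' : Dense {u | ∃ h, R' u h})
    (hadj : ∀ u h v k, R u h → R' v k → inner ℂ v h = inner ℂ k u) {s : ℝ} (hs : 0 ≤ s) (f g : H) :
    inner ℂ g (T s f) = inner ℂ (T' s g) f := by
  have key : ∀ u h v k, R u h → R' v k → inner ℂ v (T s u) = inner ℂ (T' s v) u := by
    intro u h v k huh hvk
    have hmem : ∀ r ∈ Icc 0 s, 0 ≤ s - r := fun r hr => sub_nonneg.2 hr.2
    have hc : ContinuousOn (fun r => inner ℂ (T' (s - r) v) (T r u)) (Icc 0 s) :=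
      ((hT'.continuousOn v).comp (continuous_const.sub continuous_id).continuousOn hmem).inner
        ((hT.continuousOn u).mono fun r hr => hr.1)
    have hd : ∀ r ∈ Ioo 0 s, HasDerivAt (fun r => inner ℂ (T' (s - r) v) (T r u)) 0 r := by
      intro r hr
      have hsr : 0 < s - r := sub_pos.2 hr.2
      have h1 := (hT'.hasDerivAt hvk hsr).scomp r ((hasDerivAt_id r).const_sub s)
      have h2 := h1.inner ℂ (hT.hasDerivAt huh hr.1)
      refine h2.congr_deriv ?_
      have h3 := hadj _ _ _ _ (hT.apply_mem huh hr.1.le) (hT'.apply_mem hvk hsr.le)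
      simp [h3]
    rcases hs.eq_or_lt with rfl | hs0
    · rw [hT.map_zero_apply, hT'.map_zero_apply]
    have h2 : ∀ r ∈ Ioo 0 s, ∀ r' ∈ Ioo 0 s, inner ℂ (T' (s - r) v) (T r u) =
        inner ℂ (T' (s - r') v) (T r' u) := fun r hr r' hr' =>
      isOpen_Ioo.is_const_of_deriv_eq_zero isPreconnected_Ioo
        (fun x hx => (hd x hx).differentiableAt.differentiableWithinAt)
        (fun x hx => (hd x hx).deriv) hr hr'
    have hcl : closure (Ioo 0 s) = Icc 0 s := closure_Ioo hs0.ne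
    have hmid : s / 2 ∈ Ioo 0 s := ⟨by linarith, by linarith⟩
    have h3 : EqOn (fun r => inner ℂ (T' (s - r) v) (T r u))
        (fun _ => inner ℂ (T' (s - s / 2) v) (T (s / 2) u)) (Icc 0 s) :=
      EqOn.of_subset_closure (fun r hr => h2 r hr _ hmid) hc continuousOn_const Ioo_subset_Icc_self
        hcl.ge
    have h4 := (h3 (right_mem_Icc.2 hs)).trans (h3 (left_mem_Icc.2 hs)).symm
    simpa [hT.map_zero_apply, hT'.map_zero_apply] using h4
  have h1 : ∀ v k, R' v k → ∀ f, inner ℂ v (T s f) = inner ℂ (T' s v) f := fun v k hvk f =>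
    congrFun (Continuous.ext_on hD (f := fun f => inner ℂ v (T s f))
      (g := fun f => inner ℂ (T' s v) f) (by fun_prop) (by fun_prop)
      fun u ⟨h, huh⟩ => key u h v k huh hvk) f
  exact congrFun (Continuous.ext_on hD' (f := fun g => inner ℂ g (T s f))
      (g := fun g => inner ℂ (T' s g) f) (by fun_prop) (by fun_prop)
      fun v ⟨k, hvk⟩ => h1 v k hvk f) g

/-! ### Weighted energy estimates -/

theorem _root_.HasDerivAt.exp_neg_mul_mul {p : ℝ → ℝ} {p' r : ℝ} (hp : HasDerivAt p p' r)
    (β : ℝ) : HasDerivAt (fun r => Real.exp (-(2 * β * r)) * p r)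
      (Real.exp (-(2 * β * r)) * (p' - 2 * β * p r)) r := by
  have h1 : HasDerivAt (fun r : ℝ => -(2 * β * r)) (-(2 * β)) r := by
    have := ((hasDerivAt_id r).const_mul (2 * β)).fun_neg
    rwa [mul_one] at this
  exact (h1.exp.mul hp).congr_deriv (by ring)

/-- Derivative of the quadratic form of a symmetric operator along the semigroup. -/
theorem hasDerivAt_quadratic (hT : IsContractionSemigroup R T) {P : H →L[ℂ] H}
    (hP : ∀ f g, inner ℂ (P f) g = inner ℂ f (P g)) {u h : H} (huh : R u h) {t : ℝ} (ht : 0 < t) :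
    HasDerivAt (fun s => (inner ℂ (P (T s u)) (T s u)).re)
      (-2 * (inner ℂ (P (T t u)) (T t h)).re) t := by
  have h1 := hT.hasDerivAt huh ht
  have h2 : HasDerivAt (fun s => P (T s u)) (P (-T t h)) t :=
    ((P.restrictScalars ℝ).hasFDerivAt.comp_hasDerivAt t h1)
  refine (Complex.reCLM.hasFDerivAt.comp_hasDerivAt t (h2.inner ℂ h1)).congr_deriv ?_
  simp only [map_neg, inner_neg_right, inner_neg_left, Complex.reCLM_apply, Complex.add_re,
    Complex.neg_re, hP]
  rw [← inner_conj_symm (T t h) _, Complex.conj_re, hP]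
  ring

/-- Grönwall's inequality for a weighted norm: `P` is the square of the weight, and the hypothesis
says that `P (L + β)` is accretive. -/
theorem quadratic_le (hT : IsContractionSemigroup R T) (hD : Dense {u | ∃ h, R u h})
    {P : H →L[ℂ] H} (hP : ∀ f g, inner ℂ (P f) g = inner ℂ f (P g)) {β : ℝ}
    (hN : ∀ u h, R u h → 0 ≤ (inner ℂ (P u) h).re + β * (inner ℂ (P u) u).re) {s : ℝ}
    (hs : 0 ≤ s) (f : H) :
    (inner ℂ (P (T s f)) (T s f)).re ≤ Real.exp (2 * β * s) * (inner ℂ (P f) f).re := by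
  have key : ∀ u h, R u h →
      (inner ℂ (P (T s u)) (T s u)).re ≤ Real.exp (2 * β * s) * (inner ℂ (P u) u).re := by
    intro u h huh
    have hd : ∀ r, 0 < r → HasDerivAt
        (fun r => Real.exp (-(2 * β * r)) * (inner ℂ (P (T r u)) (T r u)).re) _ r := fun r hr =>
      (hT.hasDerivAt_quadratic hP huh hr).exp_neg_mul_mul β
    have h1 : AntitoneOn (fun r => Real.exp (-(2 * β * r)) * (inner ℂ (P (T r u)) (T r u)).re)
        (Icc 0 s) := by
      refine antitoneOn_of_deriv_nonpos (convex_Icc 0 s)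
        ((Continuous.continuousOn (by fun_prop)).mul
          ((hT.continuousOn_quadratic P u).mono fun r hr => hr.1)) ?_ ?_
      · intro r hr
        rw [interior_Icc] at hr
        exact (hd r hr.1).differentiableAt.differentiableWithinAt
      · intro r hr
        rw [interior_Icc] at hr
        rw [(hd r hr.1).deriv]
        have h2 := hN _ _ (hT.apply_mem huh hr.1.le)
        have h3 := (Real.exp_pos (-(2 * β * r))).le
        nlinarith [mul_nonneg h3 h2]
    have h2 := h1 (left_mem_Icc.2 hs) (right_mem_Icc.2 hs) hs
    simp only [mul_zero, neg_zero, Real.exp_zero, one_mul, hT.map_zero_apply] at h2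
    rw [Real.exp_neg, inv_mul_le_iff₀ (Real.exp_pos _)] at h2
    exact h2
  have hcl : IsClosed {f | (inner ℂ (P (T s f)) (T s f)).re ≤
      Real.exp (2 * β * s) * (inner ℂ (P f) f).re} :=
    isClosed_le (by fun_prop) (by fun_prop)
  exact hcl.closure_subset_iff.2 (by rintro u ⟨h, huh⟩; exact key u h huh) (hD f)

/-- The parabolic smoothing estimate. The number `⟨v, L T s u⟩` equals
`⟨T' (s - r) v, L (T r u)⟩` for every `r ∈ [0, s]`, so that it is bounded by `Λ` times the
product of the two dissipations `N` and `N'` at the times `r` and `s - r`; the integral in `r`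
of their squares is bounded by the energies. -/
theorem norm_inner_le (hT : IsContractionSemigroup R T) (hT' : IsContractionSemigroup R' T')
    (hD : Dense {u | ∃ h, R u h}) (hD' : Dense {u | ∃ h, R' u h})
    (hadj : ∀ u h v k, R u h → R' v k → inner ℂ v h = inner ℂ k u) {P Q : H →L[ℂ] H}
    (hP : ∀ f g, inner ℂ (P f) g = inner ℂ f (P g)) (hQ : ∀ f g, inner ℂ (Q f) g = inner ℂ f (Q g))
    (hP0 : ∀ f, 0 ≤ (inner ℂ (P f) f).re) (hQ0 : ∀ f, 0 ≤ (inner ℂ (Q f) f).re)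
    {c β Λ : ℝ} (hc : 0 < c) (hΛ : 0 < Λ) {N N' : H → ℝ}
    (hN : ∀ u h, R u h → c * N u ^ 2 ≤ (inner ℂ (P u) h).re + β * (inner ℂ (P u) u).re)
    (hN' : ∀ u h, R' u h → c * N' u ^ 2 ≤ (inner ℂ (Q u) h).re + β * (inner ℂ (Q u) u).re)
    (hNN : ∀ u h v k, R u h → R' v k → ‖inner ℂ v h‖ ≤ Λ * (N u * N' v))
    {s : ℝ} (hs : 0 < s) {u h : H} (huh : R u h) (v : H) :
    ‖inner ℂ v (T s h)‖ ≤ Λ * Real.exp (β * s) / (4 * c * s) *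
      ((inner ℂ (P u) u).re + (inner ℂ (Q v) v).re) := by
  have key : ∀ v k, R' v k → ‖inner ℂ v (T s h)‖ ≤ Λ * Real.exp (β * s) / (4 * c * s) *
      ((inner ℂ (P u) u).re + (inner ℂ (Q v) v).re) := by
    intro v k hvk
    set X := ‖inner ℂ v (T s h)‖ with hX
    set p : ℝ → ℝ := fun r => (inner ℂ (P (T r u)) (T r u)).re with hp
    set q : ℝ → ℝ := fun r => (inner ℂ (Q (T' r v)) (T' r v)).re with hq
    have hd1 : ∀ r, 0 < r → HasDerivAt (fun r => Real.exp (-(2 * β * r)) * p r) _ r := fun r hr =>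
      (hT.hasDerivAt_quadratic hP huh hr).exp_neg_mul_mul β
    have hd2 : ∀ r, 0 < r → HasDerivAt (fun r => Real.exp (-(2 * β * r)) * q r) _ r := fun r hr =>
      (hT'.hasDerivAt_quadratic hQ hvk hr).exp_neg_mul_mul β
    have hd : ∀ r ∈ Ioo 0 s, HasDerivAt (fun r => Real.exp (-(2 * β * (s - r))) * q (s - r) -
        Real.exp (-(2 * β * r)) * p r) _ r := fun r hr =>
      ((hd2 (s - r) (sub_pos.2 hr.2)).comp r ((hasDerivAt_id r).const_sub s)).sub (hd1 r hr.1)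
    have hcont : ContinuousOn (fun r => Real.exp (-(2 * β * (s - r))) * q (s - r) -
        Real.exp (-(2 * β * r)) * p r) (Icc 0 s) := by
      refine ((Continuous.continuousOn (by fun_prop)).mul
        ((hT'.continuousOn_quadratic Q v).comp (continuous_const.sub continuous_id).continuousOn
          fun r hr => sub_nonneg.2 hr.2)).sub
        ((Continuous.continuousOn (by fun_prop)).mul
          ((hT.continuousOn_quadratic P u).mono fun r hr => hr.1))
    -- the exponentially damped energies of `T' (s - r) v` and `T r u` are monotone in `r`, and the
    -- derivative of their difference dominates the product of the dissipations
    have hlow := (convex_Icc 0 s).mul_sub_le_image_sub_of_le_deriv hcont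
      (fun r hr => by
        rw [interior_Icc] at hr
        exact (hd r hr).differentiableAt.differentiableWithinAt)
      (C := 4 * c * Real.exp (-(β * s)) * (X / Λ))
      (fun r hr => by
        rw [interior_Icc] at hr
        rw [(hd r hr).deriv]
        have hsr : 0 < s - r := sub_pos.2 hr.2
        have m1 := hT.apply_mem huh hr.1.le
        have m2 := hT'.apply_mem hvk hsr.le
        have h1 := hN _ _ m1
        have h2 := hN' _ _ m2
        have h3 := hNN _ _ _ _ m1 m2
        have hX' : X = ‖inner ℂ (T' (s - r) v) (T r h)‖ := by
          rw [← hT.inner_apply_eq hT' hD hD' hadj hsr.le, ← hT.map_add_apply hsr.le hr.1.le,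
            sub_add_cancel]
        rw [← hX'] at h3
        have h3' : X / Λ ≤ N (T r u) * N' (T' (s - r) v) := by
          rw [div_le_iff₀ hΛ]; linarith
        set a := Real.exp (-(β * r))
        set b := Real.exp (-(β * (s - r)))
        have ea : Real.exp (-(2 * β * r)) = a ^ 2 := by
          rw [← Real.exp_nat_mul]; congr 1; push_cast; ring
        have eb : Real.exp (-(2 * β * (s - r))) = b ^ 2 := by
          rw [← Real.exp_nat_mul]; congr 1; push_cast; ring
        have eab : Real.exp (-(β * s)) = a * b := by
          rw [← Real.exp_add]; congr 1; ring
        rw [ea, eb, eab]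
        have hab : 0 < a * b := mul_pos (Real.exp_pos _) (Real.exp_pos _)
        have h4 : 4 * c * (a * b) * (X / Λ) ≤ 4 * c * (a * b) * (N (T r u) * N' (T' (s - r) v)) :=
          mul_le_mul_of_nonneg_left h3' (by positivity)
        have h5 := mul_le_mul_of_nonneg_left h1 (sq_nonneg a)
        have h6 := mul_le_mul_of_nonneg_left h2 (sq_nonneg b)
        have h7 := mul_nonneg hc.le (sq_nonneg (a * N (T r u) - b * N' (T' (s - r) v)))
        nlinarith)
      0 (left_mem_Icc.2 hs.le) s (right_mem_Icc.2 hs.le) hs.le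
    simp only [sub_self, mul_zero, neg_zero, Real.exp_zero, one_mul, sub_zero, hp, hq,
      hT.map_zero_apply, hT'.map_zero_apply] at hlow
    have h1 : 0 ≤ Real.exp (-(2 * β * s)) * (inner ℂ (P (T s u)) (T s u)).re :=
      mul_nonneg (Real.exp_pos _).le (hP0 _)
    have h2 : 0 ≤ Real.exp (-(2 * β * s)) * (inner ℂ (Q (T' s v)) (T' s v)).re :=
      mul_nonneg (Real.exp_pos _).le (hQ0 _)
    have h3 : 4 * c * Real.exp (-(β * s)) * (X / Λ) * s ≤
        (inner ℂ (P u) u).re + (inner ℂ (Q v) v).re := by linarith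
    have h4 : X = Λ * Real.exp (β * s) / (4 * c * s) *
        (4 * c * Real.exp (-(β * s)) * (X / Λ) * s) := by
      rw [Real.exp_neg]
      have := (Real.exp_pos (β * s)).ne'
      field_simp
    rw [h4]
    exact mul_le_mul_of_nonneg_left h3 (by positivity)
  have hcl : IsClosed {v | ‖inner ℂ v (T s h)‖ ≤ Λ * Real.exp (β * s) / (4 * c * s) *
      ((inner ℂ (P u) u).re + (inner ℂ (Q v) v).re)} :=
    isClosed_le (by fun_prop) (by fun_prop)
  exact hcl.closure_subset_iff.2 (by rintro v ⟨k, hvk⟩; exact key v k hvk) (hD' v)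

/-- The smoothing estimate in a weighted norm: `Q = P⁻¹`, so that the weighted norms of `P` and `Q`
are dual to each other. -/
theorem quadratic_apply_le (hT : IsContractionSemigroup R T) (hT' : IsContractionSemigroup R' T')
    (hD : Dense {u | ∃ h, R u h}) (hD' : Dense {u | ∃ h, R' u h})
    (hadj : ∀ u h v k, R u h → R' v k → inner ℂ v h = inner ℂ k u) {P Q : H →L[ℂ] H}
    (hP : ∀ f g, inner ℂ (P f) g = inner ℂ f (P g)) (hQ : ∀ f g, inner ℂ (Q f) g = inner ℂ f (Q g))
    (hP0 : ∀ f, 0 ≤ (inner ℂ (P f) f).re) (hQ0 : ∀ f, 0 ≤ (inner ℂ (Q f) f).re)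
    (hQP : ∀ f, Q (P f) = f)
    {c β Λ : ℝ} (hc : 0 < c) (hΛ : 0 < Λ) {N N' : H → ℝ}
    (hN : ∀ u h, R u h → c * N u ^ 2 ≤ (inner ℂ (P u) h).re + β * (inner ℂ (P u) u).re)
    (hN' : ∀ u h, R' u h → c * N' u ^ 2 ≤ (inner ℂ (Q u) h).re + β * (inner ℂ (Q u) u).re)
    (hNN : ∀ u h v k, R u h → R' v k → ‖inner ℂ v h‖ ≤ Λ * (N u * N' v))
    {s : ℝ} (hs : 0 < s) {u h : H} (huh : R u h) :
    (inner ℂ (P (T s h)) (T s h)).re ≤ (Λ * Real.exp (β * s) / (2 * c * s)) ^ 2 *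
      (inner ℂ (P u) u).re := by
  set K := Λ * Real.exp (β * s) / (4 * c * s) with hK
  have hK0 : 0 < K := by positivity
  set w := T s h with hw
  -- the test vector balances the two terms of the previous estimate
  have h1 := hT.norm_inner_le hT' hD hD' hadj hP hQ hP0 hQ0 hc hΛ hN hN' hNN hs huh
    (((1 / (2 * K) : ℝ) : ℂ) • P w)
  rw [← hK, ← hw, map_smul, hQP, inner_smul_left, inner_smul_left, inner_smul_right,
    Complex.conj_ofReal, ← hP, Complex.re_ofReal_mul, Complex.re_ofReal_mul] at h1
  have h2 := (Complex.re_le_norm _).trans h1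
  rw [Complex.re_ofReal_mul] at h2
  have h3 : (Λ * Real.exp (β * s) / (2 * c * s)) = 2 * K := by rw [hK]; field_simp; norm_num
  rw [h3]
  set y := (inner ℂ (P w) w).re
  have h4 : K * (1 / (2 * K) * (1 / (2 * K) * y)) = y / (4 * K) := by field_simp; ring
  rw [mul_add, h4] at h2
  have h5 : 1 / (2 * K) * y = 2 * (y / (4 * K)) := by field_simp; ring
  rw [h5] at h2
  have h6 : y / (4 * K) ≤ K * (inner ℂ (P u) u).re := by linarith
  rw [div_le_iff₀ (by positivity)] at h6
  linarith

/-- If `T s L` extends to a bounded operator, then `T s` maps into the domain of `L`, and `L T s f`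
is a limit of vectors `T s L u` with `u` near `f`. -/
theorem exists_mem_apply [CompleteSpace H] (hR : IsMaxAccretive R)
    (hT : IsContractionSemigroup R T) {s C : ℝ} (hs : 0 ≤ s)
    (hC : ∀ u h, R u h → ‖T s h‖ ≤ C * ‖u‖) (f : H) :
    ∃ h, R (T s f) h ∧ ∃ u k : ℕ → H, (∀ i, R (u i) (k i)) ∧ Tendsto u atTop (𝓝 f) ∧
      Tendsto (fun i => T s (k i)) atTop (𝓝 h) := by
  obtain ⟨u, hu, hlim⟩ := mem_closure_iff_seq_limit.1 (hR.dense_domain f)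
  choose k hk using hu
  have hC' : ∀ u h, R u h → ‖T s h‖ ≤ max C 0 * ‖u‖ := fun u h huh =>
    (hC u h huh).trans (mul_le_mul_of_nonneg_right (le_max_left _ _) (norm_nonneg _))
  have h1 : CauchySeq fun i => T s (k i) := by
    rw [Metric.cauchySeq_iff]
    intro ε hε
    obtain ⟨N, hN⟩ := Metric.cauchySeq_iff.1 hlim.cauchySeq (ε / (max C 0 + 1)) (by positivity)
    refine ⟨N, fun i hi j hj => ?_⟩
    have h2 := hN i hi j hj
    rw [dist_eq_norm, lt_div_iff₀ (by positivity)] at h2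
    rw [dist_eq_norm, ← map_sub]
    have h3 := hC' _ _ (hR.sub (hk i) (hk j))
    nlinarith [norm_nonneg (u i - u j)]
  obtain ⟨h, hh⟩ := cauchySeq_tendsto_of_complete h1
  exact ⟨h, hR.mem_of_tendsto (fun i => hT.apply_mem (hk i) hs)
    (((T s).continuous.tendsto _).comp hlim) hh, u, k, hk, hlim, hh⟩

/-! ### Powers of the generator along the semigroup -/

variable {L : H → H}

/-- If `T s` maps into the domain of `L` for all `s > 0`, then it maps into the domains of all
powers of `L`. -/
theorem iterate_mem (hT : IsContractionSemigroup R T) (hL : ∀ u h, R u h → L u = h)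
    (hsm : ∀ s, 0 < s → ∀ f, ∃ h, R (T s f) h) (m : ℕ) {s : ℝ} (hs : 0 < s) (f : H) :
    ∃ h, R (L^[m] (T s f)) h := by
  induction m generalizing s f with
  | zero => exact hsm s hs f
  | succ m ih =>
    obtain ⟨h, hh⟩ := hsm (s / 2) (by positivity) f
    have h1 := hT.apply_mem hh (t := s / 2) (by positivity)
    rw [← hT.map_add_apply (by positivity) (by positivity), add_halves] at h1
    rw [Function.iterate_succ_apply, hL _ _ h1]
    exact ih (by positivity) h

theorem iterate_succ_mem (hT : IsContractionSemigroup R T) (hL : ∀ u h, R u h → L u = h)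
    (hsm : ∀ s, 0 < s → ∀ f, ∃ h, R (T s f) h) (m : ℕ) {s : ℝ} (hs : 0 < s) (f : H) :
    R (L^[m] (T s f)) (L^[m + 1] (T s f)) := by
  obtain ⟨h, hh⟩ := hT.iterate_mem hL hsm m hs f
  rwa [Function.iterate_succ_apply', hL _ _ hh]

theorem iterate_apply_add (hT : IsContractionSemigroup R T) (hL : ∀ u h, R u h → L u = h)
    (hsm : ∀ s, 0 < s → ∀ f, ∃ h, R (T s f) h) (m : ℕ) {r s : ℝ} (hr : 0 ≤ r) (hs : 0 < s) (f : H) :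
    L^[m] (T (r + s) f) = T r (L^[m] (T s f)) := by
  induction m with
  | zero => exact hT.map_add_apply hr hs.le f
  | succ m ih =>
    rw [Function.iterate_succ_apply', ih,
      hL _ _ (hT.apply_mem (hT.iterate_succ_mem hL hsm m hs f) hr)]

theorem hasDerivAt_iterate (hT : IsContractionSemigroup R T) (hL : ∀ u h, R u h → L u = h)
    (hsm : ∀ s, 0 < s → ∀ f, ∃ h, R (T s f) h) (m : ℕ) {s : ℝ} (hs : 0 < s) (f : H) :
    HasDerivAt (fun r => L^[m] (T r f)) (-L^[m + 1] (T s f)) s := by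
  have hs2 : 0 < s / 2 := by positivity
  have h1 : HasDerivAt (fun r => T r (L^[m] (T (s / 2) f)))
      (-T (s - s / 2) (L^[m + 1] (T (s / 2) f))) (s - s / 2) :=
    hT.hasDerivAt (hT.iterate_succ_mem hL hsm m hs2 f) (by linarith)
  have h2 := h1.comp_sub_const s (s / 2)
  rw [← hT.iterate_apply_add hL hsm _ (by linarith) hs2, sub_add_cancel] at h2
  refine h2.congr_of_eventuallyEq ?_
  filter_upwards [lt_mem_nhds (show s / 2 < s by linarith)] with r hr
  rw [← hT.iterate_apply_add hL hsm _ (by linarith) hs2, sub_add_cancel]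

end IsContractionSemigroup

end SemigroupProperties

/-! ### Multiplication operators on `L²` -/

section Multiplication

variable {n : ℕ}

open Classical in
/-- Multiplication by `b ∈ L^∞(ℝⁿ)` on `L²(ℝⁿ)` (and `0` if `b` is not in `L^∞(ℝⁿ)`). -/
noncomputable def mulOp (b : RSpace n → ℂ) : L2Space n →L[ℂ] L2Space n :=
  if h : MemLp b ∞ volume then
    (ContinuousLinearMap.mul ℂ ℂ).holderL volume ∞ 2 2 h.toLp
  else 0

theorem coeFn_mulOp {b : RSpace n → ℂ} (hb : MemLp b ∞ volume) (u : L2Space n) :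
    mulOp b u =ᵐ[volume] fun x => b x * u x := by
  rw [mulOp, dif_pos hb]
  filter_upwards [(ContinuousLinearMap.mul ℂ ℂ).coeFn_holder (r := 2) hb.toLp u, hb.coeFn_toLp]
    with x hx1 hx2
  rw [ContinuousLinearMap.holderL_apply_apply, hx1, hx2]
  rfl

theorem mulOp_mulOp {b c : RSpace n → ℂ} (hb : MemLp b ∞ volume) (hc : MemLp c ∞ volume)
    (u : L2Space n) : mulOp b (mulOp c u) = mulOp (fun x => b x * c x) u := by
  apply Lp.ext
  have hbc : MemLp (fun x => b x * c x) ∞ volume := hc.mul hb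
  filter_upwards [coeFn_mulOp hb (mulOp c u), coeFn_mulOp hc u, coeFn_mulOp hbc u] with x h1 h2 h3
  rw [h1, h2, h3, mul_assoc]

theorem mulOp_comm {b c : RSpace n → ℂ} (hb : MemLp b ∞ volume) (hc : MemLp c ∞ volume)
    (u : L2Space n) : mulOp b (mulOp c u) = mulOp c (mulOp b u) := by
  rw [mulOp_mulOp hb hc, mulOp_mulOp hc hb]
  simp_rw [mul_comm]

theorem L2_inner_eq (u v : L2Space n) :
    inner ℂ u v = ∫ x, v x * starRingEnd ℂ (u x) := by
  rw [L2.inner_def]; rfl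

theorem L2_integrable (u v : L2Space n) : Integrable (fun x => v x * starRingEnd ℂ (u x)) :=
  L2.integrable_inner (𝕜 := ℂ) u v

theorem inner_mulOp {b : RSpace n → ℂ} (hb : MemLp b ∞ volume) (hr : ∀ x, starRingEnd ℂ (b x) = b x)
    (u v : L2Space n) : inner ℂ (mulOp b u) v = inner ℂ u (mulOp b v) := by
  rw [L2_inner_eq, L2_inner_eq]
  refine integral_congr_ae ?_
  filter_upwards [coeFn_mulOp hb u, coeFn_mulOp hb v] with x h1 h2
  rw [h1, h2, map_mul, hr]; ring

theorem norm_mulOp_le {b : RSpace n → ℂ} (hb : MemLp b ∞ volume) {C : ℝ}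
    (h : ∀ x, ‖b x‖ ≤ C) (u : L2Space n) : ‖mulOp b u‖ ≤ C * ‖u‖ := by
  refine Lp.norm_le_mul_norm_of_ae_le_mul ?_
  filter_upwards [coeFn_mulOp hb u] with x hx
  rw [hx, norm_mul]
  exact mul_le_mul_of_nonneg_right (h x) (norm_nonneg _)

theorem L2_norm_sq (u : L2Space n) : ‖u‖ ^ 2 = ∫ x, ‖u x‖ ^ 2 := by
  have h1 : (inner ℂ u u : ℂ) = ((‖u‖ ^ 2 : ℝ) : ℂ) := by
    rw [inner_self_eq_norm_sq_to_K]; simp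
  have h2 : (inner ℂ u u : ℂ) = ((∫ x, ‖u x‖ ^ 2 : ℝ) : ℂ) := by
    rw [L2_inner_eq, ← integral_complex_ofReal]
    refine integral_congr_ae (Eventually.of_forall fun x => ?_)
    simp [Complex.mul_conj, Complex.normSq_eq_norm_sq]
  exact_mod_cast h1.symm.trans h2

theorem L2_ofReal_norm_sq (u : L2Space n) : ENNReal.ofReal (‖u‖ ^ 2) = ∫⁻ x, ‖u x‖ₑ ^ 2 := by
  rw [L2_norm_sq, ofReal_integral_eq_lintegral_ofReal ((Lp.memLp u).integrable_norm_pow two_ne_zero)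
    (Eventually.of_forall fun x => by positivity)]
  refine lintegral_congr fun x => ?_
  rw [ENNReal.ofReal_pow (norm_nonneg _), ofReal_norm]

end Multiplication

/-! ### The sesquilinear form -/

section Form

variable {n : ℕ}

/-- The norm of `L²(ℝⁿ; ℂⁿ)`. -/
noncomputable def vecNorm (g : Fin n → L2Space n) : ℝ := √(∑ j, ‖g j‖ ^ 2)

theorem vecNorm_sq (g : Fin n → L2Space n) : vecNorm g ^ 2 = ∑ j, ‖g j‖ ^ 2 :=
  Real.sq_sqrt (by positivity)

theorem vecNorm_nonneg (g : Fin n → L2Space n) : 0 ≤ vecNorm g := Real.sqrt_nonneg _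

theorem norm_le_vecNorm (g : Fin n → L2Space n) (j : Fin n) : ‖g j‖ ≤ vecNorm g := by
  refine Real.le_sqrt_of_sq_le ?_
  exact Finset.single_le_sum (f := fun j => ‖g j‖ ^ 2) (fun i _ => by positivity)
    (Finset.mem_univ j)

/-- The form `∫ A g · conj k` on `L²(ℝⁿ; ℂⁿ)`. -/
noncomputable def sesqForm (A : RSpace n → Matrix (Fin n) (Fin n) ℂ)
    (g k : Fin n → L2Space n) : ℂ :=
  ∑ j, ∑ l, inner ℂ (k j) (mulOp (fun x => A x j l) (g l))

theorem sesqPairing_eq (M : Matrix (Fin n) (Fin n) ℂ) (ξ ζ : Fin n → ℂ) :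
    sesqPairing M ξ ζ = ∑ j, ∑ l, M j l * ξ l * starRingEnd ℂ (ζ j) := by
  simp [sesqPairing, dotProduct, Matrix.mulVec, Finset.sum_mul]

theorem sesqPairing_conjTranspose (M : Matrix (Fin n) (Fin n) ℂ) (ξ ζ : Fin n → ℂ) :
    sesqPairing Mᴴ ξ ζ = starRingEnd ℂ (sesqPairing M ζ ξ) := by
  rw [sesqPairing_eq, sesqPairing_eq, map_sum, Finset.sum_comm]
  refine Finset.sum_congr rfl fun l _ => ?_
  rw [map_sum]
  refine Finset.sum_congr rfl fun j _ => ?_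
  simp only [Matrix.conjTranspose_apply, map_mul, Complex.conj_conj, RCLike.star_def]
  ring

theorem IsElliptic.memLp {A : RSpace n → Matrix (Fin n) (Fin n) ℂ} (hA : IsElliptic A)
    (j l : Fin n) : MemLp (fun x => A x j l) ∞ volume := by
  obtain ⟨a, b, -, -, h⟩ := hA.bounds
  refine memLp_top_of_bound (hA.aestronglyMeasurable j l) b ?_
  filter_upwards [h] with x hx
  have h1 := (hx (EuclideanSpace.single l 1) (EuclideanSpace.single j 1)).2
  have h2 : sesqPairing (A x)
      (fun k => (EuclideanSpace.single l (1 : ℂ) : EuclideanSpace ℂ (Fin n)) k)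
      (fun k => (EuclideanSpace.single j (1 : ℂ) : EuclideanSpace ℂ (Fin n)) k) = A x j l := by
    rw [sesqPairing_eq, Finset.sum_eq_single j, Finset.sum_eq_single l]
    · simp
    · intro i _ hi; simp [hi]
    · simp
    · intro i _ hi; simp [hi]
    · simp
  rw [h2] at h1
  simpa using h1

theorem IsElliptic.conjTranspose {A : RSpace n → Matrix (Fin n) (Fin n) ℂ} (hA : IsElliptic A) :
    IsElliptic fun x => (A x)ᴴ := by
  refine ⟨fun j k => ?_, ?_⟩
  · exact Complex.continuous_conj.comp_aestronglyMeasurable (hA.aestronglyMeasurable k j)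
  · obtain ⟨a, b, h1, h2, h3⟩ := hA.bounds
    refine ⟨a, b, h1, h2, ?_⟩
    filter_upwards [h3] with x hx ξ ζ
    rw [sesqPairing_conjTranspose, sesqPairing_conjTranspose, Complex.conj_re, RCLike.norm_conj]
    exact ⟨(hx ξ ξ).1, by have := (hx ζ ξ).2; linarith⟩

theorem integrable_sesqPairing_and_integral {A : RSpace n → Matrix (Fin n) (Fin n) ℂ}
    (hA : IsElliptic A) (g k : Fin n → L2Space n) :
    Integrable (fun x => sesqPairing (A x) (fun i => g i x) (fun i => k i x)) ∧
    ∫ x, sesqPairing (A x) (fun i => g i x) (fun i => k i x) = sesqForm A g k := by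
  have h1 : ∀ j l, (fun x => A x j l * g l x * starRingEnd ℂ (k j x)) =ᵐ[volume]
      fun x => mulOp (fun x => A x j l) (g l) x * starRingEnd ℂ (k j x) := fun j l => by
    filter_upwards [coeFn_mulOp (hA.memLp j l) (g l)] with x hx
    rw [hx]
  have h2 : ∀ j l, Integrable fun x => A x j l * g l x * starRingEnd ℂ (k j x) := fun j l =>
    (L2_integrable _ _).congr (h1 j l).symm
  simp_rw [sesqPairing_eq]
  refine ⟨integrable_finsetSum _ fun j _ => integrable_finsetSum _ fun l _ => h2 j l, ?_⟩
  rw [integral_finsetSum _ fun j _ => integrable_finsetSum _ fun l _ => h2 j l, sesqForm]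
  refine Finset.sum_congr rfl fun j _ => ?_
  rw [integral_finsetSum _ fun l _ => h2 j l]
  refine Finset.sum_congr rfl fun l _ => ?_
  rw [L2_inner_eq]
  exact integral_congr_ae (h1 j l)

theorem sesqForm_conjTranspose {A : RSpace n → Matrix (Fin n) (Fin n) ℂ}
    (hA : IsElliptic A) (g k : Fin n → L2Space n) :
    sesqForm (fun x => (A x)ᴴ) g k = starRingEnd ℂ (sesqForm A k g) := by
  rw [← (integrable_sesqPairing_and_integral hA k g).2,
    ← (integrable_sesqPairing_and_integral hA.conjTranspose g k).2, ← integral_conj]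
  simp_rw [sesqPairing_conjTranspose]

theorem exists_re_sesqForm_ge {A : RSpace n → Matrix (Fin n) (Fin n) ℂ} (hA : IsElliptic A) :
    ∃ a, 0 < a ∧ ∀ g : Fin n → L2Space n, a * vecNorm g ^ 2 ≤ (sesqForm A g g).re := by
  obtain ⟨a, b, ha, -, h⟩ := hA.bounds
  refine ⟨a, ha, fun g => ?_⟩
  obtain ⟨h1, h2⟩ := integrable_sesqPairing_and_integral hA g g
  have h3 : ∀ j, Integrable fun x => ‖g j x‖ ^ 2 := fun j =>
    (Lp.memLp (g j)).integrable_norm_pow two_ne_zero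
  rw [← h2, vecNorm_sq]
  have h4 : (∫ x, sesqPairing (A x) (fun i => g i x) (fun i => g i x)).re =
      ∫ x, (sesqPairing (A x) (fun i => g i x) (fun i => g i x)).re :=
    (integral_re h1).symm
  simp_rw [L2_norm_sq]
  rw [h4, ← integral_finsetSum _ fun j _ => h3 j, ← integral_const_mul]
  refine integral_mono_ae ((integrable_finsetSum _ fun j _ => h3 j).const_mul _) h1.re ?_
  filter_upwards [h] with x hx
  have h5 := (hx (WithLp.toLp 2 fun i => g i x) (WithLp.toLp 2 fun i => g i x)).1
  rw [EuclideanSpace.norm_sq_eq] at h5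
  exact h5

theorem exists_norm_sesqForm_le (A : RSpace n → Matrix (Fin n) (Fin n) ℂ) :
    ∃ Λ, 0 < Λ ∧ ∀ g k : Fin n → L2Space n, ‖sesqForm A g k‖ ≤ Λ * (vecNorm g * vecNorm k) := by
  refine ⟨(∑ j, ∑ l, ‖mulOp (fun x => A x j l)‖) + 1, by positivity, fun g k => ?_⟩
  have h0 : 0 ≤ vecNorm g * vecNorm k := mul_nonneg (vecNorm_nonneg _) (vecNorm_nonneg _)
  refine le_trans ?_ (mul_le_mul_of_nonneg_right (le_add_of_nonneg_right zero_le_one) h0)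
  rw [sesqForm, Finset.sum_mul]
  refine norm_sum_le_of_le _ fun j _ => ?_
  rw [Finset.sum_mul]
  refine norm_sum_le_of_le _ fun l _ => ?_
  refine (norm_inner_le_norm _ _).trans ?_
  have h1 := (mulOp (fun x => A x j l)).le_opNorm (g l)
  calc ‖k j‖ * ‖mulOp (fun x => A x j l) (g l)‖
      ≤ vecNorm k * (‖mulOp (fun x => A x j l)‖ * vecNorm g) := by
        refine mul_le_mul (norm_le_vecNorm _ _) (h1.trans ?_) (norm_nonneg _) (vecNorm_nonneg _)
        exact mul_le_mul_of_nonneg_left (norm_le_vecNorm _ _) (norm_nonneg _)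
    _ = _ := by ring

theorem sesqForm_add_right (A : RSpace n → Matrix (Fin n) (Fin n) ℂ) (g k k' : Fin n → L2Space n) :
    sesqForm A g (fun j => k j + k' j) = sesqForm A g k + sesqForm A g k' := by
  simp only [sesqForm, inner_add_left, Finset.sum_add_distrib]

theorem sesqForm_add_left (A : RSpace n → Matrix (Fin n) (Fin n) ℂ) (g g' k : Fin n → L2Space n) :
    sesqForm A (fun j => g j + g' j) k = sesqForm A g k + sesqForm A g' k := by
  simp only [sesqForm, map_add, inner_add_right, Finset.sum_add_distrib]

theorem sesqForm_smul_left (A : RSpace n → Matrix (Fin n) (Fin n) ℂ) (c : ℂ)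
    (g k : Fin n → L2Space n) : sesqForm A (fun j => c • g j) k = c * sesqForm A g k := by
  simp only [sesqForm, map_smul, inner_smul_right, Finset.mul_sum]

/-- A real multiplier can be moved from one argument of the form to the other. -/
theorem sesqForm_mulOp {A : RSpace n → Matrix (Fin n) (Fin n) ℂ} (hA : IsElliptic A)
    {b : RSpace n → ℂ} (hb : MemLp b ∞ volume) (hr : ∀ x, starRingEnd ℂ (b x) = b x)
    (g k : Fin n → L2Space n) :
    sesqForm A (fun j => mulOp b (g j)) k = sesqForm A g (fun j => mulOp b (k j)) := by
  simp only [sesqForm]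
  refine Finset.sum_congr rfl fun j _ => Finset.sum_congr rfl fun l _ => ?_
  rw [inner_mulOp hb hr, mulOp_comm hb (hA.memLp j l)]

theorem isEllipticImage_iff {A : RSpace n → Matrix (Fin n) (Fin n) ℂ} (hA : IsElliptic A)
    {u h : L2Space n} : IsEllipticImage A u h ↔ ∃ g, HasWeakGradient u g ∧
      ∀ v k, HasWeakGradient v k → sesqForm A g k = inner ℂ v h := by
  unfold IsEllipticImage
  simp_rw [(integrable_sesqPairing_and_integral hA _ _).2, L2_inner_eq]

end Form

/-! ### The space `W^{1,2}` and maximal accretivity -/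

section Sobolev

variable {n : ℕ}

theorem exists_inner_eq_integral_smul {φ : RSpace n → ℝ} (hφ : Continuous φ)
    (hc : HasCompactSupport φ) : ∃ a : L2Space n, ∀ u : L2Space n,
      ∫ x, φ x • u x = inner ℂ a u := by
  have h : MemLp (fun x => (φ x : ℂ)) 2 (volume : Measure (RSpace n)) :=
    (hφ.memLp_of_hasCompactSupport hc).ofReal
  refine ⟨h.toLp, fun u => ?_⟩
  rw [L2_inner_eq]
  refine integral_congr_ae ?_
  filter_upwards [h.coeFn_toLp] with x hx
  rw [hx]; simp [mul_comm]

theorem continuous_fderiv_single {φ : RSpace n → ℝ} (hφ : ContDiff ℝ ∞ φ) (j : Fin n) :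
    Continuous fun x => fderiv ℝ φ x (EuclideanSpace.single j 1) :=
  (hφ.continuous_fderiv (by simp)).clm_apply continuous_const

/-- Each condition defining the weak gradient is the vanishing of a continuous linear functional. -/
theorem exists_weakGradient_functional (j : Fin n) {φ : RSpace n → ℝ} (hφ : ContDiff ℝ ∞ φ)
    (hc : HasCompactSupport φ) : ∃ a b : L2Space n, ∀ (u : L2Space n) (g : Fin n → L2Space n),
      ∫ x, (fderiv ℝ φ x (EuclideanSpace.single j 1)) • u x = - ∫ x, φ x • g j x ↔
      inner ℂ a u + inner ℂ b (g j) = 0 := by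
  obtain ⟨a, ha⟩ := exists_inner_eq_integral_smul (continuous_fderiv_single hφ j)
    (hc.fderiv_apply ℝ _)
  obtain ⟨b, hb⟩ := exists_inner_eq_integral_smul hφ.continuous hc
  exact ⟨a, b, fun u g => by rw [ha, hb, eq_neg_iff_add_eq_zero]⟩

theorem HasWeakGradient.add {u v : L2Space n} {g k : Fin n → L2Space n} (h1 : HasWeakGradient u g)
    (h2 : HasWeakGradient v k) : HasWeakGradient (u + v) (fun j => g j + k j) := by
  intro j φ hφ hc
  obtain ⟨a, b, hab⟩ := exists_weakGradient_functional j hφ hc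
  have e1 := (hab u g).1 (h1 j φ hφ hc)
  have e2 := (hab v k).1 (h2 j φ hφ hc)
  rw [hab (u + v) (fun j => g j + k j), inner_add_right, inner_add_right]
  linear_combination e1 + e2

theorem HasWeakGradient.smul {u : L2Space n} {g : Fin n → L2Space n} (h1 : HasWeakGradient u g)
    (c : ℂ) : HasWeakGradient (c • u) (fun j => c • g j) := by
  intro j φ hφ hc
  obtain ⟨a, b, hab⟩ := exists_weakGradient_functional j hφ hc
  have e1 := (hab u g).1 (h1 j φ hφ hc)
  rw [hab (c • u) (fun j => c • g j), inner_smul_right, inner_smul_right]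
  linear_combination c * e1

theorem hasWeakGradient_zero : HasWeakGradient (0 : L2Space n) (fun _ => 0) := by
  intro j φ hφ hc
  obtain ⟨a, b, hab⟩ := exists_weakGradient_functional j hφ hc
  rw [hab 0 (fun _ => 0)]
  simp

variable (n) in
/-- The Hilbert space `W^{1,2}(ℝⁿ)`, as the space of pairs `(u, ∇u)`; the component `none` is `u`
and the component `some j` is `∂_j u`. -/
def sobolevGraph : Submodule ℂ (PiLp 2 fun _ : Option (Fin n) => L2Space n) where
  carrier := {U | HasWeakGradient (U none) fun j => U (some j)}
  add_mem' h1 h2 := h1.add h2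
  zero_mem' := hasWeakGradient_zero
  smul_mem' c _ h := h.smul c

theorem isClosed_sobolevGraph :
    IsClosed (sobolevGraph n : Set (PiLp 2 fun _ : Option (Fin n) => L2Space n)) := by
  have : (sobolevGraph n : Set (PiLp 2 fun _ : Option (Fin n) => L2Space n)) =
      ⋂ (j : Fin n) (φ : RSpace n → ℝ) (_ : ContDiff ℝ ∞ φ) (_ : HasCompactSupport φ),
        {U | ∫ x, (fderiv ℝ φ x (EuclideanSpace.single j 1)) • (U none) x =
          - ∫ x, φ x • (U (some j)) x} := by
    ext U; simp [sobolevGraph, HasWeakGradient]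
  rw [this]
  refine isClosed_iInter fun j => isClosed_iInter fun φ => isClosed_iInter fun hφ =>
    isClosed_iInter fun hc => ?_
  obtain ⟨a, b, hab⟩ := exists_weakGradient_functional j hφ hc
  have h2 : {U : PiLp 2 fun _ : Option (Fin n) => L2Space n |
      ∫ x, (fderiv ℝ φ x (EuclideanSpace.single j 1)) • (U none) x =
          - ∫ x, φ x • (U (some j)) x} = {U | inner ℂ a (U none) + inner ℂ b (U (some j)) = 0} := by
    ext U; exact hab (U none) fun j => U (some j)
  rw [h2]
  exact isClosed_eq (by fun_prop) continuous_const

/-- The range of `1 + ε L` is the whole of `L²`, by the Lax–Milgram theorem for the compression `S`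
to `W^{1,2}(ℝⁿ)` of the operator `C` on `L²(ℝⁿ)^{1+n}` with the form
`⟨w, u⟩ + ε ∫ A ∇u · conj ∇w`. -/
theorem exists_isEllipticImage_add_smul {A : RSpace n → Matrix (Fin n) (Fin n) ℂ}
    (hA : IsElliptic A) {ε : ℝ} (hε : 0 < ε) (f : L2Space n) :
    ∃ u h, IsEllipticImage A u h ∧ u + (ε : ℂ) • h = f := by
  obtain ⟨a, ha, hcoer⟩ := exists_re_sesqForm_ge hA
  let E := PiLp 2 fun _ : Option (Fin n) => L2Space n
  let V := sobolevGraph n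
  have : CompleteSpace V := isClosed_sobolevGraph.completeSpace_coe
  let pr : ∀ o : Option (Fin n), E →L[ℂ] L2Space n := fun o => PiLp.proj 2 _ o
  let C : E →L[ℂ] E := (PiLp.continuousLinearEquiv 2 ℂ _).symm.toContinuousLinearMap.comp
    (ContinuousLinearMap.pi fun o => match o with
      | none => pr none
      | some j => (ε : ℂ) • ∑ l, (mulOp fun x => A x j l).comp (pr (some l)))
  have hC : ∀ U W : E, inner ℂ W (C U) = inner ℂ (W none) (U none) +
      (ε : ℂ) * sesqForm A (fun j => U (some j)) (fun j => W (some j)) := by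
    intro U W
    rw [PiLp.inner_apply, Fintype.sum_option, sesqForm, Finset.mul_sum]
    congr 1
    refine Finset.sum_congr rfl fun j _ => ?_
    have : (C U) (some j) = (ε : ℂ) • ∑ l, mulOp (fun x => A x j l) (U (some l)) := by
      change ((ε : ℂ) • ∑ l, (mulOp fun x => A x j l).comp (pr (some l))) U = _
      rw [smul_apply, sum_apply]
      rfl
    rw [this, inner_smul_right, inner_sum]
  let P : E →L[ℂ] V := V.orthogonalProjectionOnto
  let S : V →L[ℂ] V := P.comp (C.comp V.subtypeL)
  have hS : ∀ U W : V, inner ℂ W (S U) = inner ℂ (W : E) (C U) := fun U W =>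
    Submodule.inner_orthogonalProjectionOnto_eq_of_mem_left W (C U)
  have hunit : IsUnit S := by
    have hm : 0 < min 1 (ε * a) := lt_min one_pos (by positivity)
    refine ContinuousLinearMap.isUnit_of_forall_le_norm_inner_map S (c := ⟨min 1 (ε * a), hm.le⟩)
      hm fun U => ?_
    rw [norm_inner_symm, hS, hC]
    refine le_trans ?_ (Complex.re_le_norm _)
    have h1 := hcoer fun j => (U : E) (some j)
    rw [vecNorm_sq] at h1
    have h2 : ‖U‖ ^ 2 = ‖(U : E) none‖ ^ 2 + ∑ j, ‖(U : E) (some j)‖ ^ 2 := by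
      rw [Submodule.coe_norm, PiLp.norm_sq_eq_of_L2, Fintype.sum_option]
    rw [inner_self_eq_norm_sq_to_K, Complex.add_re, Complex.re_ofReal_mul, h2]
    simp only [Complex.coe_algebraMap, ← Complex.ofReal_pow, Complex.ofReal_re]
    change _ * min 1 (ε * a) ≤ _
    have h3 : 0 ≤ ∑ j, ‖(U : E) (some j)‖ ^ 2 := by positivity
    have h4 := mul_le_mul_of_nonneg_left h1 hε.le
    nlinarith [min_le_left 1 (ε * a), min_le_right 1 (ε * a), sq_nonneg ‖(U : E) none‖]
  let F : E := WithLp.toLp 2 fun o => match o with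
    | none => f
    | some _ => 0
  obtain ⟨Si, hSi⟩ := hunit.exists_right_inv
  let U : V := Si (P F)
  have hU : S U = P F := DFunLike.congr_fun hSi (P F)
  have hε' : (ε : ℂ) ≠ 0 := by exact_mod_cast hε.ne'
  refine ⟨(U : E) none, (ε : ℂ)⁻¹ • (f - (U : E) none), ?_, ?_⟩
  · rw [isEllipticImage_iff hA]
    refine ⟨fun j => (U : E) (some j), U.2, fun v k hvk => ?_⟩
    let W : V := ⟨WithLp.toLp 2 fun o => match o with
      | none => v
      | some j => k j, hvk⟩
    have h1 : inner ℂ W (S U) = inner ℂ (W : E) F := by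
      rw [hU]; exact Submodule.inner_orthogonalProjectionOnto_eq_of_mem_left W F
    rw [hS, hC, PiLp.inner_apply, Fintype.sum_option] at h1
    have h2 : inner ℂ v ((U : E) none) + (ε : ℂ) * sesqForm A (fun j => (U : E) (some j)) k =
        inner ℂ v f := by
      simpa [W, F] using h1
    rw [inner_smul_right, inner_sub_right, ← h2]
    field_simp
    ring
  · rw [smul_smul, mul_inv_cancel₀ hε', one_smul, add_sub_cancel]

theorem isMaxAccretive_isEllipticImage {A : RSpace n → Matrix (Fin n) (Fin n) ℂ}
    (hA : IsElliptic A) : IsMaxAccretive (IsEllipticImage A) where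
  add h1 h2 := by
    rw [isEllipticImage_iff hA] at *
    obtain ⟨g, hg, h1⟩ := h1
    obtain ⟨g', hg', h2⟩ := h2
    refine ⟨_, hg.add hg', fun v k hvk => ?_⟩
    rw [sesqForm_add_left, h1 v k hvk, h2 v k hvk, inner_add_right]
  smul c _ _ h1 := by
    rw [isEllipticImage_iff hA] at *
    obtain ⟨g, hg, h1⟩ := h1
    refine ⟨_, hg.smul c, fun v k hvk => ?_⟩
    rw [sesqForm_smul_left, h1 v k hvk, inner_smul_right]
  unique h1 h2 := h1.unique h2
  accretive h1 := by
    rw [isEllipticImage_iff hA] at h1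
    obtain ⟨g, hg, h1⟩ := h1
    obtain ⟨a, ha, hcoer⟩ := exists_re_sesqForm_ge hA
    rw [← h1 _ g hg]
    exact le_trans (by positivity) (hcoer g)
  surj ε hε f := exists_isEllipticImage_add_smul hA hε f

theorem isHeatSemigroup_iff {A : RSpace n → Matrix (Fin n) (Fin n) ℂ}
    {T : ℝ → L2Space n →L[ℂ] L2Space n} :
    IsHeatSemigroup A T ↔ IsContractionSemigroup (IsEllipticImage A) T :=
  ⟨fun h => ⟨h.1, h.2, h.3, h.4, h.5⟩, fun h => ⟨h.1, h.2, h.3, h.4, h.5⟩⟩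

theorem isHeatSemigroup_heatSemigroup {A : RSpace n → Matrix (Fin n) (Fin n) ℂ}
    (hA : IsElliptic A) : IsHeatSemigroup A (heatSemigroup A) := by
  obtain ⟨T, hT⟩ := (isMaxAccretive_isEllipticImage hA).exists_semigroup
  have h : ∃ T, IsHeatSemigroup A T := ⟨T, isHeatSemigroup_iff.2 hT⟩
  rw [heatSemigroup, dif_pos h]
  exact h.choose_spec

theorem HasWeakGradient.weakGradient_eq {u : L2Space n} {g : Fin n → L2Space n}
    (h : HasWeakGradient u g) : weakGradient u = g := by
  have h' : ∃ g, HasWeakGradient u g := ⟨g, h⟩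
  rw [weakGradient, dif_pos h']
  exact h'.choose_spec.unique h

theorem IsEllipticImage.ellipticOp_eq {A : RSpace n → Matrix (Fin n) (Fin n) ℂ} {u h : L2Space n}
    (H : IsEllipticImage A u h) : ellipticOp A u = h := by
  have h' : ∃ h, IsEllipticImage A u h := ⟨h, H⟩
  rw [ellipticOp, dif_pos h']
  exact h'.choose_spec.unique H

theorem IsEllipticImage.hasWeakGradient {A : RSpace n → Matrix (Fin n) (Fin n) ℂ}
    {u h : L2Space n} (H : IsEllipticImage A u h) : HasWeakGradient u (weakGradient u) := by
  obtain ⟨g, hg, -⟩ := H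
  rwa [hg.weakGradient_eq]

theorem IsEllipticImage.sesqForm_eq {A : RSpace n → Matrix (Fin n) (Fin n) ℂ} (hA : IsElliptic A)
    {u h v : L2Space n} {k : Fin n → L2Space n} (H : IsEllipticImage A u h)
    (hvk : HasWeakGradient v k) : sesqForm A (weakGradient u) k = inner ℂ v h := by
  rw [isEllipticImage_iff hA] at H
  obtain ⟨g, hg, H⟩ := H
  rw [hg.weakGradient_eq, H v k hvk]

end Sobolev

/-! ### Exponential weights -/

section Weights

variable {n : ℕ}

/-- The logarithm of an admissible weight: smooth, bounded, and with gradient at most `ρ`. Only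
`ρ`, not the bound on `ψ`, enters the weighted estimates. -/
structure IsLogWeight (ρ : ℝ) (ψ : RSpace n → ℝ) : Prop where
  contDiff : ContDiff ℝ ∞ ψ
  bounded : ∃ M, ∀ x, |ψ x| ≤ M
  norm_fderiv_le : ∀ x, ‖fderiv ℝ ψ x‖ ≤ ρ

theorem isLogWeight_zero : IsLogWeight 0 (fun _ : RSpace n => 0) :=
  ⟨contDiff_const, ⟨0, by simp⟩, by simp⟩

theorem IsLogWeight.neg {ρ : ℝ} {ψ : RSpace n → ℝ} (h : IsLogWeight ρ ψ) :
    IsLogWeight ρ (fun x => -ψ x) := by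
  refine ⟨h.contDiff.neg, ?_, fun x => ?_⟩
  · obtain ⟨M, hM⟩ := h.bounded
    exact ⟨M, fun x => by rw [abs_neg]; exact hM x⟩
  · rw [fderiv_fun_neg, norm_neg]; exact h.norm_fderiv_le x

theorem memLp_top_ofReal {b : RSpace n → ℝ} (hb : Continuous b) {M : ℝ} (hM : ∀ x, |b x| ≤ M) :
    MemLp (fun x => (b x : ℂ)) ∞ volume :=
  memLp_top_of_bound (Complex.continuous_ofReal.comp hb).aestronglyMeasurable M
    (Eventually.of_forall fun x => by simpa using hM x)

/-- Multiplication by `e^ψ`. -/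
noncomputable def expWeight (ψ : RSpace n → ℝ) : L2Space n →L[ℂ] L2Space n :=
  mulOp fun x => (Real.exp (ψ x) : ℂ)

theorem memLp_top_exp {ψ : RSpace n → ℝ} (hc : Continuous ψ) {M : ℝ} (hM : ∀ x, |ψ x| ≤ M) :
    MemLp (fun x => (Real.exp (ψ x) : ℂ)) ∞ (volume : Measure (RSpace n)) :=
  memLp_top_ofReal (Real.continuous_exp.comp hc) (M := Real.exp M) fun x => by
    rw [Real.abs_exp]; exact Real.exp_le_exp.2 ((le_abs_self _).trans (hM x))

theorem IsLogWeight.memLp {ρ : ℝ} {ψ : RSpace n → ℝ} (h : IsLogWeight ρ ψ) :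
    MemLp (fun x => (Real.exp (ψ x) : ℂ)) ∞ (volume : Measure (RSpace n)) := by
  obtain ⟨M, hM⟩ := h.bounded
  exact memLp_top_exp h.contDiff.continuous hM

theorem IsLogWeight.inner_expWeight {ρ : ℝ} {ψ : RSpace n → ℝ} (h : IsLogWeight ρ ψ)
    (u v : L2Space n) : inner ℂ (expWeight ψ u) v = inner ℂ u (expWeight ψ v) :=
  inner_mulOp h.memLp (fun _ => Complex.conj_ofReal _) u v

theorem IsLogWeight.re_inner_expWeight {ρ : ℝ} {ψ : RSpace n → ℝ} (h : IsLogWeight ρ ψ)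
    (u : L2Space n) : (inner ℂ (expWeight ψ (expWeight ψ u)) u).re = ‖expWeight ψ u‖ ^ 2 := by
  rw [h.inner_expWeight, inner_self_eq_norm_sq_to_K]
  simp only [Complex.coe_algebraMap, ← Complex.ofReal_pow, Complex.ofReal_re]

theorem IsLogWeight.expWeight_neg {ρ : ℝ} {ψ : RSpace n → ℝ} (h : IsLogWeight ρ ψ)
    (u : L2Space n) : expWeight (fun x => -ψ x) (expWeight ψ u) = u := by
  rw [expWeight, expWeight, mulOp_mulOp h.neg.memLp h.memLp]
  apply Lp.ext
  filter_upwards [coeFn_mulOp (h.memLp.mul h.neg.memLp (r := ∞)) u] with x hx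
  refine hx.trans ?_
  rw [Pi.mul_apply, ← Complex.ofReal_mul, ← Real.exp_add, neg_add_cancel, Real.exp_zero,
    Complex.ofReal_one, one_mul]

theorem IsLogWeight.ofReal_norm_sq {ρ : ℝ} {ψ : RSpace n → ℝ} (h : IsLogWeight ρ ψ)
    (u : L2Space n) : ENNReal.ofReal (‖expWeight ψ u‖ ^ 2) =
      ∫⁻ x, ENNReal.ofReal (Real.exp (2 * ψ x)) * ‖u x‖ₑ ^ 2 := by
  rw [L2_ofReal_norm_sq]
  refine lintegral_congr_ae ?_
  filter_upwards [coeFn_mulOp h.memLp u] with x hx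
  rw [expWeight, hx, enorm_mul, mul_pow, ← ofReal_norm (Real.exp (ψ x) : ℂ), Complex.norm_real,
    Real.norm_of_nonneg (Real.exp_pos _).le, ← ENNReal.ofReal_pow (Real.exp_pos _).le,
    ← Real.exp_nat_mul]
  norm_num

theorem expWeight_zero (u : L2Space n) : expWeight (fun _ => 0) u = u := by
  apply Lp.ext
  filter_upwards [coeFn_mulOp (isLogWeight_zero (n := n)).memLp u] with x hx
  rw [expWeight, hx]; simp

theorem integrable_smul_L2 {φ : RSpace n → ℝ} (hφ : Continuous φ) (hc : HasCompactSupport φ)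
    (u : L2Space n) : Integrable fun x => φ x • u x := by
  have h : MemLp (fun x => (φ x : ℂ)) 2 (volume : Measure (RSpace n)) :=
    (hφ.memLp_of_hasCompactSupport hc).ofReal
  refine (L2_integrable h.toLp u).congr ?_
  filter_upwards [h.coeFn_toLp] with x hx
  rw [hx]; simp [mul_comm]

/-- The product rule for a smooth bounded multiplier with bounded derivatives. -/
theorem HasWeakGradient.smooth_mul {v : L2Space n} {k : Fin n → L2Space n} (h : HasWeakGradient v k)
    {b : RSpace n → ℝ} (hb : ContDiff ℝ ∞ b) {M : ℝ} (hM : ∀ x, |b x| ≤ M)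
    (hM' : ∀ x j, |fderiv ℝ b x (EuclideanSpace.single j 1)| ≤ M) :
    HasWeakGradient (mulOp (fun x => (b x : ℂ)) v) fun j =>
      mulOp (fun x => (b x : ℂ)) (k j) +
        mulOp (fun x => (fderiv ℝ b x (EuclideanSpace.single j 1) : ℂ)) v := by
  intro j φ hφ hc
  have hb1 := memLp_top_ofReal hb.continuous hM
  have hb2 := memLp_top_ofReal (continuous_fderiv_single hb j) (fun x => hM' x j)
  have h1 := h j (fun x => φ x * b x) (hφ.mul hb) hc.mul_right
  have e1 : ∀ x, fderiv ℝ (fun x => φ x * b x) x (EuclideanSpace.single j 1) =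
      φ x * fderiv ℝ b x (EuclideanSpace.single j 1) +
        fderiv ℝ φ x (EuclideanSpace.single j 1) * b x := fun x => by
    rw [fderiv_fun_mul (hφ.differentiable (by simp) x) (hb.differentiable (by simp) x)]
    simp [mul_comm]
  have i1 : Integrable fun x => (φ x * fderiv ℝ b x (EuclideanSpace.single j 1)) • v x :=
    integrable_smul_L2 (hφ.continuous.mul (continuous_fderiv_single hb j)) hc.mul_right v
  have i2 : Integrable fun x => (fderiv ℝ φ x (EuclideanSpace.single j 1) * b x) • v x :=
    integrable_smul_L2 ((continuous_fderiv_single hφ j).mul hb.continuous)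
      (hc.fderiv_apply ℝ _).mul_right v
  simp_rw [e1, add_smul] at h1
  rw [integral_add i1 i2] at h1
  obtain ⟨a, ha⟩ := exists_inner_eq_integral_smul hφ.continuous hc
  rw [ha, inner_add_right, ← ha, ← ha]
  have e2 : ∀ {c : RSpace n → ℝ} (_ : MemLp (fun x => (c x : ℂ)) ∞ (volume : Measure (RSpace n)))
      (χ : RSpace n → ℝ) (w : L2Space n),
      ∫ x, χ x • mulOp (fun x => (c x : ℂ)) w x = ∫ x, (χ x * c x) • w x := by
    intro c hc χ w
    refine integral_congr_ae ?_
    filter_upwards [coeFn_mulOp hc w] with x hx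
    rw [hx]; simp [mul_assoc]
  rw [e2 hb1, e2 hb1, e2 hb2]
  linear_combination h1

/-- Coercivity in a weighted norm, by testing the equation with `e^{2ψ} u`, whose gradient is
`e^ψ (e^ψ ∇u + 2 ∇ψ e^ψ u)`. -/
theorem weighted_coercive {A : RSpace n → Matrix (Fin n) (Fin n) ℂ} (hA : IsElliptic A)
    {a Λ : ℝ} (ha : 0 < a)
    (hcoer : ∀ g : Fin n → L2Space n, a * vecNorm g ^ 2 ≤ (sesqForm A g g).re)
    (hbd : ∀ g k : Fin n → L2Space n, ‖sesqForm A g k‖ ≤ Λ * (vecNorm g * vecNorm k))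
    {ρ : ℝ} {ψ : RSpace n → ℝ} (hψ : IsLogWeight ρ ψ) {u h : L2Space n}
    (H : IsEllipticImage A u h) :
    a / 2 * vecNorm (fun j => expWeight ψ (weakGradient u j)) ^ 2 ≤
      (inner ℂ (expWeight ψ (expWeight ψ u)) h).re +
        2 * Λ ^ 2 * n / a * ρ ^ 2 * ‖expWeight ψ u‖ ^ 2 := by
  obtain ⟨M, hM⟩ := hψ.bounded
  have hρ : 0 ≤ ρ := (norm_nonneg _).trans (hψ.norm_fderiv_le 0)
  set g := weakGradient u with hg
  set b : RSpace n → ℝ := fun x => Real.exp (ψ x) * Real.exp (ψ x) with hb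
  have hbs : ContDiff ℝ ∞ b := hψ.contDiff.exp.mul hψ.contDiff.exp
  have hdψ : ∀ x j, |fderiv ℝ ψ x (EuclideanSpace.single j 1)| ≤ ρ := fun x j => by
    have := (fderiv ℝ ψ x).le_of_opNorm_le (hψ.norm_fderiv_le x) (EuclideanSpace.single j 1)
    simpa using this
  have hdb : ∀ x j, fderiv ℝ b x (EuclideanSpace.single j 1) =
      b x * (2 * fderiv ℝ ψ x (EuclideanSpace.single j 1)) := fun x j => by
    have h1 := ((hψ.contDiff.differentiable (by simp) x).hasFDerivAt).exp
    have h2 : fderiv ℝ b x = _ := (h1.mul h1).fderiv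
    rw [h2]
    simp [hb]; ring
  have hb0 : ∀ x, |b x| ≤ Real.exp M * Real.exp M := fun x => by
    have h1 : Real.exp (ψ x) ≤ Real.exp M := Real.exp_le_exp.2 ((le_abs_self _).trans (hM x))
    rw [abs_of_pos (by positivity)]
    exact mul_le_mul h1 h1 (Real.exp_pos _).le (Real.exp_pos _).le
  have hd : ∀ j, MemLp (fun x => ((2 * fderiv ℝ ψ x (EuclideanSpace.single j 1) : ℝ) : ℂ)) ∞
      (volume : Measure (RSpace n)) := fun j =>
    memLp_top_ofReal (continuous_const.mul (continuous_fderiv_single hψ.contDiff j))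
      (M := 2 * ρ) fun x => by rw [abs_mul, abs_two]; linarith [hdψ x j]
  have hbm : MemLp (fun x => (b x : ℂ)) ∞ (volume : Measure (RSpace n)) :=
    memLp_top_ofReal hbs.continuous hb0
  have hWW : ∀ w : L2Space n, mulOp (fun x => (b x : ℂ)) w = expWeight ψ (expWeight ψ w) :=
    fun w => by
      rw [expWeight, mulOp_mulOp hψ.memLp hψ.memLp]
      simp [hb]
  set d : Fin n → L2Space n := fun j =>
    mulOp (fun x => ((2 * fderiv ℝ ψ x (EuclideanSpace.single j 1) : ℝ) : ℂ)) (expWeight ψ u)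
    with hdd
  have hgrad := H.hasWeakGradient.smooth_mul hbs (M := Real.exp M * Real.exp M * (1 + 2 * ρ))
    (fun x => (hb0 x).trans (le_mul_of_one_le_right (by positivity) (by linarith)))
    (fun x j => by
      rw [hdb, abs_mul, abs_mul 2, abs_two]
      exact mul_le_mul (hb0 x) (by linarith [hdψ x j]) (by positivity) (by positivity))
  have hk : (fun j => mulOp (fun x => (b x : ℂ)) (weakGradient u j) +
      mulOp (fun x => (fderiv ℝ b x (EuclideanSpace.single j 1) : ℂ)) u) =
      fun j => expWeight ψ (expWeight ψ (g j) + d j) := by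
    funext j
    rw [hWW, _root_.map_add, hdd]
    congr 1
    simp_rw [hdb, Complex.ofReal_mul (b _)]
    rw [← mulOp_mulOp hbm (hd j), hWW, expWeight, mulOp_comm hψ.memLp (hd j)]
  rw [hk] at hgrad
  have h1 := H.sesqForm_eq hA hgrad
  rw [hWW, expWeight, ← sesqForm_mulOp hA hψ.memLp (fun x => Complex.conj_ofReal _), ← expWeight,
    sesqForm_add_right] at h1
  set X := fun j => expWeight ψ (g j) with hX
  have h2 := hcoer X
  have h3 := (Complex.abs_re_le_norm _).trans (hbd X d)
  have h4 : vecNorm d ^ 2 ≤ n * (2 * ρ * ‖expWeight ψ u‖) ^ 2 := by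
    rw [vecNorm_sq]
    refine (Finset.sum_le_card_nsmul _ _ ((2 * ρ * ‖expWeight ψ u‖) ^ 2) fun j _ => ?_).trans_eq
      (by simp)
    refine pow_le_pow_left₀ (norm_nonneg _) (norm_mulOp_le (hd j) (fun x => ?_) _) 2
    rw [Complex.norm_real, Real.norm_eq_abs, abs_mul, abs_two]
    linarith [hdψ x j]
  rw [← h1, Complex.add_re]
  have h5 := (abs_le.1 h3).1
  have h6 : Λ * (vecNorm X * vecNorm d) ≤
      a / 2 * vecNorm X ^ 2 + Λ ^ 2 / (2 * a) * vecNorm d ^ 2 := by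
    have h7 : a / 2 * vecNorm X ^ 2 + Λ ^ 2 / (2 * a) * vecNorm d ^ 2 -
        Λ * (vecNorm X * vecNorm d) =
        (a * vecNorm X - Λ * vecNorm d) ^ 2 / (2 * a) := by field_simp; ring
    have h8 : 0 ≤ (a * vecNorm X - Λ * vecNorm d) ^ 2 / (2 * a) := by positivity
    linarith
  have h9 : Λ ^ 2 / (2 * a) * vecNorm d ^ 2 ≤
      2 * Λ ^ 2 * n / a * ρ ^ 2 * ‖expWeight ψ u‖ ^ 2 := by
    refine (mul_le_mul_of_nonneg_left h4 (by positivity)).trans_eq ?_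
    field_simp
  linarith

end Weights

/-! ### Weighted estimates for the heat semigroup -/

section HeatEstimates

variable {n : ℕ} {A : RSpace n → Matrix (Fin n) (Fin n) ℂ}

theorem isContractionSemigroup_heatSemigroup (hA : IsElliptic A) :
    IsContractionSemigroup (IsEllipticImage A) (heatSemigroup A) :=
  isHeatSemigroup_iff.1 (isHeatSemigroup_heatSemigroup hA)

theorem inner_eq_of_isEllipticImage_conjTranspose (hA : IsElliptic A) {u h v k : L2Space n}
    (H : IsEllipticImage A u h) (H' : IsEllipticImage (fun x => (A x)ᴴ) v k) :
    inner ℂ v h = inner ℂ k u := by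
  rw [← H.sesqForm_eq hA H'.hasWeakGradient, ← inner_conj_symm,
    ← H'.sesqForm_eq hA.conjTranspose H.hasWeakGradient, sesqForm_conjTranspose hA,
    Complex.conj_conj]

/-- Weighted contractivity, smoothing and Caccioppoli estimates, with constants depending on the
weight only through `ρ`. -/
theorem exists_weighted_estimates (hA : IsElliptic A) : ∃ a Λ K : ℝ, 0 < a ∧ 0 < Λ ∧ 0 ≤ K ∧
    ∀ (ρ : ℝ) (ψ : RSpace n → ℝ), IsLogWeight ρ ψ →
      (∀ u h, IsEllipticImage A u h →
        a * vecNorm (fun j => expWeight ψ (weakGradient u j)) ^ 2 ≤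
          (inner ℂ (expWeight ψ (expWeight ψ u)) h).re + K * ρ ^ 2 * ‖expWeight ψ u‖ ^ 2) ∧
      (∀ s f, 0 ≤ s → ‖expWeight ψ (heatSemigroup A s f)‖ ^ 2 ≤
        Real.exp (2 * (K * ρ ^ 2) * s) * ‖expWeight ψ f‖ ^ 2) ∧
      ∀ s u h, 0 < s → IsEllipticImage A u h → ‖expWeight ψ (heatSemigroup A s h)‖ ≤
        Λ * Real.exp (K * ρ ^ 2 * s) / (2 * a * s) * ‖expWeight ψ u‖ := by
  obtain ⟨a, ha, hcoer⟩ := exists_re_sesqForm_ge hA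
  obtain ⟨Λ, hΛ, hbd⟩ := exists_norm_sesqForm_le A
  have hA' := hA.conjTranspose
  have hcoer' : ∀ g : Fin n → L2Space n,
      a * vecNorm g ^ 2 ≤ (sesqForm (fun x => (A x)ᴴ) g g).re := fun g => by
    rw [sesqForm_conjTranspose hA, Complex.conj_re]; exact hcoer g
  have hbd' : ∀ g k : Fin n → L2Space n,
      ‖sesqForm (fun x => (A x)ᴴ) g k‖ ≤ Λ * (vecNorm g * vecNorm k) := fun g k => by
    rw [sesqForm_conjTranspose hA, RCLike.norm_conj, mul_comm (vecNorm g)]; exact hbd k g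
  have hT := isContractionSemigroup_heatSemigroup hA
  have hT' := isContractionSemigroup_heatSemigroup hA'
  have hD := (isMaxAccretive_isEllipticImage hA).dense_domain
  have hD' := (isMaxAccretive_isEllipticImage hA').dense_domain
  refine ⟨a / 2, Λ, 2 * Λ ^ 2 * n / a, by positivity, hΛ, by positivity, fun ρ ψ hψ => ?_⟩
  have hw : ∀ u h, IsEllipticImage A u h →
      a / 2 * vecNorm (fun j => expWeight ψ (weakGradient u j)) ^ 2 ≤
      (inner ℂ (expWeight ψ (expWeight ψ u)) h).re +
        2 * Λ ^ 2 * n / a * ρ ^ 2 * ‖expWeight ψ u‖ ^ 2 := fun u h H =>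
    weighted_coercive hA ha hcoer hbd hψ H
  set P := (expWeight ψ).comp (expWeight ψ) with hP
  set Q := (expWeight fun x => -ψ x).comp (expWeight fun x => -ψ x) with hQ
  have hPs : ∀ f g, inner ℂ (P f) g = inner ℂ f (P g) := fun f g => by
    simp only [hP, ContinuousLinearMap.comp_apply, hψ.inner_expWeight]
  have hQs : ∀ f g, inner ℂ (Q f) g = inner ℂ f (Q g) := fun f g => by
    simp only [hQ, ContinuousLinearMap.comp_apply, hψ.neg.inner_expWeight]
  have hPn : ∀ f, (inner ℂ (P f) f).re = ‖expWeight ψ f‖ ^ 2 := hψ.re_inner_expWeight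
  have hQn : ∀ f, (inner ℂ (Q f) f).re = ‖expWeight (fun x => -ψ x) f‖ ^ 2 :=
    hψ.neg.re_inner_expWeight
  have hw1 : ∀ u h, IsEllipticImage A u h →
      a / 2 * vecNorm (fun j => expWeight ψ (weakGradient u j)) ^ 2 ≤ (inner ℂ (P u) h).re +
        2 * Λ ^ 2 * n / a * ρ ^ 2 * (inner ℂ (P u) u).re := fun u h H => by
    rw [hPn]; exact hw u h H
  have hw2 : ∀ u h, IsEllipticImage (fun x => (A x)ᴴ) u h →
      a / 2 * vecNorm (fun j => expWeight (fun x => -ψ x) (weakGradient u j)) ^ 2 ≤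
        (inner ℂ (Q u) h).re + 2 * Λ ^ 2 * n / a * ρ ^ 2 * (inner ℂ (Q u) u).re := fun u h H => by
    rw [hQn]; exact weighted_coercive hA' ha hcoer' hbd' hψ.neg H
  refine ⟨hw, fun s f hs => ?_, fun s u h hs H => ?_⟩
  · rw [← hPn, ← hPn]
    exact hT.quadratic_le hD hPs (fun u h H => le_trans (by positivity) (hw1 u h H)) hs f
  · have h1 := hT.quadratic_apply_le hT' hD hD'
      (fun u h v k H H' => inner_eq_of_isEllipticImage_conjTranspose hA H H') hPs hQs
      (fun f => by rw [hPn]; positivity) (fun f => by rw [hQn]; positivity)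
      (fun f => by
        simp only [hP, hQ, ContinuousLinearMap.comp_apply, hψ.expWeight_neg])
      (half_pos ha) hΛ hw1 hw2
      (fun u h v k H H' => by
        rw [← H.sesqForm_eq hA H'.hasWeakGradient]
        have e : sesqForm A (weakGradient u) (weakGradient v) =
            sesqForm A (fun j => expWeight ψ (weakGradient u j))
              (fun j => expWeight (fun x => -ψ x) (weakGradient v j)) := by
          rw [expWeight, sesqForm_mulOp hA hψ.memLp (fun x => Complex.conj_ofReal _), ← expWeight]
          congr 1
          funext j
          have := hψ.neg.expWeight_neg (weakGradient v j)
          simpa using this.symm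
        rw [e]
        exact hbd _ _) hs H
    rw [hPn, hPn, ← mul_pow] at h1
    exact (sq_le_sq₀ (norm_nonneg _) (by positivity)).1 h1

/-- The heat semigroup maps `L²` into the domain of `L`, with a weighted bound. -/
theorem exists_smoothing_estimate (hA : IsElliptic A) : ∃ a Λ K : ℝ, 0 < a ∧ 0 < Λ ∧ 0 ≤ K ∧
    ∀ (s : ℝ) (f : L2Space n), 0 < s → ∃ h, IsEllipticImage A (heatSemigroup A s f) h ∧
      ∀ (ρ : ℝ) (ψ : RSpace n → ℝ), IsLogWeight ρ ψ → ‖expWeight ψ h‖ ≤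
        Λ * Real.exp (K * ρ ^ 2 * s) / (2 * a * s) * ‖expWeight ψ f‖ := by
  obtain ⟨a, Λ, K, ha, hΛ, hK, H⟩ := exists_weighted_estimates hA
  refine ⟨a, Λ, K, ha, hΛ, hK, fun s f hs => ?_⟩
  have h1 := (H 0 _ isLogWeight_zero).2.2
  simp_rw [expWeight_zero] at h1
  obtain ⟨h, hh, u, k, huk, hu, hk⟩ :=
    (isContractionSemigroup_heatSemigroup hA).exists_mem_apply
      (isMaxAccretive_isEllipticImage hA) hs.le (fun u h huh => h1 s u h hs huh) f
  refine ⟨h, hh, fun ρ ψ hψ => ?_⟩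
  exact le_of_tendsto_of_tendsto' (((expWeight ψ).continuous.tendsto _).comp hk).norm
    ((((expWeight ψ).continuous.tendsto _).comp hu).norm.const_mul _)
    fun i => (H ρ ψ hψ).2.2 s _ _ hs (huk i)

theorem exists_isEllipticImage_heatSemigroup (hA : IsElliptic A) (s : ℝ) (hs : 0 < s)
    (f : L2Space n) : ∃ h, IsEllipticImage A (heatSemigroup A s f) h := by
  obtain ⟨a, Λ, K, -, -, -, H⟩ := exists_smoothing_estimate hA
  obtain ⟨h, hh, -⟩ := H s f hs
  exact ⟨h, hh⟩

theorem isEllipticImage_iterate (hA : IsElliptic A) (m : ℕ) {s : ℝ} (hs : 0 < s) (f : L2Space n) :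
    IsEllipticImage A ((ellipticOp A)^[m] (heatSemigroup A s f))
      ((ellipticOp A)^[m + 1] (heatSemigroup A s f)) :=
  (isContractionSemigroup_heatSemigroup hA).iterate_succ_mem (fun _ _ H => H.ellipticOp_eq)
    (exists_isEllipticImage_heatSemigroup hA) m hs f

theorem iterate_heatSemigroup_add (hA : IsElliptic A) (m : ℕ) {r s : ℝ} (hr : 0 ≤ r) (hs : 0 < s)
    (f : L2Space n) : (ellipticOp A)^[m] (heatSemigroup A (r + s) f) =
      heatSemigroup A r ((ellipticOp A)^[m] (heatSemigroup A s f)) :=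
  (isContractionSemigroup_heatSemigroup hA).iterate_apply_add (fun _ _ H => H.ellipticOp_eq)
    (exists_isEllipticImage_heatSemigroup hA) m hr hs f

/-- Weighted bound for `(t² L)^m e^{-θ t² L}`, uniform in `t`, for weights that vary at scale
`t`. -/
theorem exists_norm_expWeight_iterate_le (hA : IsElliptic A) (m : ℕ) {θ : ℝ} (hθ : 0 < θ) :
    ∃ C, 0 ≤ C ∧ ∀ (t : ℝ) (ψ : RSpace n → ℝ) (f : L2Space n), 0 < t → IsLogWeight t⁻¹ ψ →
      (t ^ 2) ^ m * ‖expWeight ψ ((ellipticOp A)^[m] (heatSemigroup A (θ * t ^ 2) f))‖ ≤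
        C * ‖expWeight ψ f‖ := by
  induction m generalizing θ with
  | zero =>
    obtain ⟨a, Λ, K, ha, hΛ, hK, H⟩ := exists_weighted_estimates hA
    refine ⟨Real.exp (K * θ), (Real.exp_pos _).le, fun t ψ f ht hψ => ?_⟩
    have h1 := (H _ ψ hψ).2.1 (θ * t ^ 2) f (by positivity)
    have e : Real.exp (2 * (K * t⁻¹ ^ 2) * (θ * t ^ 2)) = Real.exp (K * θ) ^ 2 := by
      rw [← Real.exp_nat_mul]; congr 1; push_cast; field_simp
    rw [e, ← mul_pow] at h1
    simpa using (sq_le_sq₀ (norm_nonneg _) (by positivity)).1 h1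
  | succ m ih =>
    obtain ⟨a, Λ, K, ha, hΛ, hK, H⟩ := exists_smoothing_estimate hA
    obtain ⟨C, hC, ih⟩ := ih (half_pos hθ)
    refine ⟨C * (Λ * Real.exp (K * (θ / 2)) / (a * θ)), by positivity, fun t ψ f ht hψ => ?_⟩
    have hs : 0 < θ / 2 * t ^ 2 := by positivity
    obtain ⟨h, hh, hle⟩ := H _ f hs
    have h1 := hle _ ψ hψ
    have e1 : heatSemigroup A (θ * t ^ 2) f =
        heatSemigroup A (θ / 2 * t ^ 2) (heatSemigroup A (θ / 2 * t ^ 2) f) := by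
      have := iterate_heatSemigroup_add hA 0 hs.le hs f
      rw [← add_mul, add_halves] at this
      exact this
    have e2 : ellipticOp A (heatSemigroup A (θ * t ^ 2) f) = heatSemigroup A (θ / 2 * t ^ 2) h := by
      rw [e1]
      exact ((isContractionSemigroup_heatSemigroup hA).apply_mem hh hs.le).ellipticOp_eq
    rw [Function.iterate_succ_apply, e2]
    have h2 := ih t ψ h ht hψ
    have e3 : K * t⁻¹ ^ 2 * (θ / 2 * t ^ 2) = K * (θ / 2) := by field_simp
    rw [e3] at h1
    calc (t ^ 2) ^ (m + 1) * ‖expWeight ψ ((ellipticOp A)^[m]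
          (heatSemigroup A (θ / 2 * t ^ 2) h))‖
        = t ^ 2 * ((t ^ 2) ^ m * ‖expWeight ψ ((ellipticOp A)^[m]
          (heatSemigroup A (θ / 2 * t ^ 2) h))‖) := by ring
      _ ≤ t ^ 2 * (C * (Λ * Real.exp (K * (θ / 2)) / (2 * a * (θ / 2 * t ^ 2)) *
            ‖expWeight ψ f‖)) :=
        mul_le_mul_of_nonneg_left (h2.trans (mul_le_mul_of_nonneg_left h1 hC)) (by positivity)
      _ = _ := by field_simp

/-! ### Pointwise in time comparison of the square function integrands -/

theorem isEllipticImage_heatFamily (hA : IsElliptic A) (m : ℕ) (f : L2Space n) {t : ℝ}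
    (ht : 0 < t) : IsEllipticImage A (heatFamily A m f t)
      (((t ^ 2 : ℝ) : ℂ)⁻¹ • heatFamily A (m + 1) f t) := by
  have h1 := (isMaxAccretive_isEllipticImage hA).smul (((t ^ 2) ^ m : ℝ) : ℂ)
    (isEllipticImage_iterate hA m (s := t ^ 2) (by positivity) f)
  have ht' : ((t ^ 2 : ℝ) : ℂ) ≠ 0 := by exact_mod_cast (pow_pos ht 2).ne'
  have e : (((t ^ 2 : ℝ) : ℂ)⁻¹ • heatFamily A (m + 1) f t) =
      (((t ^ 2) ^ m : ℝ) : ℂ) • (ellipticOp A)^[m + 1] (heatSemigroup A (t ^ 2) f) := by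
    rw [heatFamily, ← ofReal_smul_eq, smul_smul, pow_succ (t ^ 2) m, Complex.ofReal_mul,
      mul_comm (((t ^ 2) ^ m : ℝ) : ℂ), inv_mul_cancel_left₀ ht']
  rw [e, heatFamily, ← ofReal_smul_eq]
  exact h1

theorem hasDerivAt_heatFamily (hA : IsElliptic A) (m : ℕ) (f : L2Space n) {t : ℝ}
    (ht : 0 < t) : HasDerivAt (heatFamily A m f)
      (t⁻¹ • ((2 * m : ℝ) • heatFamily A m f t - (2 : ℝ) • heatFamily A (m + 1) f t)) t := by
  have h1 := (isContractionSemigroup_heatSemigroup hA).hasDerivAt_iterate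
    (fun _ _ H => H.ellipticOp_eq) (exists_isEllipticImage_heatSemigroup hA) m
    (s := t ^ 2) (by positivity) f
  have hd : HasDerivAt (fun r : ℝ => r ^ 2) (2 * t) t := by simpa using hasDerivAt_pow 2 t
  have h2 := HasDerivAt.scomp (h := fun r : ℝ => r ^ 2) t h1 hd
  have h3 := (hd.pow m).smul h2
  refine h3.congr_deriv ?_
  simp only [heatFamily, smul_sub, smul_smul, smul_neg, Function.comp_apply]
  have e1 : ∀ c c' : ℝ, c = c' → ∀ v : L2Space n, c • v = c' • v := fun c c' h v => by rw [h]
  rw [add_comm, sub_eq_add_neg]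
  congr 1
  · refine e1 _ _ ?_ _
    rcases m with - | m
    · simp
    · rw [Nat.add_sub_cancel, pow_succ (t ^ 2) m]; field_simp
  · congr 1
    refine e1 _ _ ?_ _
    change (t ^ 2) ^ m * (2 * t) = _
    rw [pow_succ (t ^ 2) m]; field_simp

/-- For `m ≥ 1` the integrand of `𝒮_m` at time `t` is controlled, in weighted `L²`, by that of
`𝒮_1` at time `t / 2`, since `t² L e^{-t² L} = 4 e^{-3 t² L / 4} ((t/2)² L e^{-(t/2)² L})`. -/
theorem exists_norm_heatFamily_le (hA : IsElliptic A) (m : ℕ) :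
    ∃ C, 0 ≤ C ∧ ∀ (t : ℝ) (ψ : RSpace n → ℝ) (f : L2Space n), 0 < t → IsLogWeight t⁻¹ ψ →
      ‖expWeight ψ (heatFamily A (m + 1) f t)‖ ≤ C * ‖expWeight ψ (heatFamily A 1 f (t / 2))‖ := by
  obtain ⟨C, hC, H⟩ := exists_norm_expWeight_iterate_le hA m (θ := 3 / 4) (by norm_num)
  refine ⟨4 * C, by positivity, fun t ψ f ht hψ => ?_⟩
  have h1 := H t ψ (ellipticOp A (heatSemigroup A (1 / 4 * t ^ 2) f)) ht hψ
  have e1 := iterate_heatSemigroup_add hA 1 (r := 3 / 4 * t ^ 2) (s := 1 / 4 * t ^ 2)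
    (by positivity) (by positivity) f
  rw [← add_mul, show (3 / 4 + 1 / 4 : ℝ) = 1 by norm_num, one_mul, Function.iterate_one] at e1
  have e2 : ∀ (c : ℝ) (v : L2Space n), 0 ≤ c → ‖expWeight ψ (c • v)‖ = c * ‖expWeight ψ v‖ :=
    fun c v hc => by
      rw [← ofReal_smul_eq, map_smul, norm_smul, Complex.norm_real, Real.norm_of_nonneg hc]
  rw [heatFamily, heatFamily, e2 _ _ (by positivity), e2 _ _ (by positivity),
    Function.iterate_succ_apply, e1, Function.iterate_one, pow_one,
    show (t / 2) ^ 2 = 1 / 4 * t ^ 2 by ring]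
  calc _ = t ^ 2 * ((t ^ 2) ^ m * ‖expWeight ψ ((ellipticOp A)^[m] (heatSemigroup A
        (3 / 4 * t ^ 2) (ellipticOp A (heatSemigroup A (1 / 4 * t ^ 2) f))))‖) := by ring
    _ ≤ t ^ 2 * (C * ‖expWeight ψ (ellipticOp A (heatSemigroup A (1 / 4 * t ^ 2) f))‖) := by
      gcongr
    _ = _ := by ring

/-- The same for the integrand of `𝒢_m`: Caccioppoli's inequality for the space derivatives, and
`t ∂_t u_m = 2 m u_m - 2 u_{m+1}`. -/
theorem exists_norm_gradient_heatFamily_le (hA : IsElliptic A) (m : ℕ) :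
    ∃ C, 0 ≤ C ∧ ∀ (t : ℝ) (ψ : RSpace n → ℝ) (f : L2Space n), 0 < t → IsLogWeight t⁻¹ ψ →
      t ^ 2 * (∑ j, ‖expWeight ψ (weakGradient (heatFamily A (m + 1) f t) j)‖ ^ 2 +
        ‖expWeight ψ (deriv (heatFamily A (m + 1) f) t)‖ ^ 2) ≤
      C * ‖expWeight ψ (heatFamily A 1 f (t / 2))‖ ^ 2 := by
  obtain ⟨C, hC, H⟩ := exists_norm_heatFamily_le hA m
  obtain ⟨C', hC', H'⟩ := exists_norm_heatFamily_le hA (m + 1)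
  obtain ⟨a, Λ, K, ha, hΛ, hK, hW⟩ := exists_weighted_estimates hA
  refine ⟨(C * C' + K * C ^ 2) / a + (2 * (m + 1) * C + 2 * C') ^ 2, by positivity,
    fun t ψ f ht hψ => ?_⟩
  set u := heatFamily A (m + 1) f t with hu
  set v := heatFamily A (m + 1 + 1) f t with hv
  set S := ‖expWeight ψ (heatFamily A 1 f (t / 2))‖
  have h1 : ‖expWeight ψ u‖ ≤ C * S := H t ψ f ht hψ
  have h2 : ‖expWeight ψ v‖ ≤ C' * S := H' t ψ f ht hψ
  have h3 := (hW _ ψ hψ).1 _ _ (isEllipticImage_heatFamily hA (m + 1) f ht)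
  rw [vecNorm_sq, ← hu, ← hv, inner_smul_right, hψ.inner_expWeight, ← Complex.ofReal_inv,
    Complex.re_ofReal_mul] at h3
  have h4 : (inner ℂ (expWeight ψ u) (expWeight ψ v)).re ≤ C * S * (C' * S) :=
    ((Complex.re_le_norm _).trans (norm_inner_le_norm _ _)).trans
      (mul_le_mul h1 h2 (norm_nonneg _) (by positivity))
  have h5 : ‖expWeight ψ u‖ ^ 2 ≤ (C * S) ^ 2 := pow_le_pow_left₀ (norm_nonneg _) h1 2
  have h6 : t ^ 2 * ∑ j, ‖expWeight ψ (weakGradient u j)‖ ^ 2 ≤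
      (C * C' + K * C ^ 2) / a * S ^ 2 := by
    rw [div_mul_eq_mul_div, le_div_iff₀ ha]
    have h7 := mul_le_mul_of_nonneg_left h3 (sq_nonneg t)
    have e : t ^ 2 * ((t ^ 2)⁻¹ * (inner ℂ (expWeight ψ u) (expWeight ψ v)).re +
        K * t⁻¹ ^ 2 * ‖expWeight ψ u‖ ^ 2) =
        (inner ℂ (expWeight ψ u) (expWeight ψ v)).re + K * ‖expWeight ψ u‖ ^ 2 := by
      field_simp
    rw [e] at h7
    nlinarith [mul_le_mul_of_nonneg_left h5 hK]
  have h8 : t * ‖expWeight ψ (deriv (heatFamily A (m + 1) f) t)‖ ≤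
      (2 * (m + 1) * C + 2 * C') * S := by
    rw [(hasDerivAt_heatFamily hA (m + 1) f ht).deriv, ← hu, ← hv, ← ofReal_smul_eq,
      ← ofReal_smul_eq, ← ofReal_smul_eq, map_smul, map_sub, map_smul, map_smul, norm_smul,
      Complex.norm_real, Real.norm_of_nonneg (inv_nonneg.2 ht.le), mul_inv_cancel_left₀ ht.ne']
    refine (norm_sub_le _ _).trans ?_
    rw [norm_smul, norm_smul, Complex.norm_real, Complex.norm_real,
      Real.norm_of_nonneg (by positivity), Real.norm_of_nonneg (by positivity)]
    push_cast
    have h9 : (0 : ℝ) ≤ 2 * (m + 1) := by positivity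
    nlinarith [mul_le_mul_of_nonneg_left h1 h9]
  have h10 := pow_le_pow_left₀ (by positivity) h8 2
  rw [mul_pow, mul_pow] at h10
  rw [mul_add, add_mul]
  exact add_le_add h6 h10

end HeatEstimates

/-! ### Layer cake formulas -/

section LayerCake

/-- The layer cake formula for a single value `x ∈ [0, ∞]`; integrating it in `x` gives the formula
for functions. -/
theorem ENNReal.rpow_eq_lintegral (x : ℝ≥0∞) {s : ℝ} (hs : 0 < s) :
    x ^ s = ∫⁻ a in Ioi (0 : ℝ), ENNReal.ofReal (s * a ^ (s - 1)) *
      {a : ℝ | ENNReal.ofReal a < x}.indicator 1 a := by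
  have hfin : ∀ y : ℝ, 0 ≤ y → ∫⁻ a in Ioc 0 y, ENNReal.ofReal (s * a ^ (s - 1)) =
      ENNReal.ofReal (y ^ s) := by
    intro y hy
    have h1 : IntervalIntegrable (fun a : ℝ => s * a ^ (s - 1)) volume 0 y :=
      (intervalIntegral.intervalIntegrable_rpow' (by linarith)).const_mul s
    rw [← ofReal_integral_eq_lintegral_ofReal
      ((intervalIntegrable_iff_integrableOn_Ioc_of_le hy).1 h1)]
    · rw [← intervalIntegral.integral_of_le hy, intervalIntegral.integral_const_mul,
        integral_rpow (Or.inl (by linarith)), sub_add_cancel, Real.zero_rpow hs.ne', sub_zero,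
        mul_div_cancel₀ _ hs.ne']
    · filter_upwards [ae_restrict_mem measurableSet_Ioc] with a ha
      exact mul_nonneg hs.le (Real.rpow_nonneg ha.1.le _)
  have hmul : ∀ a : ℝ, ENNReal.ofReal (s * a ^ (s - 1)) *
      {a : ℝ | ENNReal.ofReal a < x}.indicator 1 a =
      {a : ℝ | ENNReal.ofReal a < x}.indicator (fun a => ENNReal.ofReal (s * a ^ (s - 1))) a := by
    intro a
    by_cases h : a ∈ {a : ℝ | ENNReal.ofReal a < x} <;> simp [h]
  have hmeas : MeasurableSet {a : ℝ | ENNReal.ofReal a < x} :=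
    measurableSet_lt ENNReal.measurable_ofReal measurable_const
  simp_rw [hmul]
  rw [lintegral_indicator hmeas, Measure.restrict_restrict hmeas]
  rcases eq_or_ne x ⊤ with rfl | hx
  · have e : {a : ℝ | ENNReal.ofReal a < (⊤ : ℝ≥0∞)} ∩ Ioi 0 = Ioi 0 := by ext a; simp
    rw [e, ENNReal.top_rpow_of_pos hs, eq_comm, eq_top_iff]
    refine le_of_forall_lt fun c hc => ?_
    obtain ⟨N, hN⟩ := ENNReal.exists_nat_gt hc.ne
    refine lt_of_lt_of_le hN ?_
    have h1 := hfin ((N : ℝ) ^ s⁻¹) (by positivity)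
    rw [← Real.rpow_mul (by positivity), inv_mul_cancel₀ hs.ne', Real.rpow_one,
      ENNReal.ofReal_natCast] at h1
    rw [← h1]
    exact lintegral_mono_set Ioc_subset_Ioi_self
  · have e : {a : ℝ | ENNReal.ofReal a < x} ∩ Ioi 0 = Ioo 0 x.toReal := by
      ext a
      simp only [mem_inter_iff, mem_ofPred_eq, mem_Ioi, mem_Ioo]
      constructor
      · rintro ⟨h1, h2⟩
        exact ⟨h2, (ENNReal.ofReal_lt_iff_lt_toReal h2.le hx).1 h1⟩
      · rintro ⟨h1, h2⟩
        exact ⟨(ENNReal.ofReal_lt_iff_lt_toReal h1.le hx).2 h2, h1⟩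
    rw [e, setLIntegral_congr Ioo_ae_eq_Ioc, hfin _ ENNReal.toReal_nonneg,
      ← ENNReal.ofReal_rpow_of_nonneg ENNReal.toReal_nonneg hs.le, ENNReal.ofReal_toReal hx]

/-- Companion of `ENNReal.rpow_eq_lintegral` for the part of `x` below the level `a`; the integral
converges at infinity because `s < 1`. -/
theorem ENNReal.lintegral_mul_indicator_le (x : ℝ≥0∞) {s : ℝ} (hs : 0 < s) (hs1 : s < 1) :
    ∫⁻ a in Ioi (0 : ℝ), ENNReal.ofReal (s * a ^ (s - 2)) *
      (x * {a : ℝ | x ≤ ENNReal.ofReal a}.indicator 1 a) ≤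
        ENNReal.ofReal (s / (1 - s)) * x ^ s := by
  rcases eq_or_ne x ⊤ with rfl | hx
  · simp
  rcases eq_or_ne x 0 with rfl | hx0
  · simp
  have hy : 0 < x.toReal := ENNReal.toReal_pos hx0 hx
  have hle : ∀ a : ℝ, 0 < a → ENNReal.ofReal (s * a ^ (s - 2)) *
      (x * {a : ℝ | x ≤ ENNReal.ofReal a}.indicator 1 a) =
      x * (Ici x.toReal).indicator (fun a => ENNReal.ofReal (s * a ^ (s - 2))) a := by
    intro a ha
    have h : a ∈ {a : ℝ | x ≤ ENNReal.ofReal a} ↔ a ∈ Ici x.toReal := by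
      rw [mem_ofPred_eq, mem_Ici, ENNReal.le_ofReal_iff_toReal_le hx ha.le]
    by_cases h1 : a ∈ Ici x.toReal
    · rw [indicator_of_mem h1, indicator_of_mem (h.2 h1)]; simp [mul_comm]
    · rw [indicator_of_notMem h1, indicator_of_notMem (fun h2 => h1 (h.1 h2))]; simp
  have hsub : Ici x.toReal ∩ Ioi 0 = Ici x.toReal :=
    inter_eq_self_of_subset_left fun a ha => lt_of_lt_of_le hy ha
  rw [setLIntegral_congr_fun measurableSet_Ioi hle, lintegral_const_mul' _ _ hx,
    lintegral_indicator measurableSet_Ici, Measure.restrict_restrict measurableSet_Ici, hsub,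
    setLIntegral_congr Ioi_ae_eq_Ici.symm]
  have h1 := integrableOn_Ioi_rpow_of_lt (a := s - 2) (by linarith) hy
  rw [← ofReal_integral_eq_lintegral_ofReal (h1.const_mul s)]
  · rw [integral_const_mul, integral_Ioi_rpow_of_lt (by linarith) hy]
    nth_rewrite 1 [← ENNReal.ofReal_toReal hx]
    nth_rewrite 3 [← ENNReal.ofReal_toReal hx]
    rw [ENNReal.ofReal_rpow_of_pos hy, ← ENNReal.ofReal_mul hy.le,
      ← ENNReal.ofReal_mul (by apply div_nonneg <;> linarith)]
    refine ENNReal.ofReal_le_ofReal (le_of_eq ?_)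
    have e : x.toReal ^ s = x.toReal * x.toReal ^ (s - 1) := by
      rw [← Real.rpow_one_add' hy.le (by linarith)]; congr 1; ring
    rw [e, show s - 2 + 1 = -(1 - s) by ring, show -(1 - s) = s - 1 by ring]
    have h2 : 1 - s ≠ 0 := by linarith
    have h3 : s - 1 ≠ 0 := by linarith
    field_simp; ring
  · filter_upwards [ae_restrict_mem measurableSet_Ioi] with a ha
    exact mul_nonneg hs.le (Real.rpow_nonneg (hy.trans ha).le _)

variable {X : Type*} [MeasurableSpace X]

theorem measurable_indicator_lt {F : X → ℝ≥0∞} (hF : Measurable F) : Measurable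
    fun p : X × ℝ => {a : ℝ | ENNReal.ofReal a < F p.1}.indicator (1 : ℝ → ℝ≥0∞) p.2 :=
  (measurable_one.indicator (measurableSet_lt (ENNReal.measurable_ofReal.comp measurable_snd)
    (hF.comp measurable_fst)) : Measurable ({p : X × ℝ | ENNReal.ofReal p.2 < F p.1}.indicator 1))

theorem lintegral_rpow_eq_lintegral_meas (μ : Measure X) [SFinite μ] {F : X → ℝ≥0∞}
    (hF : Measurable F) {s : ℝ} (hs : 0 < s) : ∫⁻ x, F x ^ s ∂μ =
      ∫⁻ a in Ioi (0 : ℝ), ENNReal.ofReal (s * a ^ (s - 1)) * μ {x | ENNReal.ofReal a < F x} := by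
  simp_rw [fun x => ENNReal.rpow_eq_lintegral (F x) hs]
  rw [lintegral_lintegral_swap]
  · refine lintegral_congr fun a => ?_
    rw [lintegral_const_mul' _ _ ENNReal.ofReal_ne_top]
    congr 1
    have : (fun x => {a : ℝ | ENNReal.ofReal a < F x}.indicator (1 : ℝ → ℝ≥0∞) a) =
        {x | ENNReal.ofReal a < F x}.indicator 1 := by
      ext x; simp [indicator]
    rw [this, lintegral_indicator_one (measurableSet_lt measurable_const hF)]
  · refine Measurable.aemeasurable (Measurable.mul ?_ (measurable_indicator_lt hF))
    fun_prop

end LayerCake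

/-! ### The maximal function of a doubling measure -/

section Doubling

variable {X : Type*} [PseudoMetricSpace X] [MeasurableSpace X]

/-- Balls have positive finite measure, and `μ (2B) ≤ K μ B`. -/
structure IsDoublingOnBalls (μ : Measure X) (K : ℝ≥0) : Prop where
  pos : ∀ x r, 0 < r → 0 < μ (Metric.ball x r)
  lt_top : ∀ x r, μ (Metric.ball x r) < ⊤
  doubling : ∀ x r, μ (Metric.ball x (2 * r)) ≤ K * μ (Metric.ball x r)

/-- The uncentred maximal function over balls. -/
noncomputable def ballMaximal (μ : Measure X) (h : X → ℝ≥0∞) (x : X) : ℝ≥0∞ :=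
  ⨆ (c : X) (r : ℝ) (_ : x ∈ Metric.ball c r),
    (∫⁻ y in Metric.ball c r, h y ∂μ) / μ (Metric.ball c r)

variable {μ : Measure X} {K : ℝ≥0}

theorem setOf_lt_ballMaximal (h : X → ℝ≥0∞) (a : ℝ≥0∞) : {x | a < ballMaximal μ h x} =
    ⋃ (c : X) (r : ℝ) (_ : a < (∫⁻ y in Metric.ball c r, h y ∂μ) / μ (Metric.ball c r)),
      Metric.ball c r := by
  ext x
  simp only [ballMaximal, mem_ofPred_eq, lt_iSup_iff, mem_iUnion, exists_prop, and_comm]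

theorem isOpen_lt_ballMaximal (h : X → ℝ≥0∞) (a : ℝ≥0∞) : IsOpen {x | a < ballMaximal μ h x} := by
  rw [setOf_lt_ballMaximal]
  exact isOpen_iUnion fun c => isOpen_iUnion fun r => isOpen_iUnion fun _ => Metric.isOpen_ball

theorem measurable_ballMaximal [BorelSpace X] (h : X → ℝ≥0∞) : Measurable (ballMaximal μ h) :=
  measurable_of_Ioi fun a => (isOpen_lt_ballMaximal h a).measurableSet

theorem IsDoublingOnBalls.setLIntegral_le (hμ : IsDoublingOnBalls μ K) (h : X → ℝ≥0∞) {c x : X}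
    {r : ℝ} (hx : x ∈ Metric.ball c r) :
    ∫⁻ y in Metric.ball c r, h y ∂μ ≤ ballMaximal μ h x * μ (Metric.ball c r) := by
  have h1 : (∫⁻ y in Metric.ball c r, h y ∂μ) / μ (Metric.ball c r) ≤ ballMaximal μ h x :=
    le_iSup₂_of_le c r (le_iSup_of_le hx le_rfl)
  rwa [ENNReal.div_le_iff (hμ.pos c r (Metric.pos_of_mem_ball hx)).ne' (hμ.lt_top c r).ne] at h1

/-- The weak type `(1, 1)` inequality, by Vitali's covering lemma. -/
theorem IsDoublingOnBalls.mul_meas_lt_ballMaximal_le [BorelSpace X] [SecondCountableTopology X]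
    (hμ : IsDoublingOnBalls μ K) (h : X → ℝ≥0∞) (a : ℝ≥0∞) :
    a * μ {x | a < ballMaximal μ h x} ≤ K ^ 2 * ∫⁻ x, h x ∂μ := by
  -- the covering lemma needs bounded radii
  set t : ℕ → Set (X × ℝ) := fun N => {p | 0 < p.2 ∧ p.2 ≤ N ∧
    a < (∫⁻ y in Metric.ball p.1 p.2, h y ∂μ) / μ (Metric.ball p.1 p.2)} with ht
  have hU : {x | a < ballMaximal μ h x} = ⋃ N, ⋃ p ∈ t N, Metric.ball p.1 p.2 := by
    rw [setOf_lt_ballMaximal]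
    ext x
    simp only [mem_iUnion, exists_prop, ht, mem_ofPred_eq, Prod.exists]
    constructor
    · rintro ⟨c, r, h1, h2⟩
      obtain ⟨N, hN⟩ := exists_nat_ge r
      exact ⟨N, c, r, ⟨Metric.pos_of_mem_ball h2, hN, h1⟩, h2⟩
    · rintro ⟨N, c, r, ⟨-, -, h1⟩, h2⟩
      exact ⟨c, r, h1, h2⟩
  have hmono : Monotone fun N => ⋃ p ∈ t N, Metric.ball p.1 p.2 := by
    intro N M hNM
    refine biUnion_subset_biUnion_left fun p hp => ⟨hp.1, hp.2.1.trans ?_, hp.2.2⟩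
    exact_mod_cast hNM
  rw [hU, hmono.measure_iUnion, ENNReal.mul_iSup]
  refine iSup_le fun N => ?_
  obtain ⟨u, hut, hdisj, hcov⟩ := Vitali.exists_disjoint_subfamily_covering_enlargement_ball (t N)
    Prod.fst Prod.snd N (fun p hp => hp.2.1) 4 (by norm_num)
  have hcount : u.Countable := hdisj.countable_of_isOpen (fun p _ => Metric.isOpen_ball)
    fun p hp => ⟨p.1, Metric.mem_ball_self (hut hp).1⟩
  have hsub : (⋃ p ∈ t N, Metric.ball p.1 p.2) ⊆ ⋃ p ∈ u, Metric.ball p.1 (4 * p.2) := by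
    refine iUnion₂_subset fun p hp => ?_
    obtain ⟨q, hq, hpq⟩ := hcov p hp
    exact hpq.trans (subset_biUnion_of_mem (u := fun q : X × ℝ => Metric.ball q.1 (4 * q.2)) hq)
  have hball : ∀ p ∈ u, a * μ (Metric.ball p.1 (4 * p.2)) ≤
      K ^ 2 * ∫⁻ y in Metric.ball p.1 p.2, h y ∂μ := by
    intro p hp
    obtain ⟨h1, -, h2⟩ := hut hp
    have h3 : μ (Metric.ball p.1 (4 * p.2)) ≤ K ^ 2 * μ (Metric.ball p.1 p.2) := by
      have h4 := hμ.doubling p.1 (2 * p.2)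
      rw [← mul_assoc, show (2 * 2 : ℝ) = 4 by norm_num] at h4
      refine h4.trans ?_
      rw [pow_two, mul_assoc]
      gcongr
      exact hμ.doubling p.1 p.2
    have h5 : a * μ (Metric.ball p.1 p.2) ≤ ∫⁻ y in Metric.ball p.1 p.2, h y ∂μ := by
      have := h2.le
      rwa [ENNReal.le_div_iff_mul_le (Or.inl (hμ.pos _ _ h1).ne') (Or.inl (hμ.lt_top _ _).ne)]
        at this
    calc a * μ (Metric.ball p.1 (4 * p.2)) ≤ a * (K ^ 2 * μ (Metric.ball p.1 p.2)) := by gcongr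
      _ = K ^ 2 * (a * μ (Metric.ball p.1 p.2)) := by ring
      _ ≤ _ := by gcongr
  calc a * μ (⋃ p ∈ t N, Metric.ball p.1 p.2)
      ≤ a * ∑' p : u, μ (Metric.ball p.1.1 (4 * p.1.2)) := by
        gcongr
        exact (measure_mono hsub).trans (measure_biUnion_le μ hcount _)
    _ ≤ ∑' p : u, K ^ 2 * ∫⁻ y in Metric.ball p.1.1 p.1.2, h y ∂μ := by
        rw [← ENNReal.tsum_mul_left]
        exact ENNReal.tsum_le_tsum fun p => hball p p.2
    _ = K ^ 2 * ∫⁻ y in ⋃ p ∈ u, Metric.ball p.1 p.2, h y ∂μ := by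
        rw [ENNReal.tsum_mul_left, lintegral_biUnion hcount (fun p _ => measurableSet_ball) hdisj]
    _ ≤ _ := mul_le_mul_right (setLIntegral_le_lintegral _ _) _

theorem ballMaximal_le_add (h : X → ℝ≥0∞) (a : ℝ≥0∞) (x : X) [OpensMeasurableSpace X] :
    ballMaximal μ h x ≤ ballMaximal μ ({y | a < h y}.indicator h) x + a := by
  refine iSup_le fun c => iSup_le fun r => iSup_le fun hx => ?_
  have h1 : ∀ y, h y ≤ {y | a < h y}.indicator h y + a := fun y => by
    by_cases hy : a < h y
    · rw [indicator_of_mem (show y ∈ {y | a < h y} from hy)]; exact le_self_add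
    · exact (not_lt.1 hy).trans le_add_self
  have h2 : ∫⁻ y in Metric.ball c r, h y ∂μ ≤
      (∫⁻ y in Metric.ball c r, {y | a < h y}.indicator h y ∂μ) + a * μ (Metric.ball c r) := by
    refine (lintegral_mono h1).trans_eq ?_
    rw [lintegral_add_right _ measurable_const, setLIntegral_const]
  calc _ ≤ _ := ENNReal.div_le_div_right h2 _
    _ ≤ (∫⁻ y in Metric.ball c r, {y | a < h y}.indicator h y ∂μ) / μ (Metric.ball c r) + a := by
      rw [ENNReal.add_div]
      gcongr
      exact ENNReal.div_le_of_le_mul le_rfl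
    _ ≤ _ := by
      gcongr
      exact le_iSup₂_of_le c r (le_iSup_of_le hx le_rfl)

/-- The maximal function is bounded on `L^s(μ)` for `s > 1`, by the weak type inequality for the
part of `h` above each level. -/
theorem IsDoublingOnBalls.lintegral_ballMaximal_rpow_le [BorelSpace X] [SecondCountableTopology X]
    [SFinite μ] (hμ : IsDoublingOnBalls μ K) {s : ℝ} (hs : 1 < s) {h : X → ℝ≥0∞}
    (hh : Measurable h) : ∫⁻ x, ballMaximal μ h x ^ s ∂μ ≤
      2 ^ s * K ^ 2 * ENNReal.ofReal (s / (s - 1)) * ∫⁻ x, h x ^ s ∂μ := by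
  have hs0 : 0 < s := by linarith
  have hs1 : 0 < s - 1 := by linarith
  have e1 : ∀ x, ballMaximal μ h x ^ s = 2 ^ s * (ballMaximal μ h x / 2) ^ s := fun x => by
    rw [← ENNReal.mul_rpow_of_nonneg _ _ hs0.le, ENNReal.mul_div_cancel (by simp) (by simp)]
  have hm : ∀ a : ℝ, 0 < a → μ {x | ENNReal.ofReal a < ballMaximal μ h x / 2} ≤
      ENNReal.ofReal a⁻¹ * (K ^ 2 * ∫⁻ x, {x | ENNReal.ofReal a < h x}.indicator h x ∂μ) := by
    intro a ha
    have h1 := hμ.mul_meas_lt_ballMaximal_le ({x | ENNReal.ofReal a < h x}.indicator h)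
      (ENNReal.ofReal a)
    have ha' : ENNReal.ofReal a ≠ 0 := by simpa using ha
    rw [ENNReal.ofReal_inv_of_pos ha, ← ENNReal.div_eq_inv_mul,
      ENNReal.le_div_iff_mul_le (Or.inl ha') (Or.inl ENNReal.ofReal_ne_top), mul_comm]
    refine le_trans ?_ h1
    refine mul_le_mul_right (measure_mono fun x hx => ?_) _
    simp only [mem_ofPred_eq] at hx ⊢
    rw [ENNReal.lt_div_iff_mul_lt (by simp) (by simp), mul_two] at hx
    exact (ENNReal.add_lt_add_iff_right ENNReal.ofReal_ne_top).1
      (hx.trans_le (ballMaximal_le_add h (ENNReal.ofReal a) x))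
  simp_rw [e1]
  rw [lintegral_const_mul' _ _ (by simp), mul_assoc, mul_assoc]
  refine mul_le_mul_right ?_ _
  rw [lintegral_rpow_eq_lintegral_meas μ ((measurable_ballMaximal h).div_const 2) hs0]
  have hI : ∀ (a : ℝ) (x : X), {x | ENNReal.ofReal a < h x}.indicator h x =
      h x * {a : ℝ | ENNReal.ofReal a < h x}.indicator (1 : ℝ → ℝ≥0∞) a := fun a x => by
    by_cases hx : ENNReal.ofReal a < h x <;> simp [indicator, hx]
  calc ∫⁻ a in Ioi (0 : ℝ), ENNReal.ofReal (s * a ^ (s - 1)) *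
        μ {x | ENNReal.ofReal a < ballMaximal μ h x / 2}
      ≤ ∫⁻ a in Ioi (0 : ℝ), K ^ 2 * ENNReal.ofReal (s / (s - 1)) *
          ∫⁻ x, ENNReal.ofReal ((s - 1) * a ^ (s - 1 - 1)) *
            (h x * {a : ℝ | ENNReal.ofReal a < h x}.indicator (1 : ℝ → ℝ≥0∞) a) ∂μ := by
        refine setLIntegral_mono' measurableSet_Ioi fun a ha => ?_
        refine (mul_le_mul_right (hm a ha) _).trans_eq ?_
        rw [lintegral_const_mul' _ _ ENNReal.ofReal_ne_top]
        simp_rw [hI]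
        have e2 : ENNReal.ofReal (s * a ^ (s - 1)) * ENNReal.ofReal a⁻¹ =
            ENNReal.ofReal (s / (s - 1)) * ENNReal.ofReal ((s - 1) * a ^ (s - 1 - 1)) := by
          have ha' : 0 < a := ha
          rw [← ENNReal.ofReal_mul (by positivity), ← ENNReal.ofReal_mul (by positivity)]
          congr 1
          rw [Real.rpow_sub_one ha'.ne' (s - 1)]
          field_simp
        rw [← mul_assoc, e2]
        ring
    _ = K ^ 2 * ENNReal.ofReal (s / (s - 1)) * ∫⁻ x, (∫⁻ a in Ioi (0 : ℝ),
          ENNReal.ofReal ((s - 1) * a ^ (s - 1 - 1)) *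
            (h x * {a : ℝ | ENNReal.ofReal a < h x}.indicator (1 : ℝ → ℝ≥0∞) a)) ∂μ := by
        rw [lintegral_const_mul' _ _ (by finiteness), lintegral_lintegral_swap]
        refine Measurable.aemeasurable ?_
        refine Measurable.mul (f := fun p : ℝ × X => ENNReal.ofReal ((s - 1) * p.1 ^ (s - 1 - 1)))
          (by fun_prop) ?_
        exact (hh.comp measurable_snd).mul ((measurable_indicator_lt hh).comp measurable_swap)
    _ = _ := by
        rw [mul_assoc]
        congr 2
        refine lintegral_congr fun x => ?_
        have e3 : h x ^ s = h x * h x ^ (s - 1) := by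
          have := ENNReal.rpow_add_of_nonneg (x := h x) 1 (s - 1) zero_le_one hs1.le
          rwa [add_sub_cancel, ENNReal.rpow_one] at this
        rw [e3, ENNReal.rpow_eq_lintegral (h x) hs1, ← lintegral_const_mul]
        · refine lintegral_congr fun a => ?_
          ring
        · exact Measurable.mul (by fun_prop) ((measurable_indicator_lt hh).comp
            (measurable_const.prodMk measurable_id : Measurable fun a : ℝ => (x, a)))

end Doubling

/-! ### Change of aperture -/

section Aperture

variable {X : Type*} [PseudoMetricSpace X] [MeasurableSpace X]

/-- The `ν`-measure of the cone `{(t, y) : dist x y < a t}` of vertex `x` and aperture `a`. -/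
noncomputable def coneMeasure (ν : Measure (ℝ × X)) (a : ℝ) (x : X) : ℝ≥0∞ :=
  ν {p | dist x p.2 < a * p.1}

theorem IsDoublingOnBalls.ne_zero {μ : Measure X} {K : ℝ≥0}
    (hμ : IsDoublingOnBalls μ K) (x : X) : (K : ℝ≥0∞) ≠ 0 := by
  intro h
  have h1 := hμ.doubling x 1
  rw [h, zero_mul] at h1
  exact (hμ.pos x (2 * 1) (by norm_num)).not_ge h1

/-- If `B(y, 2t)` is not contained in `{M 1_U > 1/(2K)}`, then `U` occupies at most half of
`B(y, t)`. -/
theorem IsDoublingOnBalls.meas_ball_diff_le {μ : Measure X} {K : ℝ≥0}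
    (hμ : IsDoublingOnBalls μ K) {U : Set X}
    (hU : MeasurableSet U) (y : X) (t : ℝ) :
    μ (Metric.ball y (2 * t) ∩ {x | (2 * K : ℝ≥0∞)⁻¹ < ballMaximal μ (U.indicator 1) x}ᶜ) ≤
      2 * K * μ (Metric.ball y (1 * t) ∩ Uᶜ) := by
  rw [one_mul]
  rcases (Metric.ball y (2 * t) ∩
    {x | (2 * K : ℝ≥0∞)⁻¹ < ballMaximal μ (U.indicator 1) x}ᶜ).eq_empty_or_nonempty with h | h
  · rw [h]; simp
  obtain ⟨x, hx, hx'⟩ := h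
  have hK := hμ.ne_zero x
  have hKt : (K : ℝ≥0∞) ≠ ⊤ := ENNReal.coe_ne_top
  have hx' : ballMaximal μ (U.indicator 1) x ≤ (2 * K : ℝ≥0∞)⁻¹ := not_lt.1 hx'
  have h1 : μ (Metric.ball y t ∩ U) ≤ 2⁻¹ * μ (Metric.ball y t) := by
    calc μ (Metric.ball y t ∩ U) ≤ μ (U ∩ Metric.ball y (2 * t)) := by
          refine measure_mono fun z hz => ⟨hz.2, Metric.ball_subset_ball ?_ hz.1⟩
          linarith [Metric.pos_of_mem_ball hz.1]
      _ = ∫⁻ z in Metric.ball y (2 * t), U.indicator 1 z ∂μ := by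
          rw [lintegral_indicator_one hU, Measure.restrict_apply hU]
      _ ≤ (2 * K : ℝ≥0∞)⁻¹ * μ (Metric.ball y (2 * t)) :=
          (hμ.setLIntegral_le _ hx).trans (mul_le_mul_left hx' _)
      _ ≤ (2 * K : ℝ≥0∞)⁻¹ * (K * μ (Metric.ball y t)) := mul_le_mul_right (hμ.doubling y t) _
      _ = 2⁻¹ * μ (Metric.ball y t) := by
          rw [ENNReal.mul_inv (by simp) (by simp), mul_assoc, ← mul_assoc (K : ℝ≥0∞)⁻¹,
            ENNReal.inv_mul_cancel hK hKt, one_mul]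
  have h2 : μ (Metric.ball y t) ≤ 2 * μ (Metric.ball y t ∩ Uᶜ) := by
    have h3 : μ (Metric.ball y t) ≤ 2⁻¹ * μ (Metric.ball y t) + μ (Metric.ball y t ∩ Uᶜ) := by
      conv_lhs => rw [← measure_inter_add_sdiff (Metric.ball y t) hU]
      exact add_le_add h1 le_rfl
    have hf : 2⁻¹ * μ (Metric.ball y t) ≠ ⊤ := ENNReal.mul_ne_top (by simp) (hμ.lt_top y t).ne
    have h4 : 2⁻¹ * μ (Metric.ball y t) + 2⁻¹ * μ (Metric.ball y t) = μ (Metric.ball y t) := by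
      rw [← add_mul, ENNReal.inv_two_add_inv_two, one_mul]
    nth_rewrite 1 [← h4] at h3
    have h5 := (ENNReal.add_le_add_iff_left hf).1 h3
    calc μ (Metric.ball y t) = 2 * (2⁻¹ * μ (Metric.ball y t)) := by
          rw [← mul_assoc, ENNReal.mul_inv_cancel (by simp) (by simp), one_mul]
      _ ≤ _ := mul_le_mul_right h5 _
  calc _ ≤ μ (Metric.ball y (2 * t)) := measure_mono inter_subset_left
    _ ≤ K * μ (Metric.ball y t) := hμ.doubling y t
    _ ≤ K * (2 * μ (Metric.ball y t ∩ Uᶜ)) := mul_le_mul_right h2 _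
    _ = _ := by ring

variable [BorelSpace X] [SecondCountableTopology X]

theorem measurableSet_cone (a : ℝ) :
    MeasurableSet {z : X × ℝ × X | dist z.1 z.2.2 < a * z.2.1} :=
  measurableSet_lt (by fun_prop) (by fun_prop)

theorem measurable_coneMeasure (ν : Measure (ℝ × X)) [SFinite ν] (a : ℝ) :
    Measurable (coneMeasure ν a) :=
  measurable_measure_prodMk_left (measurableSet_cone a)

/-- Averaging over the vertices of the cones, by Tonelli's theorem. -/
theorem lintegral_coneMeasure_mul (μ : Measure X) [SFinite μ] (ν : Measure (ℝ × X)) [SFinite ν]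
    (a : ℝ) {h : X → ℝ≥0∞} (hh : Measurable h) : ∫⁻ x, coneMeasure ν a x * h x ∂μ =
      ∫⁻ p, ∫⁻ x in Metric.ball p.2 (a * p.1), h x ∂μ ∂ν := by
  have e1 : ∀ x, coneMeasure ν a x * h x =
      ∫⁻ p, {z : X × ℝ × X | dist z.1 z.2.2 < a * z.2.1}.indicator (fun z => h z.1) (x, p) ∂ν := by
    intro x
    have hs : MeasurableSet {p : ℝ × X | dist x p.2 < a * p.1} :=
      measurableSet_lt (by fun_prop) (by fun_prop)
    have : (fun p => {z : X × ℝ × X | dist z.1 z.2.2 < a * z.2.1}.indicator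
        (fun z => h z.1) (x, p)) = {p : ℝ × X | dist x p.2 < a * p.1}.indicator fun _ => h x := rfl
    rw [this, lintegral_indicator_const hs, mul_comm]
    rfl
  simp_rw [e1]
  rw [lintegral_lintegral_swap]
  · refine lintegral_congr fun p => ?_
    rw [← lintegral_indicator measurableSet_ball]
    rfl
  · exact (((hh.comp measurable_fst).indicator (measurableSet_cone a)) : Measurable
      ({z : X × ℝ × X | dist z.1 z.2.2 < a * z.2.1}.indicator fun z => h z.1)).aemeasurable

theorem setLIntegral_coneMeasure (μ : Measure X) [SFinite μ] (ν : Measure (ℝ × X)) [SFinite ν]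
    (a : ℝ) {s : Set X} (hs : MeasurableSet s) : ∫⁻ x in s, coneMeasure ν a x ∂μ =
      ∫⁻ p, μ (Metric.ball p.2 (a * p.1) ∩ s) ∂ν := by
  have := lintegral_coneMeasure_mul μ ν a (h := s.indicator 1) (measurable_one.indicator hs)
  rw [← lintegral_indicator hs]
  refine Eq.trans (lintegral_congr fun x => ?_) (this.trans (lintegral_congr fun p => ?_))
  · by_cases hx : x ∈ s <;> simp [hx]
  · rw [lintegral_indicator_one hs, Measure.restrict_apply hs, inter_comm]

variable {μ : Measure X} {K : ℝ≥0}

/-- A distributional inequality. Outside of `V = {M 1_U > 1/(2K)}`, where `U` is the level set of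
the narrow cones, the integral of the wide cones is controlled by that of the narrow cones outside
of `U`. -/
theorem IsDoublingOnBalls.meas_lt_coneMeasure_le [SFinite μ] (hμ : IsDoublingOnBalls μ K)
    (ν : Measure (ℝ × X)) [SFinite ν] {a : ℝ} (ha : 0 < a) :
    μ {x | ENNReal.ofReal a < coneMeasure ν 2 x} ≤
      2 * K ^ 3 * μ {x | ENNReal.ofReal a < coneMeasure ν 1 x} + 2 * K * (ENNReal.ofReal a⁻¹ *
        ∫⁻ x in {x | coneMeasure ν 1 x ≤ ENNReal.ofReal a}, coneMeasure ν 1 x ∂μ) := by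
  rcases isEmpty_or_nonempty X with hX | ⟨⟨x₀⟩⟩
  · simp [Set.eq_empty_of_isEmpty]
  have hK := hμ.ne_zero x₀
  set U := {x | ENNReal.ofReal a < coneMeasure ν 1 x} with hUdef
  have hU : MeasurableSet U := measurableSet_lt measurable_const (measurable_coneMeasure ν 1)
  have hUc : {x | coneMeasure ν 1 x ≤ ENNReal.ofReal a} = Uᶜ := by
    ext x; simp [hUdef]
  set V := {x | (2 * K : ℝ≥0∞)⁻¹ < ballMaximal μ (U.indicator 1) x} with hVdef
  have hV : MeasurableSet V := (isOpen_lt_ballMaximal _ _).measurableSet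
  have h1 : μ V ≤ 2 * K ^ 3 * μ U := by
    have h := hμ.mul_meas_lt_ballMaximal_le (U.indicator 1) (2 * K : ℝ≥0∞)⁻¹
    rw [lintegral_indicator_one hU, ← ENNReal.div_eq_inv_mul,
      ENNReal.div_le_iff (by simp [hK]) (ENNReal.mul_ne_top (by simp) (by simp))] at h
    refine h.trans_eq ?_
    ring
  have h2 : ∫⁻ x in Vᶜ, coneMeasure ν 2 x ∂μ ≤ 2 * K * ∫⁻ x in Uᶜ, coneMeasure ν 1 x ∂μ := by
    rw [setLIntegral_coneMeasure μ ν 2 hV.compl, setLIntegral_coneMeasure μ ν 1 hU.compl,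
      ← lintegral_const_mul' _ _ (ENNReal.mul_ne_top (by simp) (by simp))]
    exact lintegral_mono fun p => hμ.meas_ball_diff_le hU p.2 p.1
  have h3 : μ ({x | ENNReal.ofReal a < coneMeasure ν 2 x} ∩ Vᶜ) ≤
      ENNReal.ofReal a⁻¹ * ∫⁻ x in Vᶜ, coneMeasure ν 2 x ∂μ := by
    have h := mul_meas_ge_le_lintegral (μ := μ.restrict Vᶜ) (measurable_coneMeasure ν 2)
      (ENNReal.ofReal a)
    have ha' : ENNReal.ofReal a ≠ 0 := by simpa using ha
    rw [ENNReal.ofReal_inv_of_pos ha, ← ENNReal.div_eq_inv_mul,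
      ENNReal.le_div_iff_mul_le (Or.inl ha') (Or.inl ENNReal.ofReal_ne_top), mul_comm]
    refine le_trans (mul_le_mul_right ?_ _) h
    rw [Measure.restrict_apply' hV.compl]
    refine measure_mono fun x hx => ⟨?_, hx.2⟩
    exact show ENNReal.ofReal a ≤ coneMeasure ν 2 x from le_of_lt hx.1
  calc μ {x | ENNReal.ofReal a < coneMeasure ν 2 x}
      ≤ μ V + μ ({x | ENNReal.ofReal a < coneMeasure ν 2 x} ∩ Vᶜ) := by
        refine (measure_mono fun x hx => ?_).trans (measure_union_le _ _)
        by_cases h : x ∈ V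
        · exact Or.inl h
        · exact Or.inr ⟨hx, h⟩
    _ ≤ 2 * K ^ 3 * μ U + ENNReal.ofReal a⁻¹ * (2 * K * ∫⁻ x in Uᶜ, coneMeasure ν 1 x ∂μ) :=
        add_le_add h1 (h3.trans (mul_le_mul_right h2 _))
    _ = _ := by rw [hUc]; ring

theorem IsDoublingOnBalls.lintegral_coneMeasure_rpow_le_of_lt_one [SFinite μ]
    (hμ : IsDoublingOnBalls μ K) {q : ℝ} (hq : 0 < q) (hq1 : q < 1) (ν : Measure (ℝ × X))
    [SFinite ν] : ∫⁻ x, coneMeasure ν 2 x ^ q ∂μ ≤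
      (2 * K ^ 3 + 2 * K * ENNReal.ofReal (q / (1 - q))) * ∫⁻ x, coneMeasure ν 1 x ^ q ∂μ := by
  set G := coneMeasure ν 1 with hG
  have hGm : Measurable G := measurable_coneMeasure ν 1
  have hJ : Measurable fun p : ℝ × X =>
      {a : ℝ | G p.2 ≤ ENNReal.ofReal a}.indicator (1 : ℝ → ℝ≥0∞) p.1 :=
    (measurable_one.indicator (measurableSet_le (hGm.comp measurable_snd)
      (ENNReal.measurable_ofReal.comp measurable_fst)) :
      Measurable ({p : ℝ × X | G p.2 ≤ ENNReal.ofReal p.1}.indicator 1))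
  rw [lintegral_rpow_eq_lintegral_meas μ (measurable_coneMeasure ν 2) hq]
  calc ∫⁻ a in Ioi (0 : ℝ), ENNReal.ofReal (q * a ^ (q - 1)) *
        μ {x | ENNReal.ofReal a < coneMeasure ν 2 x}
      ≤ ∫⁻ a in Ioi (0 : ℝ), (2 * K ^ 3 * (ENNReal.ofReal (q * a ^ (q - 1)) *
          μ {x | ENNReal.ofReal a < G x}) + 2 * K * ∫⁻ x, ENNReal.ofReal (q * a ^ (q - 2)) *
            (G x * {a : ℝ | G x ≤ ENNReal.ofReal a}.indicator 1 a) ∂μ) := by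
        refine setLIntegral_mono' measurableSet_Ioi fun a ha => ?_
        have ha' : 0 < a := ha
        refine (mul_le_mul_right (hμ.meas_lt_coneMeasure_le ν ha) _).trans_eq ?_
        rw [mul_add, lintegral_const_mul' _ _ ENNReal.ofReal_ne_top,
          ← lintegral_indicator (measurableSet_le hGm measurable_const)]
        have e : ∀ x, G x * {a : ℝ | G x ≤ ENNReal.ofReal a}.indicator 1 a =
            {x | G x ≤ ENNReal.ofReal a}.indicator G x := fun x => by
          by_cases hx : G x ≤ ENNReal.ofReal a <;> simp [indicator, hx]
        simp_rw [e]
        have e2 : ENNReal.ofReal (q * a ^ (q - 2)) =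
            ENNReal.ofReal (q * a ^ (q - 1)) * ENNReal.ofReal a⁻¹ := by
          rw [← ENNReal.ofReal_mul (by positivity), show q - 2 = q - 1 - 1 by ring,
            Real.rpow_sub_one ha'.ne' (q - 1), div_eq_mul_inv, mul_assoc]
        rw [e2]
        ring
    _ = 2 * K ^ 3 * ∫⁻ x, G x ^ q ∂μ + 2 * K * ∫⁻ x, (∫⁻ a in Ioi (0 : ℝ),
          ENNReal.ofReal (q * a ^ (q - 2)) *
            (G x * {a : ℝ | G x ≤ ENNReal.ofReal a}.indicator 1 a)) ∂μ := by
        have hm : Measurable fun p : ℝ × X => ENNReal.ofReal (q * p.1 ^ (q - 2)) *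
            (G p.2 * {a : ℝ | G p.2 ≤ ENNReal.ofReal a}.indicator 1 p.1) :=
          Measurable.mul (by fun_prop) ((hGm.comp measurable_snd).mul hJ)
        rw [lintegral_add_right, lintegral_const_mul' _ _ (by finiteness),
          lintegral_const_mul' _ _ (by finiteness), lintegral_rpow_eq_lintegral_meas μ hGm hq,
          lintegral_lintegral_swap hm.aemeasurable]
        exact hm.lintegral_prod_right'.const_mul _
    _ ≤ 2 * K ^ 3 * ∫⁻ x, G x ^ q ∂μ +
          2 * K * ∫⁻ x, ENNReal.ofReal (q / (1 - q)) * G x ^ q ∂μ := by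
        gcongr with x
        exact ENNReal.lintegral_mul_indicator_le _ hq hq1
    _ = _ := by
        rw [lintegral_const_mul' _ _ ENNReal.ofReal_ne_top]
        ring

/-- Duality: widening the cones is compensated by replacing the test function by its maximal
function. -/
theorem IsDoublingOnBalls.lintegral_coneMeasure_mul_le [SFinite μ] (hμ : IsDoublingOnBalls μ K)
    (ν : Measure (ℝ × X)) [SFinite ν] {h : X → ℝ≥0∞} (hh : Measurable h) :
    ∫⁻ x, coneMeasure ν 2 x * h x ∂μ ≤ K * ∫⁻ x, coneMeasure ν 1 x * ballMaximal μ h x ∂μ := by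
  rw [lintegral_coneMeasure_mul μ ν 2 hh,
    lintegral_coneMeasure_mul μ ν 1 (measurable_ballMaximal h),
    ← lintegral_const_mul' _ _ ENNReal.coe_ne_top]
  refine lintegral_mono fun p => ?_
  rw [one_mul]
  rcases le_or_gt p.1 0 with h0 | h0
  · rw [Metric.ball_eq_empty.2 (by linarith : 2 * p.1 ≤ 0)]; simp
  have hB0 := (hμ.pos p.2 p.1 h0).ne'
  have hB := (hμ.lt_top p.2 p.1).ne
  rw [← ENNReal.mul_le_mul_iff_left hB0 hB]
  calc (∫⁻ x in Metric.ball p.2 (2 * p.1), h x ∂μ) * μ (Metric.ball p.2 p.1)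
      = ∫⁻ _ in Metric.ball p.2 p.1, (∫⁻ x in Metric.ball p.2 (2 * p.1), h x ∂μ) ∂μ := by
        rw [setLIntegral_const]
    _ ≤ ∫⁻ x in Metric.ball p.2 p.1, ballMaximal μ h x * (K * μ (Metric.ball p.2 p.1)) ∂μ := by
        refine setLIntegral_mono' measurableSet_ball fun x hx => ?_
        refine (hμ.setLIntegral_le h (Metric.ball_subset_ball (by linarith) hx)).trans ?_
        exact mul_le_mul_right (hμ.doubling _ _) _
    _ = _ := by
        rw [lintegral_mul_const' _ _ (by finiteness)]
        ring

/-- For `q > 1`, test the duality estimate with `F^{q-1}`, where `F` is the cone measure of aperture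
`2`, and use the boundedness of the maximal function on the dual space. -/
theorem IsDoublingOnBalls.lintegral_coneMeasure_rpow_le_of_one_lt [SFinite μ]
    (hμ : IsDoublingOnBalls μ K) {q : ℝ} (hq : 1 < q) : ∃ C : ℝ≥0, ∀ (ν : Measure (ℝ × X))
    [SFinite ν], ∫⁻ x, coneMeasure ν 2 x ^ q ∂μ ≤ C * ∫⁻ x, coneMeasure ν 1 x ^ q ∂μ := by
  rcases isEmpty_or_nonempty X with hX | ⟨⟨x₀⟩⟩
  · exact ⟨0, fun ν _ => by simp [Measure.eq_zero_of_isEmpty μ]⟩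
  have hq0 : 0 < q := by linarith
  have hqq : q.HolderConjugate q.conjExponent := Real.HolderConjugate.conjExponent hq
  set s := q.conjExponent with hs
  have hs0 : 0 < s := hqq.symm.pos
  have hs1 : 1 < s := hqq.symm.lt
  set D : ℝ≥0∞ := 2 ^ s * K ^ 2 * ENNReal.ofReal (s / (s - 1)) with hD
  have hDtop : D ≠ ⊤ := by
    have : (2 : ℝ≥0∞) ^ s ≠ ⊤ := by simp
    finiteness
  set E : ℝ≥0∞ := (K * D ^ (1 / s)) ^ q with hE
  have hEtop : E ≠ ⊤ := ENNReal.rpow_ne_top_of_nonneg hq0.le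
    (ENNReal.mul_ne_top (by simp) (ENNReal.rpow_ne_top_of_nonneg (by positivity) hDtop))
  refine ⟨E.toNNReal, fun ν _ => ?_⟩
  rw [ENNReal.coe_toNNReal hEtop]
  set F := coneMeasure ν 2 with hF
  have hFm : Measurable F := measurable_coneMeasure ν 2
  -- truncations of `F`, since the absorption at the end needs a finite left-hand side
  set f : ℕ → X → ℝ≥0∞ := fun N => (Metric.ball x₀ N).indicator fun x => min (F x) N with hf
  have hfm : ∀ N, Measurable (f N) := fun N =>
    (hFm.min measurable_const).indicator measurableSet_ball
  have hfF : ∀ N x, f N x ≤ F x := fun N x =>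
    (indicator_le_self _ _ x).trans (min_le_left _ _)
  have hsup : ∀ x, F x ^ q = ⨆ N, f N x ^ q := by
    intro x
    have hmonoN : Monotone fun N => f N x ^ q := by
      intro N M hNM
      refine ENNReal.rpow_le_rpow ?_ hq0.le
      by_cases hx : x ∈ Metric.ball x₀ N
      · have hx' : x ∈ Metric.ball x₀ M := Metric.ball_subset_ball (by exact_mod_cast hNM) hx
        simp only [hf, indicator_of_mem hx, indicator_of_mem hx']
        gcongr
      · simp [hf, indicator_of_notMem hx]
    refine le_antisymm ?_ (iSup_le fun N => ENNReal.rpow_le_rpow (hfF N x) hq0.le)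
    refine le_of_tendsto' (f := fun N : ℕ => min (F x) N ^ q) (x := atTop) ?_ fun N => ?_
    · have h1 : Tendsto (fun N : ℕ => min (F x) (N : ℝ≥0∞)) atTop (𝓝 (min (F x) ⊤)) :=
        tendsto_const_nhds.min ENNReal.tendsto_nat_nhds_top
      rw [min_top_right] at h1
      exact h1.ennrpow_const q
    · obtain ⟨M, hM⟩ := exists_nat_gt (dist x x₀)
      refine le_iSup_of_le (max N M) (ENNReal.rpow_le_rpow ?_ hq0.le)
      have hx : x ∈ Metric.ball x₀ (max N M : ℕ) :=
        hM.trans_le (by exact_mod_cast le_max_right N M)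
      simp only [hf, indicator_of_mem hx]
      gcongr
      exact le_max_left N M
  have hmono : Monotone fun N x => f N x ^ q := by
    intro N M hNM x
    refine ENNReal.rpow_le_rpow ?_ hq0.le
    by_cases hx : x ∈ Metric.ball x₀ N
    · have hx' : x ∈ Metric.ball x₀ M := Metric.ball_subset_ball (by exact_mod_cast hNM) hx
      simp only [hf, indicator_of_mem hx, indicator_of_mem hx']
      gcongr
    · simp [hf, indicator_of_notMem hx]
  simp_rw [hsup]
  rw [lintegral_iSup (fun N => (hfm N).pow_const q) hmono]
  refine iSup_le fun N => ?_
  set Y := ∫⁻ x, f N x ^ q ∂μ with hY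
  have hYtop : Y ≠ ⊤ := by
    have h1 : Y ≤ ∫⁻ x in Metric.ball x₀ N, (N : ℝ≥0∞) ^ q ∂μ := by
      rw [← lintegral_indicator measurableSet_ball]
      refine lintegral_mono fun x => ?_
      by_cases hx : x ∈ Metric.ball x₀ N
      · simp only [hf, indicator_of_mem hx]
        exact ENNReal.rpow_le_rpow (min_le_right _ _) hq0.le
      · simp [hf, indicator_of_notMem hx, hq0]
    rw [setLIntegral_const] at h1
    exact ne_top_of_le_ne_top (ENNReal.mul_ne_top (ENNReal.rpow_ne_top_of_nonneg hq0.le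
      (ENNReal.natCast_ne_top N)) (hμ.lt_top _ _).ne) h1
  set Z := ∫⁻ x, coneMeasure ν 1 x ^ q ∂μ with hZ
  have hhm : Measurable fun x => f N x ^ (q - 1) := (hfm N).pow_const _
  have e1 : ∀ x, f N x ^ q = f N x * f N x ^ (q - 1) := fun x => by
    have := ENNReal.rpow_add_of_nonneg (x := f N x) 1 (q - 1) zero_le_one (by linarith)
    rwa [add_sub_cancel, ENNReal.rpow_one] at this
  have e2 : ∀ x, (f N x ^ (q - 1)) ^ s = f N x ^ q := fun x => by
    rw [← ENNReal.rpow_mul, hqq.sub_one_mul_conj]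
  have key : Y ≤ K * D ^ (1 / s) * Z ^ (1 / q) * Y ^ (1 / s) := by
    calc Y = ∫⁻ x, f N x * f N x ^ (q - 1) ∂μ := lintegral_congr e1
      _ ≤ ∫⁻ x, F x * f N x ^ (q - 1) ∂μ := lintegral_mono fun x => mul_le_mul_left (hfF N x) _
      _ ≤ K * ∫⁻ x, coneMeasure ν 1 x * ballMaximal μ (fun x => f N x ^ (q - 1)) x ∂μ :=
          hμ.lintegral_coneMeasure_mul_le ν hhm
      _ ≤ K * (Z ^ (1 / q) *
            (∫⁻ x, ballMaximal μ (fun x => f N x ^ (q - 1)) x ^ s ∂μ) ^ (1 / s)) :=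
          mul_le_mul_right (ENNReal.lintegral_mul_le_Lp_mul_Lq μ hqq
            (measurable_coneMeasure ν 1).aemeasurable (measurable_ballMaximal _).aemeasurable) _
      _ ≤ K * (Z ^ (1 / q) * (D * ∫⁻ x, (f N x ^ (q - 1)) ^ s ∂μ) ^ (1 / s)) := by
          gcongr
          exact hμ.lintegral_ballMaximal_rpow_le hs1 hhm
      _ = _ := by
          simp_rw [e2]
          rw [ENNReal.mul_rpow_of_nonneg _ _ (by positivity)]
          ring
  rcases eq_or_ne Y 0 with hY0 | hY0
  · rw [hY0]; exact zero_le
  have e3 : Y = Y ^ (1 / q) * Y ^ (1 / s) := by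
    rw [← ENNReal.rpow_add _ _ hY0 hYtop, one_div, one_div, hqq.inv_add_inv_eq_one,
      ENNReal.rpow_one]
  have hYs0 : Y ^ (1 / s) ≠ 0 := by simp [hY0, hYtop]
  have hYst : Y ^ (1 / s) ≠ ⊤ := ENNReal.rpow_ne_top_of_nonneg (by positivity) hYtop
  nth_rewrite 1 [e3] at key
  have key' := (ENNReal.mul_le_mul_iff_left hYs0 hYst).1 key
  have := ENNReal.rpow_le_rpow key' hq0.le
  rwa [← ENNReal.rpow_mul, one_div_mul_cancel hq0.ne', ENNReal.rpow_one,
    ENNReal.mul_rpow_of_nonneg _ _ hq0.le, ← ENNReal.rpow_mul, one_div_mul_cancel hq0.ne',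
    ENNReal.rpow_one] at this

theorem IsDoublingOnBalls.exists_lintegral_coneMeasure_two_le [SFinite μ]
    (hμ : IsDoublingOnBalls μ K) {q : ℝ} (hq : 0 < q) : ∃ C : ℝ≥0, ∀ (ν : Measure (ℝ × X))
    [SFinite ν], ∫⁻ x, coneMeasure ν 2 x ^ q ∂μ ≤ C * ∫⁻ x, coneMeasure ν 1 x ^ q ∂μ := by
  rcases lt_trichotomy q 1 with h | rfl | h
  · refine ⟨2 * K ^ 3 + 2 * K * (q / (1 - q)).toNNReal, fun ν _ => ?_⟩
    exact_mod_cast hμ.lintegral_coneMeasure_rpow_le_of_lt_one hq h ν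
  · refine ⟨K, fun ν _ => ?_⟩
    simp only [ENNReal.rpow_one]
    rw [← setLIntegral_univ, ← setLIntegral_univ (μ := μ) (coneMeasure ν 1),
      setLIntegral_coneMeasure μ ν 2 .univ, setLIntegral_coneMeasure μ ν 1 .univ,
      ← lintegral_const_mul' _ _ ENNReal.coe_ne_top]
    simp only [inter_univ, one_mul]
    exact lintegral_mono fun p => hμ.doubling p.2 p.1
  · exact hμ.lintegral_coneMeasure_rpow_le_of_one_lt h

/-- Change of aperture, with a constant that grows geometrically in the number of doublings. -/
theorem IsDoublingOnBalls.exists_lintegral_coneMeasure_two_pow_le [SFinite μ]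
    (hμ : IsDoublingOnBalls μ K) {q : ℝ} (hq : 0 < q) : ∃ C : ℝ≥0, ∀ (ν : Measure (ℝ × X))
    [SFinite ν] (j : ℕ),
      ∫⁻ x, coneMeasure ν (2 ^ j) x ^ q ∂μ ≤ C ^ j * ∫⁻ x, coneMeasure ν 1 x ^ q ∂μ := by
  obtain ⟨C, hC⟩ := hμ.exists_lintegral_coneMeasure_two_le hq
  refine ⟨C, fun ν _ j => ?_⟩
  induction j with
  | zero => simp
  | succ j ih =>
    have hm : Measurable fun p : ℝ × X => ((2 : ℝ) ^ j * p.1, p.2) := by fun_prop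
    have e : ∀ a x, coneMeasure (ν.map fun p : ℝ × X => ((2 : ℝ) ^ j * p.1, p.2)) a x =
        coneMeasure ν (a * 2 ^ j) x := fun a x => by
      rw [coneMeasure, Measure.map_apply hm (measurableSet_lt (by fun_prop) (by fun_prop)),
        coneMeasure]
      simp only [preimage_ofPred_eq, mul_assoc]
    have h1 := hC (ν.map fun p : ℝ × X => ((2 : ℝ) ^ j * p.1, p.2))
    simp_rw [e, one_mul] at h1
    rw [pow_succ' 2 j, pow_succ' (C : ℝ≥0∞), mul_assoc]
    exact h1.trans (mul_le_mul_right ih _)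

end Aperture

/-! ### Muckenhoupt weights are doubling -/

section Muckenhoupt

variable {n : ℕ} {w : RSpace n → ℝ}

/-- The measure `w dx`. -/
noncomputable def weightMeasure (w : RSpace n → ℝ) : Measure (RSpace n) :=
  volume.withDensity fun x => ENNReal.ofReal (w x)

theorem IsWeight.aemeasurable (hw : IsWeight w) : AEMeasurable fun x => ENNReal.ofReal (w x) :=
  hw.locallyIntegrable.aestronglyMeasurable.aemeasurable.ennreal_ofReal

theorem weightMeasure_ball (x : RSpace n) (r : ℝ) : weightMeasure w (Metric.ball x r) =
    ∫⁻ y in Metric.ball x r, ENNReal.ofReal (w y) :=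
  withDensity_apply _ measurableSet_ball

theorem IsWeight.weightMeasure_ball_lt_top (hw : IsWeight w) (x : RSpace n) (r : ℝ) :
    weightMeasure w (Metric.ball x r) < ⊤ := by
  rw [weightMeasure_ball]
  have h := (hw.locallyIntegrable.integrableOn_isCompact (isCompact_closedBall x r)).mono_set
    Metric.ball_subset_closedBall
  exact h.lintegral_lt_top

theorem IsWeight.weightMeasure_ball_pos (hw : IsWeight w) (x : RSpace n) {r : ℝ} (hr : 0 < r) :
    0 < weightMeasure w (Metric.ball x r) := by
  rw [weightMeasure_ball, pos_iff_ne_zero, Ne, lintegral_eq_zero_iff' hw.aemeasurable.restrict]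
  intro h
  have h1 : ∀ᵐ y ∂(volume.restrict (Metric.ball x r)), False := by
    filter_upwards [h, ae_restrict_of_ae hw.pos] with y hy hy'
    simp only [Pi.zero_apply, ENNReal.ofReal_eq_zero] at hy
    linarith
  rw [eventually_false_iff_eq_bot, ae_eq_bot, Measure.restrict_eq_zero] at h1
  exact (Metric.measure_ball_pos volume x hr).ne' h1

theorem volume_ball_two_mul (x : RSpace n) (r : ℝ) :
    volume (Metric.ball x (2 * r)) = 2 ^ n * volume (Metric.ball x r) := by
  rw [Measure.addHaar_ball_mul_of_pos volume x two_pos, Measure.addHaar_ball_center volume x r,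
    finrank_euclideanSpace_fin, ENNReal.ofReal_pow zero_le_two, ENNReal.ofReal_ofNat]

/-- The `A₁` condition on `B(x, 2r)`, averaged over `B(x, r)`. -/
theorem MuckenhouptA1.weightMeasure_ball_two_mul_le (h : MuckenhouptA1 w) : ∃ K : ℝ≥0,
    ∀ x r, 0 < r →
      weightMeasure w (Metric.ball x (2 * r)) ≤ K * weightMeasure w (Metric.ball x r) := by
  obtain ⟨C, hC⟩ := h
  refine ⟨C * 2 ^ n, fun x r hr => ?_⟩
  have hB0 := (Metric.measure_ball_pos volume x hr).ne'
  have hBt : volume (Metric.ball x r) ≠ ⊤ := measure_ball_lt_top.ne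
  have h1 := ae_restrict_of_ae_restrict_of_subset
    (Metric.ball_subset_ball (by linarith : r ≤ 2 * r)) (hC x (2 * r) (by linarith))
  have h2 := lintegral_mono_ae h1
  rw [setLIntegral_const, lintegral_const_mul' _ _ ENNReal.coe_ne_top, setLAverage_eq,
    ← weightMeasure_ball, ← weightMeasure_ball, volume_ball_two_mul] at h2
  have e : weightMeasure w (Metric.ball x (2 * r)) = 2 ^ n *
      (weightMeasure w (Metric.ball x (2 * r)) / (2 ^ n * volume (Metric.ball x r)) *
        volume (Metric.ball x r)) := by
    rw [mul_left_comm, mul_comm _ (_ * _),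
      ENNReal.mul_div_cancel (by simp [hB0]) (by finiteness)]
  rw [e]
  calc _ ≤ 2 ^ n * (C * weightMeasure w (Metric.ball x r)) := mul_le_mul_right h2 _
    _ = _ := by push_cast; ring

theorem MuckenhouptAp.weightMeasure_ball_two_mul_le (hw : IsWeight w) {p : ℝ} (hp : 1 < p)
    (h : MuckenhouptAp p w) : ∃ K : ℝ≥0, ∀ x r, 0 < r →
      weightMeasure w (Metric.ball x (2 * r)) ≤ K * weightMeasure w (Metric.ball x r) := by
  obtain ⟨C, hC⟩ := h
  have hpp : p.HolderConjugate p.conjExponent := Real.HolderConjugate.conjExponent hp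
  set q := p.conjExponent with hq
  have hp0 : 0 < p := hpp.pos
  have hq0 : 0 < q := hpp.symm.pos
  refine ⟨C * (2 ^ n) ^ p, fun x r hr => ?_⟩
  set B := Metric.ball x r
  set B' := Metric.ball x (2 * r)
  have hBB' : B ⊆ B' := Metric.ball_subset_ball (by linarith)
  have hB0 : volume B ≠ 0 := (Metric.measure_ball_pos volume x hr).ne'
  have hBt : volume B ≠ ⊤ := measure_ball_lt_top.ne
  have hV : volume B' = 2 ^ n * volume B := volume_ball_two_mul x r
  have hV0 : volume B' ≠ 0 := by rw [hV]; simp [hB0]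
  have hVt : volume B' ≠ ⊤ := measure_ball_lt_top.ne
  set W : RSpace n → ℝ≥0∞ := fun y => ENNReal.ofReal (w y) with hW
  have hWm : AEMeasurable W := hw.aemeasurable
  set σ := ∫⁻ y in B', W y ^ (1 - q) with hσ
  -- Hölder's inequality for `1 = W^{1/p} W^{-1/p}`
  have h1 : volume B ^ p ≤ weightMeasure w B * σ ^ (p - 1) := by
    have h2 : volume B ≤ weightMeasure w B ^ (1 / p) * σ ^ (1 / q) := by
      calc volume B = ∫⁻ y in B, W y ^ (1 / p) * W y ^ (-(1 / p)) := by
            rw [← setLIntegral_one]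
            refine lintegral_congr_ae (ae_restrict_of_ae ?_)
            filter_upwards [hw.pos] with y hy
            rw [← ENNReal.rpow_add _ _ (by simpa [hW] using hy) (by simp [hW]), add_neg_cancel,
              ENNReal.rpow_zero]
        _ ≤ (∫⁻ y in B, (W y ^ (1 / p)) ^ p) ^ (1 / p) *
              (∫⁻ y in B, (W y ^ (-(1 / p))) ^ q) ^ (1 / q) :=
            ENNReal.lintegral_mul_le_Lp_mul_Lq _ hpp (hWm.restrict.pow_const _)
              (hWm.restrict.pow_const _)
        _ ≤ _ := by
            have e1 : ∀ y, (W y ^ (1 / p)) ^ p = W y := fun y => by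
              rw [← ENNReal.rpow_mul, one_div_mul_cancel hp0.ne', ENNReal.rpow_one]
            have e2 : ∀ y, (W y ^ (-(1 / p))) ^ q = W y ^ (1 - q) := fun y => by
              rw [← ENNReal.rpow_mul]
              congr 1
              have := hpp.symm.sub_one_mul_conj
              field_simp
              linarith
            simp_rw [e1, e2]
            rw [weightMeasure_ball]
            gcongr
            exact lintegral_mono_set hBB'
    have h3 := ENNReal.rpow_le_rpow h2 hp0.le
    rwa [ENNReal.mul_rpow_of_nonneg _ _ hp0.le, ← ENNReal.rpow_mul, one_div_mul_cancel hp0.ne',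
      ENNReal.rpow_one, ← ENNReal.rpow_mul, one_div_mul_eq_div, hpp.div_conj_eq_sub_one] at h3
  have h4 := hC x (2 * r) (by linarith)
  rw [setLAverage_eq, setLAverage_eq, ← weightMeasure_ball,
    ENNReal.div_rpow_of_nonneg _ _ hpp.sub_one_pos.le] at h4
  have hVp : volume B' * volume B' ^ (p - 1) = volume B' ^ p := by
    have := ENNReal.rpow_add 1 (p - 1) hV0 hVt
    rwa [add_sub_cancel, ENNReal.rpow_one, eq_comm] at this
  have h5 : weightMeasure w B' * σ ^ (p - 1) ≤ C * volume B' ^ p := by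
    have hVp0 : volume B' ^ (p - 1) ≠ 0 := by simp [hV0, hVt]
    have hVpt : volume B' ^ (p - 1) ≠ ⊤ := ENNReal.rpow_ne_top_of_nonneg hpp.sub_one_pos.le hVt
    calc weightMeasure w B' * σ ^ (p - 1) = weightMeasure w B' / volume B' *
          (σ ^ (p - 1) / volume B' ^ (p - 1)) * (volume B' * volume B' ^ (p - 1)) := by
          rw [mul_mul_mul_comm, ENNReal.div_mul_cancel hV0 hVt, ENNReal.div_mul_cancel hVp0 hVpt]
      _ ≤ C * (volume B' * volume B' ^ (p - 1)) := mul_le_mul_left h4 _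
      _ = _ := by rw [hVp]
  have hp1 : volume B ^ p ≠ 0 := by simp [hB0, hBt]
  have hp2 : volume B ^ p ≠ ⊤ := ENNReal.rpow_ne_top_of_nonneg hp0.le hBt
  rw [← ENNReal.mul_le_mul_iff_left hp1 hp2]
  calc weightMeasure w B' * volume B ^ p
      ≤ weightMeasure w B' * (weightMeasure w B * σ ^ (p - 1)) := mul_le_mul_right h1 _
    _ = weightMeasure w B * (weightMeasure w B' * σ ^ (p - 1)) := by ring
    _ ≤ weightMeasure w B * (C * volume B' ^ p) := mul_le_mul_right h5 _
    _ = _ := by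
      rw [hV, ENNReal.mul_rpow_of_nonneg _ _ hp0.le, ENNReal.coe_mul,
        ENNReal.coe_rpow_of_nonneg _ hp0.le]
      push_cast
      ring

theorem MuckenhouptAInfty.isDoublingOnBalls (h : MuckenhouptAInfty w) :
    ∃ K : ℝ≥0, IsDoublingOnBalls (weightMeasure w) K := by
  obtain ⟨hw, h⟩ := h
  obtain ⟨K, hK⟩ : ∃ K : ℝ≥0, ∀ x r, 0 < r →
      weightMeasure w (Metric.ball x (2 * r)) ≤ K * weightMeasure w (Metric.ball x r) := by
    rcases h with h | ⟨p, hp, h⟩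
    · exact h.weightMeasure_ball_two_mul_le
    · exact h.weightMeasure_ball_two_mul_le hw hp
  refine ⟨K, fun x r hr => hw.weightMeasure_ball_pos x hr,
    fun x r => hw.weightMeasure_ball_lt_top x r, fun x r => ?_⟩
  rcases le_or_gt r 0 with hr | hr
  · rw [Metric.ball_eq_empty.2 (by linarith : 2 * r ≤ 0)]; simp
  · exact hK x r hr

instance : SFinite (weightMeasure w) := by
  unfold weightMeasure; infer_instance

end Muckenhoupt

/-! ### From weighted estimates to cones -/

section Localization

variable {n : ℕ}

/-- A smooth substitute for `max 1 (|y - x| / t)`. -/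
noncomputable def softDist (x : RSpace n) (t : ℝ) (y : RSpace n) : ℝ :=
  √(1 + ‖y - x‖ ^ 2 / t ^ 2)

theorem one_le_softDist (x : RSpace n) (t : ℝ) (y : RSpace n) : 1 ≤ softDist x t y :=
  Real.one_le_sqrt.2 (by have : 0 ≤ ‖y - x‖ ^ 2 / t ^ 2 := by positivity
                         linarith)

theorem norm_div_le_softDist (x : RSpace n) (t : ℝ) (y : RSpace n) :
    ‖y - x‖ / t ≤ softDist x t y :=
  Real.le_sqrt_of_sq_le (by rw [div_pow]; linarith)

theorem softDist_le_two {x y : RSpace n} {t : ℝ} (hy : y ∈ Metric.ball x t) :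
    softDist x t y ≤ 2 := by
  have ht := Metric.pos_of_mem_ball hy
  rw [Metric.mem_ball, dist_eq_norm] at hy
  refine Real.sqrt_le_iff.2 ⟨by norm_num, ?_⟩
  have : ‖y - x‖ ^ 2 / t ^ 2 ≤ 1 := by
    rw [div_le_one (pow_pos ht 2)]
    exact pow_le_pow_left₀ (norm_nonneg _) hy.le 2
  linarith

theorem contDiff_softDist (x : RSpace n) (t : ℝ) : ContDiff ℝ ∞ (softDist x t) := by
  refine ContDiff.sqrt ?_ fun y => ?_
  · exact contDiff_const.add (((contDiff_id.sub contDiff_const).norm_sq ℝ).div_const _)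
  · positivity

theorem softDist_le_add (x : RSpace n) {t : ℝ} (ht : 0 < t) (y z : RSpace n) :
    softDist x t y ≤ softDist x t z + t⁻¹ * dist y z := by
  have hz := norm_div_le_softDist x t z
  have hsq : softDist x t z ^ 2 = 1 + (‖z - x‖ / t) ^ 2 := by
    rw [softDist, Real.sq_sqrt (by positivity), div_pow]
  have htri : ‖y - x‖ / t ≤ ‖z - x‖ / t + t⁻¹ * dist y z := by
    rw [dist_eq_norm, ← div_eq_inv_mul, ← add_div]
    gcongr
    calc ‖y - x‖ = ‖(z - x) + (y - z)‖ := by congr 1; abel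
      _ ≤ _ := norm_add_le _ _
  have hd : 0 ≤ t⁻¹ * dist y z := by positivity
  have h1 := one_le_softDist x t z
  refine Real.sqrt_le_iff.2 ⟨by positivity, ?_⟩
  rw [← div_pow]
  have h2 := pow_le_pow_left₀ (by positivity : 0 ≤ ‖y - x‖ / t) htri 2
  nlinarith [mul_le_mul_of_nonneg_right hz hd]

/-- A bounded approximation, as `ε → 0`, of the logarithm of the weight `e^{-|y - x| / t}`. -/
noncomputable def coneLogWeight (x : RSpace n) (t ε : ℝ) (y : RSpace n) : ℝ :=
  -(softDist x t y / (1 + ε * softDist x t y))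

theorem isLogWeight_coneLogWeight (x : RSpace n) {t ε : ℝ} (ht : 0 < t) (hε : 0 < ε) :
    IsLogWeight t⁻¹ (coneLogWeight x t ε) := by
  have hpos : ∀ y, 0 < 1 + ε * softDist x t y := fun y => by
    have := one_le_softDist x t y
    positivity
  refine ⟨?_, ⟨ε⁻¹, fun y => ?_⟩, fun y => ?_⟩
  · exact ((contDiff_softDist x t).div (contDiff_const.add (contDiff_const.mul
      (contDiff_softDist x t))) fun y => (hpos y).ne').neg
  · have h1 := one_le_softDist x t y
    have h2 : 0 ≤ softDist x t y / (1 + ε * softDist x t y) := by have := hpos y; positivity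
    rw [coneLogWeight, abs_neg, abs_of_nonneg h2, div_le_iff₀ (hpos y), mul_add,
      inv_mul_cancel_left₀ hε.ne']
    have : 0 < ε⁻¹ := inv_pos.2 hε
    linarith
  · have hL : LipschitzWith ⟨t⁻¹, by positivity⟩ (coneLogWeight x t ε) := by
      refine LipschitzWith.of_le_add_mul _ fun y z => ?_
      change coneLogWeight x t ε y ≤ coneLogWeight x t ε z + t⁻¹ * dist y z
      have h1 := one_le_softDist x t y
      have h2 := one_le_softDist x t z
      have h3 := softDist_le_add x ht z y
      rw [dist_comm] at h3
      have hd : 0 ≤ t⁻¹ * dist y z := by positivity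
      simp only [coneLogWeight]
      have e : softDist x t z / (1 + ε * softDist x t z) -
          softDist x t y / (1 + ε * softDist x t y) = (softDist x t z - softDist x t y) /
            ((1 + ε * softDist x t z) * (1 + ε * softDist x t y)) := by
        have := (hpos y).ne'
        have := (hpos z).ne'
        field_simp
        ring
      have h4 : softDist x t z / (1 + ε * softDist x t z) -
          softDist x t y / (1 + ε * softDist x t y) ≤ t⁻¹ * dist y z := by
        rw [e, div_le_iff₀ (mul_pos (hpos z) (hpos y))]
        have h5 : 1 ≤ (1 + ε * softDist x t z) * (1 + ε * softDist x t y) := by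
          have : 0 ≤ ε * softDist x t z := by positivity
          have : 0 ≤ ε * softDist x t y := by positivity
          nlinarith
        nlinarith [mul_le_mul_of_nonneg_left h5 hd]
      linarith
    exact norm_fderiv_le_of_lipschitz ℝ hL

/-- Dyadic decomposition of the weight `e^{-2|y - x| / t}`. -/
theorem exp_neg_softDist_le (x : RSpace n) {t : ℝ} (ht : 0 < t) (y : RSpace n) :
    ENNReal.ofReal (Real.exp (2 * -softDist x t y)) ≤ ∑' j : ℕ,
      (Metric.ball x (2 ^ j * t)).indicator (fun _ => ENNReal.ofReal (Real.exp (-2 ^ j))) y := by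
  obtain ⟨j, h1, h2⟩ := exists_nat_pow_near (one_le_softDist x t y) one_lt_two
  refine le_trans ?_ (ENNReal.le_tsum (j + 1))
  have hy : y ∈ Metric.ball x (2 ^ (j + 1) * t) := by
    rw [Metric.mem_ball, dist_eq_norm, ← div_lt_iff₀ ht]
    exact (norm_div_le_softDist x t y).trans_lt h2
  rw [indicator_of_mem hy]
  refine ENNReal.ofReal_le_ofReal (Real.exp_le_exp.2 ?_)
  rw [pow_succ]
  linarith

/-- A bound in weighted `L²`, for all weights varying at scale `t`, gives a bound on balls of
radius `t` with rapidly decreasing tails. -/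
theorem setLIntegral_ball_le_tsum {x : RSpace n} {t : ℝ} (ht : 0 < t) {g : RSpace n → ℝ≥0∞}
    {v : L2Space n} {C : ℝ≥0∞} (hC : C ≠ ⊤) (H : ∀ ψ, IsLogWeight t⁻¹ ψ →
      ∫⁻ y, ENNReal.ofReal (Real.exp (2 * ψ y)) * g y ≤
        C * ENNReal.ofReal (‖expWeight ψ v‖ ^ 2)) :
    ∫⁻ y in Metric.ball x t, g y ≤ ENNReal.ofReal (Real.exp 4) * C *
      ∑' j : ℕ, ENNReal.ofReal (Real.exp (-2 ^ j)) *
        ∫⁻ y in Metric.ball x (2 ^ j * t), ‖v y‖ₑ ^ 2 := by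
  have hv : Measurable fun y => ‖v y‖ₑ ^ 2 := (Lp.stronglyMeasurable v).measurable.enorm.pow_const 2
  have hsc := (contDiff_softDist x t).continuous.measurable
  -- on `B(x, t)` the logarithms of the weights are bounded below by `-2`, hence the factor `e^4`
  have h1 : ∀ ε : ℝ, 0 < ε → ∫⁻ y in Metric.ball x t, g y ≤ ENNReal.ofReal (Real.exp 4) * (C *
      ∫⁻ y, ENNReal.ofReal (Real.exp (2 * coneLogWeight x t ε y)) * ‖v y‖ₑ ^ 2) := by
    intro ε hε
    have hψ := isLogWeight_coneLogWeight x ht hε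
    have h2 := H _ hψ
    rw [hψ.ofReal_norm_sq] at h2
    refine le_trans ?_ (mul_le_mul_right h2 _)
    rw [← lintegral_const_mul' _ _ ENNReal.ofReal_ne_top]
    refine (setLIntegral_mono' measurableSet_ball fun y hy => ?_).trans
      (setLIntegral_le_lintegral (Metric.ball x t) _)
    rw [← mul_assoc, ← ENNReal.ofReal_mul (Real.exp_pos _).le, ← Real.exp_add]
    refine le_mul_of_one_le_left zero_le ?_
    rw [ENNReal.one_le_ofReal, Real.one_le_exp_iff]
    have h3 := one_le_softDist x t y
    have h4 : softDist x t y / (1 + ε * softDist x t y) ≤ softDist x t y :=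
      div_le_self (by linarith) (by have : 0 ≤ ε * softDist x t y := by positivity
                                    linarith)
    have h5 := softDist_le_two hy
    rw [coneLogWeight]
    linarith
  have hlim : Tendsto (fun ε : ℝ => ∫⁻ y, ENNReal.ofReal
      (Real.exp (2 * coneLogWeight x t ε y)) * ‖v y‖ₑ ^ 2) (𝓝[>] 0)
      (𝓝 (∫⁻ y, ENNReal.ofReal (Real.exp (2 * -softDist x t y)) * ‖v y‖ₑ ^ 2)) := by
    refine tendsto_lintegral_filter_of_dominated_convergence (fun y => ‖v y‖ₑ ^ 2) ?_ ?_ ?_ ?_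
    · filter_upwards [self_mem_nhdsWithin] with ε hε
      exact ((isLogWeight_coneLogWeight x ht hε).contDiff.continuous.measurable.const_mul
        2).exp.ennreal_ofReal.mul hv
    · filter_upwards [self_mem_nhdsWithin] with ε hε
      have hε' : 0 < ε := hε
      refine Eventually.of_forall fun y => mul_le_of_le_one_left zero_le ?_
      rw [ENNReal.ofReal_le_one, Real.exp_le_one_iff, coneLogWeight]
      have h3 := one_le_softDist x t y
      have : 0 ≤ softDist x t y / (1 + ε * softDist x t y) := by positivity
      linarith
    · rw [← L2_ofReal_norm_sq]
      exact ENNReal.ofReal_ne_top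
    · refine Eventually.of_forall fun y => ?_
      refine ENNReal.Tendsto.mul_const ?_ (Or.inr (by finiteness))
      refine ENNReal.tendsto_ofReal ((Real.continuous_exp.tendsto _).comp ?_)
      have hc : ContinuousAt (fun ε : ℝ => 2 * coneLogWeight x t ε y) 0 := by
        refine continuousAt_const.mul (ContinuousAt.neg ?_)
        refine continuousAt_const.div (by fun_prop) ?_
        simp
      have := hc.tendsto.mono_left (nhdsWithin_le_nhds (s := Ioi 0))
      simpa [coneLogWeight] using this
  have h2 : ∫⁻ y in Metric.ball x t, g y ≤ ENNReal.ofReal (Real.exp 4) * (C *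
      ∫⁻ y, ENNReal.ofReal (Real.exp (2 * -softDist x t y)) * ‖v y‖ₑ ^ 2) := by
    refine ge_of_tendsto (ENNReal.Tendsto.const_mul (ENNReal.Tendsto.const_mul hlim
      (Or.inr hC)) (Or.inr ENNReal.ofReal_ne_top)) ?_
    filter_upwards [self_mem_nhdsWithin] with ε hε using h1 ε hε
  refine h2.trans ?_
  rw [mul_assoc]
  refine mul_le_mul_right (mul_le_mul_right ?_ _) _
  calc ∫⁻ y, ENNReal.ofReal (Real.exp (2 * -softDist x t y)) * ‖v y‖ₑ ^ 2
      ≤ ∫⁻ y, ∑' j : ℕ, ENNReal.ofReal (Real.exp (-2 ^ j)) *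
          (Metric.ball x (2 ^ j * t)).indicator (fun y => ‖v y‖ₑ ^ 2) y := by
        refine lintegral_mono fun y => ?_
        refine (mul_le_mul_left (exp_neg_softDist_le x ht y) _).trans_eq ?_
        rw [← ENNReal.tsum_mul_right]
        refine tsum_congr fun j => ?_
        by_cases hy : y ∈ Metric.ball x (2 ^ j * t)
        · rw [indicator_of_mem hy, indicator_of_mem hy]
        · rw [indicator_of_notMem hy, indicator_of_notMem hy, zero_mul, mul_zero]
    _ = _ := by
        rw [lintegral_tsum fun j => ((hv.indicator measurableSet_ball).const_mul _).aemeasurable]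
        refine tsum_congr fun j => ?_
        rw [lintegral_const_mul' _ _ ENNReal.ofReal_ne_top, lintegral_indicator measurableSet_ball]

end Localization

/-! ### Series of square functions -/

section Series

/-- A substitute, for all exponents `q > 0`, of the triangle inequality. -/
theorem ENNReal.tsum_rpow_le {q : ℝ} (hq : 0 < q) (b : ℕ → ℝ≥0∞) :
    (∑' j, b j) ^ q ≤ ∑' j, (2 ^ (j + 1) * b j) ^ q := by
  set R := ∑' j, (2 ^ (j + 1) * b j) ^ q
  have h1 : ∀ j, 2 ^ (j + 1) * b j ≤ R ^ (1 / q) := fun j => by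
    have := ENNReal.rpow_le_rpow (ENNReal.le_tsum (f := fun j => (2 ^ (j + 1) * b j) ^ q) j)
      (by positivity : 0 ≤ 1 / q)
    rwa [← ENNReal.rpow_mul, mul_one_div_cancel hq.ne', ENNReal.rpow_one] at this
  have h2 : ∑' j, b j ≤ R ^ (1 / q) := by
    calc ∑' j, b j = ∑' j : ℕ, 2⁻¹ ^ (j + 1) * (2 ^ (j + 1) * b j) := by
          refine tsum_congr fun j => ?_
          rw [← mul_assoc, ← mul_pow, ENNReal.inv_mul_cancel (by simp) (by simp), one_pow, one_mul]
      _ ≤ ∑' j : ℕ, 2⁻¹ ^ (j + 1) * R ^ (1 / q) :=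
          ENNReal.tsum_le_tsum fun j => mul_le_mul_right (h1 j) _
      _ = R ^ (1 / q) := by
          rw [ENNReal.tsum_mul_right, ENNReal.tsum_geometric_add_one, ENNReal.one_sub_inv_two,
            inv_inv, ENNReal.inv_mul_cancel (by simp) (by simp), one_mul]
  have h3 := ENNReal.rpow_le_rpow h2 hq.le
  rwa [← ENNReal.rpow_mul, one_div_mul_cancel hq.ne', ENNReal.rpow_one] at h3

/-- The super-exponential decay `e^{-2^j}` beats every geometric growth. -/
theorem tsum_exp_neg_two_pow_ne_top {q : ℝ} (hq : 0 < q) {D : ℝ≥0∞} (hD : D ≠ ⊤) :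
    ∑' j : ℕ, (2 ^ (j + 1) * ENNReal.ofReal (Real.exp (-2 ^ j))) ^ q * D ^ (j + 1) ≠ ⊤ := by
  set ρ : ℝ≥0∞ := 2⁻¹ ^ q with hρ
  have hρ1 : ρ < 1 := ENNReal.rpow_lt_one (by simp) hq
  obtain ⟨k, hk⟩ : ∃ k : ℕ, ρ ^ k * D < 1 := by
    have h1 : Tendsto (fun k : ℕ => ρ ^ k * D) atTop (𝓝 (0 * D)) :=
      ENNReal.Tendsto.mul_const (ENNReal.tendsto_pow_atTop_nhds_zero_of_lt_one hρ1) (Or.inr hD)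
    rw [zero_mul] at h1
    exact (h1.eventually_lt_const zero_lt_one).exists
  set N : ℝ≥0∞ := ENNReal.ofReal (2 * (k + 1).factorial) with hN
  have hterm : ∀ j : ℕ, (2 ^ (j + 1) * ENNReal.ofReal (Real.exp (-2 ^ j))) ^ q * D ^ (j + 1) ≤
      N ^ q * D * (ρ ^ k * D) ^ j := by
    intro j
    have h1 : (2 : ℝ≥0∞) ^ (j + 1) * ENNReal.ofReal (Real.exp (-2 ^ j)) ≤
        N * (2⁻¹ ^ k) ^ j := by
      have e2 : (2 : ℝ≥0∞) = ENNReal.ofReal 2 := by simp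
      rw [e2, ← ENNReal.ofReal_inv_of_pos two_pos, ← ENNReal.ofReal_pow (by norm_num),
        ← ENNReal.ofReal_pow (by norm_num), ← ENNReal.ofReal_pow (by norm_num),
        ← ENNReal.ofReal_mul (by positivity), ← ENNReal.ofReal_mul (by positivity)]
      refine ENNReal.ofReal_le_ofReal ?_
      have h2 := Real.pow_div_factorial_le_exp ((2 : ℝ) ^ j) (by positivity) (k + 1)
      rw [Real.exp_neg]
      have h3 : (Real.exp (2 ^ j))⁻¹ ≤ ((k + 1).factorial : ℝ) / (2 ^ j) ^ (k + 1) := by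
        rw [← inv_div]
        exact inv_anti₀ (by positivity) h2
      calc (2 : ℝ) ^ (j + 1) * (Real.exp (2 ^ j))⁻¹
          ≤ 2 ^ (j + 1) * (((k + 1).factorial : ℝ) / (2 ^ j) ^ (k + 1)) := by gcongr
        _ = 2 * ((k + 1).factorial : ℝ) * (2⁻¹ ^ k) ^ j := by
          rw [pow_succ 2 j, pow_succ (2 ^ j : ℝ) k, inv_pow, inv_pow, ← pow_mul, ← pow_mul,
            mul_comm k j]
          field_simp
    have h2 : ((2⁻¹ ^ k) ^ j : ℝ≥0∞) ^ q = (ρ ^ k) ^ j := by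
      rw [hρ, ← pow_mul, ← pow_mul, ← ENNReal.rpow_natCast, ← ENNReal.rpow_natCast,
        ← ENNReal.rpow_mul, ← ENNReal.rpow_mul, mul_comm]
    calc _ ≤ (N * (2⁻¹ ^ k) ^ j) ^ q * D ^ (j + 1) :=
          mul_le_mul_left (ENNReal.rpow_le_rpow h1 hq.le) _
      _ = _ := by
          rw [ENNReal.mul_rpow_of_nonneg _ _ hq.le, h2, mul_pow, pow_succ]
          ring
  refine ne_top_of_le_ne_top ?_ (ENNReal.tsum_le_tsum hterm)
  rw [ENNReal.tsum_mul_left, ENNReal.tsum_geometric]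
  refine ENNReal.mul_ne_top (ENNReal.mul_ne_top
    (ENNReal.rpow_ne_top_of_nonneg hq.le ENNReal.ofReal_ne_top) hD) ?_
  exact ENNReal.inv_ne_top.2 (tsub_pos_of_lt hk).ne'

end Series

/-! ### The square functions as cone measures -/

section HeatMeasure

open ProbabilityTheory

variable {n : ℕ} {A : RSpace n → Matrix (Fin n) (Fin n) ℂ}

theorem exists_norm_heatFamily_one_le (hA : IsElliptic A) :
    ∃ C, ∀ (f : L2Space n) (t : ℝ), 0 < t → ‖heatFamily A 1 f t‖ ≤ C * ‖f‖ := by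
  obtain ⟨C, -, H⟩ := exists_norm_expWeight_iterate_le hA 1 (θ := 1) one_pos
  refine ⟨C, fun f t ht => ?_⟩
  have h1 := H t (fun _ => 0) f ht ⟨contDiff_const, ⟨0, by simp⟩, by simp [ht.le]⟩
  rw [expWeight_zero, expWeight_zero, one_mul] at h1
  rwa [heatFamily, ← ofReal_smul_eq, norm_smul, Complex.norm_real,
    Real.norm_of_nonneg (by positivity)]

theorem continuous_setLIntegral_L2 {s : Set (RSpace n)} (hs : MeasurableSet s) :
    Continuous fun u : L2Space n => ∫⁻ y in s, ‖u y‖ₑ ^ 2 := by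
  have hb : MemLp (s.indicator fun _ => (1 : ℂ)) ⊤ (volume : Measure (RSpace n)) :=
    memLp_top_of_bound (stronglyMeasurable_const.indicator hs).aestronglyMeasurable 1
      (Eventually.of_forall fun x => (norm_indicator_le_norm_self _ _).trans (by simp))
  have e : ∀ u : L2Space n, ∫⁻ y in s, ‖u y‖ₑ ^ 2 =
      ENNReal.ofReal (‖mulOp (s.indicator fun _ => (1 : ℂ)) u‖ ^ 2) := by
    intro u
    rw [L2_ofReal_norm_sq, ← lintegral_indicator hs]
    refine lintegral_congr_ae ?_
    filter_upwards [coeFn_mulOp hb u] with y hy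
    rw [hy]
    by_cases h : y ∈ s <;> simp [h]
  simp_rw [e]
  exact ENNReal.continuous_ofReal.comp (by fun_prop)

theorem continuousOn_heatFamily (hA : IsElliptic A) (m : ℕ) (f : L2Space n) :
    ContinuousOn (heatFamily A m f) (Ioi 0) := fun _ ht =>
  (hasDerivAt_heatFamily hA m f ht).continuousAt.continuousWithinAt

/-- The measures `|u(t, y)|² dy`, `t > 0`, for a continuous `L²`-valued function `u`, as a kernel
(with value `0` for `t ≤ 0`). This circumvents the joint measurability of `(t, y) ↦ u(t, y)`: with
`u t` only an a.e. class for each `t`, the values on Borel sets are measurable in `t`. -/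
noncomputable def sqKernel (u : ℝ → L2Space n) (hu : ContinuousOn u (Ioi 0)) :
    Kernel ℝ (RSpace n) where
  toFun t := (Ioi (0 : ℝ)).indicator (fun t => volume.withDensity fun y => ‖u t y‖ₑ ^ 2) t
  measurable' := by
    refine Measure.measurable_of_measurable_coe _ fun s hs => ?_
    have e : (fun t => (Ioi (0 : ℝ)).indicator
        (fun t => volume.withDensity fun y => ‖u t y‖ₑ ^ 2) t s) =
        (Ioi (0 : ℝ)).piecewise (fun t => ∫⁻ y in s, ‖u t y‖ₑ ^ 2) 0 := by
      ext t
      by_cases ht : t ∈ Ioi (0 : ℝ)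
      · rw [indicator_of_mem ht, piecewise_eq_of_mem _ _ _ ht, withDensity_apply _ hs]
      · rw [indicator_of_notMem ht, piecewise_eq_of_notMem _ _ _ ht]; rfl
    rw [e]
    exact ((continuous_setLIntegral_L2 hs).comp_continuousOn hu).measurable_piecewise
      continuousOn_const measurableSet_Ioi

theorem sqKernel_apply {u : ℝ → L2Space n} (hu : ContinuousOn u (Ioi 0)) {t : ℝ} (ht : 0 < t)
    {s : Set (RSpace n)} (hs : MeasurableSet s) : sqKernel u hu t s = ∫⁻ y in s, ‖u t y‖ₑ ^ 2 := by
  change (Ioi (0 : ℝ)).indicator (fun t => volume.withDensity fun y => ‖u t y‖ₑ ^ 2) t s = _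
  rw [indicator_of_mem (show t ∈ Ioi (0 : ℝ) from ht), withDensity_apply _ hs]

theorem isFiniteKernel_sqKernel {u : ℝ → L2Space n} (hu : ContinuousOn u (Ioi 0)) {M : ℝ}
    (hM : ∀ t, 0 < t → ‖u t‖ ≤ M) : IsFiniteKernel (sqKernel u hu) := by
  refine ⟨ENNReal.ofReal (M ^ 2), ENNReal.ofReal_lt_top, fun t => ?_⟩
  by_cases ht : 0 < t
  · rw [sqKernel_apply hu ht .univ, setLIntegral_univ, ← L2_ofReal_norm_sq]
    exact ENNReal.ofReal_le_ofReal (pow_le_pow_left₀ (norm_nonneg _) (hM t ht) 2)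
  · change (Ioi (0 : ℝ)).indicator (fun t => volume.withDensity fun y => ‖u t y‖ₑ ^ 2) t univ ≤ _
    rw [indicator_of_notMem (show t ∉ Ioi (0 : ℝ) from ht)]
    simp

/-- The measure `dt / t^{n+1}` on `(0, ∞)`. -/
noncomputable def scaleMeasure (n : ℕ) : Measure ℝ :=
  (volume.restrict (Ioi 0)).withDensity fun t => (ENNReal.ofReal (t ^ (n + 1)))⁻¹

instance : SFinite (scaleMeasure n) := by
  unfold scaleMeasure; infer_instance

theorem lintegral_scaleMeasure {φ : ℝ → ℝ≥0∞} (hφ : Measurable φ) : ∫⁻ t, φ t ∂(scaleMeasure n) =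
    ∫⁻ t in Ioi (0 : ℝ), (ENNReal.ofReal (t ^ (n + 1)))⁻¹ * φ t :=
  lintegral_withDensity_eq_lintegral_mul _ (by fun_prop) hφ

theorem lintegral_scaleMeasure_comp_half_le {φ : ℝ → ℝ≥0∞} (hφ : Measurable φ) :
    ∫⁻ t, φ (t / 2) ∂(scaleMeasure n) ≤ 2 * ∫⁻ t, φ t ∂(scaleMeasure n) := by
  set G : ℝ → ℝ≥0∞ := (Ioi 0).indicator fun t => (ENNReal.ofReal (t ^ (n + 1)))⁻¹ * φ t with hG
  have hGm : Measurable G := by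
    refine Measurable.indicator (Measurable.mul ?_ hφ) measurableSet_Ioi
    fun_prop
  calc ∫⁻ t, φ (t / 2) ∂(scaleMeasure n) = ∫⁻ t in Ioi (0 : ℝ),
        (ENNReal.ofReal (t ^ (n + 1)))⁻¹ * φ (t / 2) :=
        lintegral_scaleMeasure (hφ.comp (by fun_prop))
    _ ≤ ∫⁻ t in Ioi (0 : ℝ), G (2⁻¹ * t) := by
        refine setLIntegral_mono' measurableSet_Ioi fun t ht => ?_
        have ht' : 0 < t := ht
        have h2 : 2⁻¹ * t ∈ Ioi (0 : ℝ) := by rw [mem_Ioi]; positivity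
        rw [hG, indicator_of_mem h2, ← div_eq_inv_mul]
        gcongr
        linarith
    _ ≤ ∫⁻ t, G (2⁻¹ * t) := setLIntegral_le_lintegral _ _
    _ = 2 * ∫⁻ t, G t := by
        rw [← lintegral_map (f := G) hGm (by fun_prop : Measurable fun t : ℝ => 2⁻¹ * t),
          Real.map_volume_mul_left (by norm_num), lintegral_smul_measure]
        simp
    _ = _ := by rw [lintegral_indicator measurableSet_Ioi, lintegral_scaleMeasure hφ]

theorem conicalSquare_eq (F : ℝ → RSpace n → ℝ) (x : RSpace n) : conicalSquare F x =
    (∫⁻ t in Ioi (0 : ℝ), (ENNReal.ofReal (t ^ (n + 1)))⁻¹ *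
      ∫⁻ y in Metric.ball x t, ‖F t y‖ₑ ^ 2) ^ (1 / 2 : ℝ) := by
  rw [conicalSquare]
  congr 1
  refine setLIntegral_congr_fun measurableSet_Ioi fun t ht => ?_
  have ht' : 0 < t ^ (n + 1) := pow_pos ht _
  rw [← lintegral_const_mul' _ _ (ENNReal.inv_ne_top.2 (by simpa using ht'))]
  exact lintegral_congr fun y => ENNReal.div_eq_inv_mul

variable {u : ℝ → L2Space n} (hu : ContinuousOn u (Ioi 0)) [IsFiniteKernel (sqKernel u hu)]

theorem coneMeasure_sqKernel (a : ℝ) (x : RSpace n) :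
    coneMeasure (scaleMeasure n ⊗ₘ sqKernel u hu) a x =
      ∫⁻ t, sqKernel u hu t (Metric.ball x (a * t)) ∂(scaleMeasure n) := by
  rw [coneMeasure, Measure.compProd_apply (measurableSet_lt (by fun_prop) (by fun_prop))]
  refine lintegral_congr fun t => ?_
  congr 1
  ext y
  simp [dist_comm]

theorem measurable_sqKernel_ball (a : ℝ) (x : RSpace n) :
    Measurable fun t => sqKernel u hu t (Metric.ball x (a * t)) := by
  have h : MeasurableSet {p : ℝ × RSpace n | dist p.2 x < a * p.1} :=
    measurableSet_lt (by fun_prop) (by fun_prop)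
  exact Kernel.measurable_kernel_prodMk_left h

theorem conicalSquare_norm_eq (x : RSpace n) : conicalSquare (fun t y => ‖u t y‖) x =
    coneMeasure (scaleMeasure n ⊗ₘ sqKernel u hu) 1 x ^ (1 / 2 : ℝ) := by
  rw [conicalSquare_eq, coneMeasure_sqKernel,
    lintegral_scaleMeasure (measurable_sqKernel_ball hu 1 x)]
  congr 1
  refine setLIntegral_congr_fun measurableSet_Ioi fun t ht => ?_
  simp only [enorm_norm, one_mul]
  rw [sqKernel_apply hu ht measurableSet_ball]

/-- A square function whose integrand at time `t` is controlled in weighted `L²` by `u (t / 2)` is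
controlled pointwise by the square functions of `u` on cones of aperture `2 ^ (j + 1)`. -/
theorem conicalSquare_le_tsum_coneMeasure {F : ℝ → RSpace n → ℝ} {C : ℝ≥0∞} (hC : C ≠ ⊤)
    (H : ∀ t ψ, 0 < t → IsLogWeight t⁻¹ ψ →
      ∫⁻ y, ENNReal.ofReal (Real.exp (2 * ψ y)) * ‖F t y‖ₑ ^ 2 ≤
        C * ENNReal.ofReal (‖expWeight ψ (u (t / 2))‖ ^ 2)) (x : RSpace n) :
    conicalSquare F x ≤ (2 * ENNReal.ofReal (Real.exp 4) * C *
      ∑' j : ℕ, ENNReal.ofReal (Real.exp (-2 ^ j)) *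
        coneMeasure (scaleMeasure n ⊗ₘ sqKernel u hu) (2 ^ (j + 1)) x) ^ (1 / 2 : ℝ) := by
  rw [conicalSquare_eq]
  refine ENNReal.rpow_le_rpow ?_ (by norm_num)
  have hm : ∀ j : ℕ, Measurable fun t =>
      sqKernel u hu (t / 2) (Metric.ball x (2 ^ (j + 1) * (t / 2))) := fun j =>
    (measurable_sqKernel_ball hu (2 ^ (j + 1)) x).comp (by fun_prop)
  calc ∫⁻ t in Ioi (0 : ℝ), (ENNReal.ofReal (t ^ (n + 1)))⁻¹ *
        ∫⁻ y in Metric.ball x t, ‖F t y‖ₑ ^ 2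
      ≤ ∫⁻ t in Ioi (0 : ℝ), (ENNReal.ofReal (t ^ (n + 1)))⁻¹ *
          (ENNReal.ofReal (Real.exp 4) * C * ∑' j : ℕ, ENNReal.ofReal (Real.exp (-2 ^ j)) *
            sqKernel u hu (t / 2) (Metric.ball x (2 ^ (j + 1) * (t / 2)))) := by
        refine setLIntegral_mono' measurableSet_Ioi fun t ht => mul_le_mul_right ?_ _
        have ht' : 0 < t := ht
        refine (setLIntegral_ball_le_tsum ht' hC (H t · ht')).trans_eq ?_
        congr 1
        refine tsum_congr fun j => ?_
        rw [sqKernel_apply hu (half_pos ht') measurableSet_ball, pow_succ, mul_assoc (2 ^ j) 2,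
          mul_div_cancel₀ t two_ne_zero]
    _ = ENNReal.ofReal (Real.exp 4) * C * ∑' j : ℕ, ENNReal.ofReal (Real.exp (-2 ^ j)) *
          ∫⁻ t, sqKernel u hu (t / 2) (Metric.ball x (2 ^ (j + 1) * (t / 2)))
            ∂(scaleMeasure n) := by
        rw [← lintegral_scaleMeasure (Measurable.const_mul
          (Measurable.tsum fun j => (hm j).const_mul _) _),
          lintegral_const_mul' _ _ (by finiteness),
          lintegral_tsum fun j => ((hm j).const_mul _).aemeasurable]
        congr 1
        exact tsum_congr fun j => lintegral_const_mul' _ _ ENNReal.ofReal_ne_top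
    _ ≤ ENNReal.ofReal (Real.exp 4) * C * ∑' j : ℕ, ENNReal.ofReal (Real.exp (-2 ^ j)) *
          (2 * coneMeasure (scaleMeasure n ⊗ₘ sqKernel u hu) (2 ^ (j + 1)) x) := by
        refine mul_le_mul_right (ENNReal.tsum_le_tsum fun j => mul_le_mul_right ?_ _) _
        rw [coneMeasure_sqKernel]
        exact lintegral_scaleMeasure_comp_half_le (measurable_sqKernel_ball hu (2 ^ (j + 1)) x)
    _ = _ := by
        simp_rw [mul_left_comm _ (2 : ℝ≥0∞)]
        rw [ENNReal.tsum_mul_left]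
        ring

end HeatMeasure

/-! ### Comparison of square functions -/

section Comparison

open ProbabilityTheory

variable {n : ℕ} {A : RSpace n → Matrix (Fin n) (Fin n) ℂ}

theorem weightedNorm_eq {p : ℝ} (hp : 0 < p) (w : RSpace n → ℝ) (F : RSpace n → ℝ≥0∞) :
    weightedNorm p w F = (∫⁻ x, F x ^ p ∂(weightMeasure w)) ^ (1 / p) := by
  rw [weightedNorm, eLpNorm_eq_lintegral_rpow_enorm_toReal (by simpa using hp)
    ENNReal.ofReal_ne_top, ENNReal.toReal_ofReal hp.le]
  rfl

/-- Summing the change of aperture over dyadic cones. -/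
theorem IsDoublingOnBalls.exists_lintegral_tsum_coneMeasure_le {X : Type*} [PseudoMetricSpace X]
    [MeasurableSpace X] [BorelSpace X] [SecondCountableTopology X] {μ : Measure X} [SFinite μ]
    {K : ℝ≥0} (hμ : IsDoublingOnBalls μ K) {q : ℝ} (hq : 0 < q) : ∃ C : ℝ≥0,
    ∀ (ν : Measure (ℝ × X)) [SFinite ν], ∫⁻ x, (∑' j : ℕ, ENNReal.ofReal (Real.exp (-2 ^ j)) *
      coneMeasure ν (2 ^ (j + 1)) x) ^ q ∂μ ≤ C * ∫⁻ x, coneMeasure ν 1 x ^ q ∂μ := by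
  obtain ⟨D, hD⟩ := hμ.exists_lintegral_coneMeasure_two_pow_le hq
  refine ⟨(∑' j : ℕ, (2 ^ (j + 1) * ENNReal.ofReal (Real.exp (-2 ^ j))) ^ q *
    (D : ℝ≥0∞) ^ (j + 1)).toNNReal, fun ν _ => ?_⟩
  rw [ENNReal.coe_toNNReal (tsum_exp_neg_two_pow_ne_top hq ENNReal.coe_ne_top)]
  calc _ ≤ ∫⁻ x, ∑' j : ℕ, (2 ^ (j + 1) * ENNReal.ofReal (Real.exp (-2 ^ j))) ^ q *
          coneMeasure ν (2 ^ (j + 1)) x ^ q ∂μ := by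
        refine lintegral_mono fun x => (ENNReal.tsum_rpow_le hq _).trans_eq ?_
        refine tsum_congr fun j => ?_
        rw [← mul_assoc, ENNReal.mul_rpow_of_nonneg _ _ hq.le]
    _ = ∑' j : ℕ, (2 ^ (j + 1) * ENNReal.ofReal (Real.exp (-2 ^ j))) ^ q *
          ∫⁻ x, coneMeasure ν (2 ^ (j + 1)) x ^ q ∂μ := by
        have hm : ∀ j : ℕ, Measurable fun x => coneMeasure ν (2 ^ (j + 1)) x ^ q :=
          fun j => (measurable_coneMeasure ν _).pow_const q
        rw [lintegral_tsum fun j => ((hm j).const_mul _).aemeasurable]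
        exact tsum_congr fun j => lintegral_const_mul _ (hm j)
    _ ≤ ∑' j : ℕ, (2 ^ (j + 1) * ENNReal.ofReal (Real.exp (-2 ^ j))) ^ q *
          (D ^ (j + 1) * ∫⁻ x, coneMeasure ν 1 x ^ q ∂μ) :=
        ENNReal.tsum_le_tsum fun j => mul_le_mul_right (hD ν (j + 1)) _
    _ = _ := by
        rw [← ENNReal.tsum_mul_right]
        exact tsum_congr fun j => (mul_assoc _ _ _).symm

/-- A square function whose integrand is controlled in weighted `L²` is controlled by `𝒮_H` in
`L^p(w)`. -/
theorem exists_weightedNorm_conicalSquare_le (hA : IsElliptic A)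
    {F : L2Space n → ℝ → RSpace n → ℝ} {C : ℝ≥0∞} (hC : C ≠ ⊤)
    (H : ∀ f t ψ, 0 < t → IsLogWeight t⁻¹ ψ →
      ∫⁻ y, ENNReal.ofReal (Real.exp (2 * ψ y)) * ‖F f t y‖ₑ ^ 2 ≤
        C * ENNReal.ofReal (‖expWeight ψ (heatFamily A 1 f (t / 2))‖ ^ 2))
    {w : RSpace n → ℝ} (hw : MuckenhouptAInfty w) {p : ℝ} (hp : 0 < p) : ∃ C' : ℝ≥0,
    ∀ f, weightedNorm p w (conicalSquare (F f)) ≤ C' * weightedNorm p w (squareS A 1 f) := by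
  obtain ⟨K, hK⟩ := hw.isDoublingOnBalls
  obtain ⟨D, hD⟩ := hK.exists_lintegral_tsum_coneMeasure_le (half_pos hp)
  obtain ⟨M, hM⟩ := exists_norm_heatFamily_one_le hA
  set E : ℝ≥0∞ := 2 * ENNReal.ofReal (Real.exp 4) * C with hE
  have hEt : E ≠ ⊤ := by finiteness
  set R : ℝ≥0∞ := (E ^ (p / 2) * D) ^ (1 / p) with hR
  have hRt : R ≠ ⊤ := ENNReal.rpow_ne_top_of_nonneg (by positivity)
    (ENNReal.mul_ne_top (ENNReal.rpow_ne_top_of_nonneg (by positivity) hEt) ENNReal.coe_ne_top)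
  refine ⟨R.toNNReal, fun f => ?_⟩
  rw [ENNReal.coe_toNNReal hRt]
  have hu := continuousOn_heatFamily hA 1 f
  have := isFiniteKernel_sqKernel hu (hM f)
  set ν := scaleMeasure n ⊗ₘ sqKernel (heatFamily A 1 f) hu
  have e : ∀ b : ℝ≥0∞, (b ^ (1 / 2 : ℝ)) ^ p = b ^ (p / 2) := fun b => by
    rw [← ENNReal.rpow_mul, one_div_mul_eq_div]
  rw [weightedNorm_eq hp, weightedNorm_eq hp, hR,
    ← ENNReal.mul_rpow_of_nonneg _ _ (by positivity : 0 ≤ 1 / p)]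
  refine ENNReal.rpow_le_rpow ?_ (by positivity)
  calc ∫⁻ x, conicalSquare (F f) x ^ p ∂(weightMeasure w)
      ≤ ∫⁻ x, E ^ (p / 2) * (∑' j : ℕ, ENNReal.ofReal (Real.exp (-2 ^ j)) *
          coneMeasure ν (2 ^ (j + 1)) x) ^ (p / 2) ∂(weightMeasure w) := by
        refine lintegral_mono fun x => ?_
        refine (ENNReal.rpow_le_rpow
          (conicalSquare_le_tsum_coneMeasure hu hC (H f) x) hp.le).trans_eq ?_
        rw [e, ENNReal.mul_rpow_of_nonneg _ _ (by positivity)]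
    _ = E ^ (p / 2) * ∫⁻ x, (∑' j : ℕ, ENNReal.ofReal (Real.exp (-2 ^ j)) *
          coneMeasure ν (2 ^ (j + 1)) x) ^ (p / 2) ∂(weightMeasure w) :=
        lintegral_const_mul' _ _ (ENNReal.rpow_ne_top_of_nonneg (by positivity) hEt)
    _ ≤ E ^ (p / 2) * (D * ∫⁻ x, coneMeasure ν 1 x ^ (p / 2) ∂(weightMeasure w)) :=
        mul_le_mul_right (hD ν) _
    _ = _ := by
        rw [← mul_assoc]
        congr 1
        refine lintegral_congr fun x => ?_
        rw [← e, squareS, conicalSquare_norm_eq hu]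

theorem exists_weightedNorm_squareS_le (hA : IsElliptic A) (m : ℕ) {w : RSpace n → ℝ}
    (hw : MuckenhouptAInfty w) {p : ℝ} (hp : 0 < p) : ∃ C : ℝ≥0, ∀ f : L2Space n,
      weightedNorm p w (squareS A (m + 1) f) ≤ C * weightedNorm p w (squareS A 1 f) := by
  obtain ⟨C, hC, H⟩ := exists_norm_heatFamily_le hA m
  refine exists_weightedNorm_conicalSquare_le hA (C := ENNReal.ofReal (C ^ 2))
    ENNReal.ofReal_ne_top (fun f t ψ ht hψ => ?_) hw hp
  simp only [enorm_norm]
  rw [← hψ.ofReal_norm_sq, ← ENNReal.ofReal_mul (by positivity), ← mul_pow]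
  exact ENNReal.ofReal_le_ofReal (pow_le_pow_left₀ (norm_nonneg _) (H t ψ f ht hψ) 2)

theorem exists_weightedNorm_squareGFull_le (hA : IsElliptic A) (m : ℕ) {w : RSpace n → ℝ}
    (hw : MuckenhouptAInfty w) {p : ℝ} (hp : 0 < p) : ∃ C : ℝ≥0, ∀ f : L2Space n,
      weightedNorm p w (squareGFull A (m + 1) f) ≤ C * weightedNorm p w (squareS A 1 f) := by
  obtain ⟨C, hC, H⟩ := exists_norm_gradient_heatFamily_le hA m
  refine exists_weightedNorm_conicalSquare_le hA (C := ENNReal.ofReal C)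
    ENNReal.ofReal_ne_top (fun f t ψ ht hψ => ?_) hw hp
  have hsq : ∀ v : L2Space n, ∀ y, ENNReal.ofReal (‖v y‖ ^ 2) = ‖v y‖ₑ ^ 2 := fun v y => by
    rw [ENNReal.ofReal_pow (norm_nonneg _), ofReal_norm]
  have e : ∀ y, ENNReal.ofReal (Real.exp (2 * ψ y)) *
      ‖t * √((∑ j, ‖weakGradient (heatFamily A (m + 1) f t) j y‖ ^ 2) +
        ‖deriv (heatFamily A (m + 1) f) t y‖ ^ 2)‖ₑ ^ 2 = ENNReal.ofReal (t ^ 2) *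
      (∑ j, ENNReal.ofReal (Real.exp (2 * ψ y)) *
          ‖weakGradient (heatFamily A (m + 1) f t) j y‖ₑ ^ 2 +
        ENNReal.ofReal (Real.exp (2 * ψ y)) * ‖deriv (heatFamily A (m + 1) f) t y‖ₑ ^ 2) := by
    intro y
    rw [← Finset.mul_sum, ← mul_add, mul_left_comm]
    congr 1
    rw [Real.enorm_of_nonneg (by positivity), ← ENNReal.ofReal_pow (by positivity), mul_pow,
      Real.sq_sqrt (by positivity), ENNReal.ofReal_mul (by positivity),
      ENNReal.ofReal_add (by positivity) (by positivity),
      ENNReal.ofReal_sum_of_nonneg fun j _ => by positivity]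
    simp_rw [hsq]
  have hm : ∀ v : L2Space n, Measurable fun y =>
      ENNReal.ofReal (Real.exp (2 * ψ y)) * ‖v y‖ₑ ^ 2 := fun v =>
    (hψ.contDiff.continuous.measurable.const_mul 2).exp.ennreal_ofReal.mul
      ((Lp.stronglyMeasurable v).measurable.enorm.pow_const 2)
  simp_rw [e]
  rw [lintegral_const_mul' _ _ ENNReal.ofReal_ne_top, lintegral_add_right _ (hm _),
    lintegral_finsetSum _ fun j _ => hm _, ← hψ.ofReal_norm_sq]
  simp_rw [← hψ.ofReal_norm_sq]
  rw [← ENNReal.ofReal_sum_of_nonneg fun j _ => by positivity,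
    ← ENNReal.ofReal_add (by positivity) (by positivity), ← ENNReal.ofReal_mul (by positivity),
    ← ENNReal.ofReal_mul hC]
  exact ENNReal.ofReal_le_ofReal (H t ψ f ht hψ)

theorem squareG_le_squareGFull (m : ℕ) (f : L2Space n) (x : RSpace n) :
    squareG A m f x ≤ squareGFull A m f x := by
  refine ENNReal.rpow_le_rpow (setLIntegral_mono' measurableSet_Ioi fun t ht => ?_) (by norm_num)
  have ht' : 0 < t := ht
  refine lintegral_mono fun y => ENNReal.div_le_div_right (pow_le_pow_left' ?_ 2) _
  rw [Real.enorm_of_nonneg (by positivity), Real.enorm_of_nonneg (by positivity)]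
  refine ENNReal.ofReal_le_ofReal (mul_le_mul_of_nonneg_left (Real.sqrt_le_sqrt ?_) ht'.le)
  exact le_add_of_nonneg_right (sq_nonneg _)

end Comparison

theorem mainTheorem3 (n : ℕ) (hn : 1 ≤ n) (A : RSpace n → Matrix (Fin n) (Fin n) ℂ)
    (hA : IsElliptic A) :
    -- the heat semigroup exists, and all the objects below are well defined
    (IsHeatSemigroup A (heatSemigroup A) ∧
      ∀ (m : ℕ) (f : L2Space n) (t : ℝ), 0 < t →
        (ellipticOp A)^[m] (heatSemigroup A (t ^ 2) f) ∈ ellipticDomain A ∧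
        HasWeakGradient (heatFamily A m f t) (weakGradient (heatFamily A m f t)) ∧
        DifferentiableAt ℝ (heatFamily A m f) t) ∧
    -- (a)
    (∀ (f : L2Space n) (m : ℕ) (x : RSpace n), squareG A m f x ≤ squareGFull A m f x) ∧
    -- (b)
    (∀ m : ℕ, 1 ≤ m → ∀ w : RSpace n → ℝ, MuckenhouptAInfty w → ∀ p : ℝ, 0 < p →
      ∃ C : ℝ≥0, ∀ f : L2Space n,
        weightedNorm p w (squareS A m f) ≤ C * weightedNorm p w (squareS A 1 f)) ∧
    -- (c)
    (∀ m : ℕ, 1 ≤ m → ∀ w : RSpace n → ℝ, MuckenhouptAInfty w → ∀ p : ℝ, 0 < p →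
      ∃ C : ℝ≥0, ∀ f : L2Space n,
        weightedNorm p w (squareGFull A m f) ≤ C * weightedNorm p w (squareS A 1 f)) := by
  refine ⟨⟨isHeatSemigroup_heatSemigroup hA, fun m f t ht => ⟨?_, ?_, ?_⟩⟩,
    fun f m x => squareG_le_squareGFull m f x, fun m hm w hw p hp => ?_, fun m hm w hw p hp => ?_⟩
  · exact ⟨_, isEllipticImage_iterate hA m (pow_pos ht 2) f⟩
  · exact (isEllipticImage_heatFamily hA m f ht).hasWeakGradient
  · exact (hasDerivAt_heatFamily hA m f ht).differentiableAt
  · obtain ⟨m, rfl⟩ := Nat.exists_eq_add_of_le' hm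
    exact exists_weightedNorm_squareS_le hA m hw hp
  · obtain ⟨m, rfl⟩ := Nat.exists_eq_add_of_le' hm
    exact exists_weightedNorm_squareGFull_le hA m hw hp
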